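/- Let $\{m_n\}_{n\ge1}$ be a sequence of positive integers, $\theta_n:=m_n/n$, $\Theta_+:=\{\theta_n:n\ge1\}$ and $\Theta:=\Theta_+\cup(-\Theta_+)\cup\{0\}$; write $\langle s\rangle=(1+s^2)^{1/2}$. Then there is $W\in C^\infty(\mathbb R;\mathbb R)$ with the following properties. 1. $W(x)=\sum_{\theta\in\Theta}e^{i\theta x}w_\theta(x)$ for all $x\in\mathbb R$ (unconditionally convergent) with $w_\theta\in C^\infty(\mathbb R;\mathbb C)$, and for all integers $k,N\ge0$ there is $C_{k,N}$ such that for all $x\in\mathbb R$ $$|\partial_x^kw_\theta(x)|\le C_{k,N}\langle x\rangle^{-k}\langle\theta\rangle^{-N}\quad(\theta\in\Theta),\qquad |\partial_x^kw_{\pm\theta_n}(x)|\le C_{k,N}\langle x\rangle^{-k}\langle n\rangle^{-N}\quad(n\ge1).$$ (Repetitions among the $\theta_n$ are allowed. If a value of $\Theta_+$ is taken at infinitely many indices, the second bound is required only for the smallest of these indices.) 2. For every $n\ge1$, $\frac{m_n^2}{4n^2}$ is an eigenvalue of the operator $-\Delta+W=-\frac{d^2}{dx^2}+W$ on $L^2(\mathbb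 R;\mathbb C)$ with domain $H^2(\mathbb R)$. 3. If $\{m_n/n:n\ge1\}=\mathbb Q\cap(0,\infty)$, then $-\Delta+W$ has dense pure point spectrum, in the sense that its point spectrum (the set of its eigenvalues) is dense in its spectrum and its closure contains $[0,\infty)$. -/

import Mathlib

open MeasureTheory
open scoped ENNReal SchwartzMap ContDiff Laplacian

noncomputable section

namespace LimitPeriodic

/-! ### Unbounded operators on a Hilbert space: eigenvalues and spectrum -/

section Unbounded

variable {H : Type*} [NormedAddCommGroup H] [InnerProductSpace ℂ H]

/-- The point spectrum of an unbounded operator `T`: the set of its eigenvalues. -/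
def pointSpectrum (T : H →ₗ.[ℂ] H) : Set ℂ :=
  {z | ∃ u : T.domain, u ≠ 0 ∧ T u = z • (u : H)}

/-- The resolvent set of an unbounded operator `T`: those `z` for which `T - z` is a bijection of
the domain of `T` onto the whole space, with a bounded inverse `R`. -/
def resolventSet (T : H →ₗ.[ℂ] H) : Set ℂ :=
  {z | ∃ R : H →L[ℂ] H,
    (∀ f : H, ∃ h : R f ∈ T.domain, T ⟨R f, h⟩ - z • R f = f) ∧
    (∀ u : T.domain, R (T u - z • (u : H)) = u)}

/-- The spectrum of an unbounded operator. -/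
def spectrum (T : H →ₗ.[ℂ] H) : Set ℂ := (resolventSet T)ᶜ

end Unbounded

/-! ### The operator `-d²/dx² + W` on `L²(ℝ)` -/

/-- The Hilbert space `L²(ℝ; ℂ)`. -/
abbrev L2 : Type := Lp ℂ 2 (volume : Measure ℝ)

/-- An `L²` function is determined by the tempered distribution that it defines. -/
theorem toTempered_injective {u v : L2} (h : (u : 𝓢'(ℝ, ℂ)) = (v : 𝓢'(ℝ, ℂ))) : u = v := by
  have hk := MeasureTheory.Lp.ker_toTemperedDistributionCLM_eq_bot (E := ℝ) (F := ℂ)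
    (μ := volume) (p := 2)
  rw [LinearMap.ker_eq_bot] at hk
  exact hk h

/-- The domain: `u ∈ H²(ℝ)` with `W u ∈ L²(ℝ)` (the latter is automatic when `W` is bounded and
continuous, in which case the domain is `H²(ℝ)`). -/
def schrodingerDomain (W : ℝ → ℝ) : Submodule ℂ L2 where
  carrier := {u | TemperedDistribution.MemSobolev 2 2 (u : 𝓢'(ℝ, ℂ)) ∧
    MemLp (fun x => (W x : ℂ) * u x) 2 (volume : Measure ℝ)}
  zero_mem' := by
    refine ⟨?_, ?_⟩
    · rw [← MeasureTheory.Lp.toTemperedDistributionCLM_apply, map_zero]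
      exact TemperedDistribution.memSobolev_fun_zero ℝ ℂ 2 2
    · refine (memLp_congr_ae ?_).mpr (MemLp.zero (ε := ℂ))
      filter_upwards [Lp.coeFn_zero ℂ 2 (volume : Measure ℝ)] with x hx
      rw [hx]
      simp
  add_mem' := by
    rintro u v ⟨hu, hu'⟩ ⟨hv, hv'⟩
    refine ⟨?_, ?_⟩
    · rw [← MeasureTheory.Lp.toTemperedDistributionCLM_apply, map_add]
      exact hu.add hv
    · refine (memLp_congr_ae ?_).mpr (hu'.add hv')
      filter_upwards [Lp.coeFn_add u v] with x hx
      rw [hx, Pi.add_apply, Pi.add_apply, mul_add]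
  smul_mem' := by
    rintro c u ⟨hu, hu'⟩
    refine ⟨?_, ?_⟩
    · rw [← MeasureTheory.Lp.toTemperedDistributionCLM_apply, map_smul]
      exact hu.smul c
    · refine (memLp_congr_ae ?_).mpr (hu'.const_mul c)
      filter_upwards [Lp.coeFn_smul c u] with x hx
      simp only [hx, Pi.smul_apply, smul_eq_mul]
      ring

/-- The distributional second derivative of a function in `H²(ℝ)` is in `L²(ℝ)`. -/
theorem exists_laplacian {W : ℝ → ℝ} (u : schrodingerDomain W) :
    ∃ v : L2, Δ ((u : L2) : 𝓢'(ℝ, ℂ)) = (v : 𝓢'(ℝ, ℂ)) := by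
  have h := u.2.1.laplacian
  rw [sub_self] at h
  exact TemperedDistribution.memSobolev_zero_iff.mp h

/-- The second derivative `u''` of `u` in the domain, as an element of `L²(ℝ)`. -/
def secondDeriv {W : ℝ → ℝ} (u : schrodingerDomain W) : L2 := (exists_laplacian u).choose

theorem secondDeriv_spec {W : ℝ → ℝ} (u : schrodingerDomain W) :
    Δ ((u : L2) : 𝓢'(ℝ, ℂ)) = (secondDeriv u : 𝓢'(ℝ, ℂ)) := (exists_laplacian u).choose_spec

/-- The product `W u`, as an element of `L²(ℝ)`. -/
def potentialMul {W : ℝ → ℝ} (u : schrodingerDomain W) : L2 := u.2.2.toLp _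

/-- The operator `-Δ + W : u ↦ -u'' + W u` on `L²(ℝ)`. -/
def schrodinger (W : ℝ → ℝ) : L2 →ₗ.[ℂ] L2 where
  domain := schrodingerDomain W
  toFun :=
    { toFun := fun u => -secondDeriv u + potentialMul u
      map_add' := by
        intro u v
        have h1 : secondDeriv (u + v) = secondDeriv u + secondDeriv v := by
          apply toTempered_injective
          rw [← secondDeriv_spec]
          simp only [← MeasureTheory.Lp.toTemperedDistributionCLM_apply,
            ← TemperedDistribution.laplacianCLM_apply, map_add, Submodule.coe_add]
          simp [secondDeriv_spec]
        have h2 : potentialMul (u + v) = potentialMul u + potentialMul v := by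
          apply Lp.ext
          filter_upwards [Lp.coeFn_add (potentialMul u) (potentialMul v), u.2.2.coeFn_toLp,
            v.2.2.coeFn_toLp, (u + v).2.2.coeFn_toLp, Lp.coeFn_add (u : L2) (v : L2)]
            with x a b c d e
          rw [a, Pi.add_apply]
          unfold potentialMul
          rw [b, c, d, Submodule.coe_add, e, Pi.add_apply, mul_add]
        rw [h1, h2]
        abel
      map_smul' := by
        intro c u
        have h1 : secondDeriv (c • u) = c • secondDeriv u := by
          apply toTempered_injective
          rw [← secondDeriv_spec]
          simp only [← MeasureTheory.Lp.toTemperedDistributionCLM_apply,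
            ← TemperedDistribution.laplacianCLM_apply, map_smul, Submodule.coe_smul]
          simp [secondDeriv_spec]
        have h2 : potentialMul (c • u) = c • potentialMul u := by
          apply Lp.ext
          filter_upwards [Lp.coeFn_smul c (potentialMul u), u.2.2.coeFn_toLp,
            (c • u).2.2.coeFn_toLp, Lp.coeFn_smul c (u : L2)] with x a b d e
          rw [a, Pi.smul_apply]
          unfold potentialMul
          rw [b, d, Submodule.coe_smul, e, Pi.smul_apply, smul_eq_mul, smul_eq_mul]
          ring
        rw [h1, h2, smul_add, smul_neg, RingHom.id_apply] }

/-! ### Limit-periodic coefficients -/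

/-- The Japanese bracket `⟨x⟩ = (1 + x²)^{1/2}`. -/
def bracket (x : ℝ) : ℝ := Real.sqrt (1 + x ^ 2)

/-- The frequency `θ_n = m_n / n`, for `n ≥ 1`. -/
def freq (m : ℕ+ → ℕ+) (n : ℕ+) : ℝ := (m n : ℝ) / (n : ℝ)

/-- The frequency set `Θ = Θ₊ ∪ (-Θ₊) ∪ {0}` with `Θ₊ = {θ_n : n ≥ 1}`. -/
def freqSet (m : ℕ+ → ℕ+) : Set ℝ :=
  {θ | ∃ n, θ = freq m n} ∪ {θ | ∃ n, θ = -freq m n} ∪ {0}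

/-- The index `n` counts for the decay in `n`. If the value `θ_n` is taken at only finitely many
indices (for instance, if the `θ_n` are distinct), every index of it counts; a value that is
repeated infinitely often (where decay along all its indices would force the coefficient to vanish)
is labelled by its smallest index only. -/
def IndexCounts (m : ℕ+ → ℕ+) (n : ℕ+) : Prop :=
  {k | freq m k = freq m n}.Finite ∨ ∀ k, freq m k = freq m n → n ≤ k

/-- `V` is a smooth real function of the form `V(x) = ∑_{θ ∈ Θ} e^{iθx} w_θ(x)` with
`|∂ₓᵏ w_θ(x)| ≤ C_{k,N} ⟨x⟩^{-k} ⟨θ⟩^{-N}` and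
`|∂ₓᵏ w_{±θ_n}(x)| ≤ C_{k,N} ⟨x⟩^{-k} ⟨n⟩^{-N}`. -/
def IsLimitPeriodicCoefficient (m : ℕ+ → ℕ+) (V : ℝ → ℝ) : Prop :=
  ContDiff ℝ ∞ V ∧
  ∃ w : ℝ → ℝ → ℂ,
    (∀ θ ∈ freqSet m, ContDiff ℝ ∞ (w θ)) ∧
    (∀ x : ℝ, HasSum
      (fun θ : freqSet m => Complex.exp (Complex.I * ((θ : ℝ) : ℂ) * (x : ℂ)) * w θ x)
      (V x : ℂ)) ∧
    (∀ k N : ℕ, ∃ C : ℝ, ∀ θ ∈ freqSet m, ∀ x : ℝ,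
      ‖iteratedDeriv k (w θ) x‖ ≤ C * (bracket x ^ k)⁻¹ * (bracket θ ^ N)⁻¹) ∧
    (∀ k N : ℕ, ∃ C : ℝ, ∀ n : ℕ+, IndexCounts m n → ∀ x : ℝ,
      ‖iteratedDeriv k (w (freq m n)) x‖ ≤ C * (bracket x ^ k)⁻¹ * (bracket n ^ N)⁻¹ ∧
      ‖iteratedDeriv k (w (-freq m n)) x‖ ≤ C * (bracket x ^ k)⁻¹ * (bracket n ^ N)⁻¹)

/-- The limit-periodic hypotheses on the first-order perturbation `W₁ Dₓ + Dₓ W₁ + W₀`. -/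
def LimitPeriodicHypotheses (m : ℕ+ → ℕ+) (W₁ W₀ : ℝ → ℝ) : Prop :=
  IsLimitPeriodicCoefficient m W₁ ∧ IsLimitPeriodicCoefficient m W₀

end LimitPeriodic

end

/-!
The potential is built block by block on the dyadic intervals `2 ^ j ≤ |x| ≤ 2 ^ (j + 1)`. For
`u = 2 Re (c e^{iκx})`, a real solution of `u'' = (W - κ²) u`, the complex amplitude `c` obeys a
first-order equation in which a term `(24 θ / h) Re (z e^{iθx})` of the potential with `θ = 2κ`
acts resonantly on the scale `h = 2 ^ j`, whereas all other frequencies average out as `h → ∞`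
(`norm_le_of_averaging`). If `z` is aligned with the phase of `c` at the left end of the block, the
amplitude shrinks by a factor `4` across the block (`eventually_block_reduction`). So the phases
are chosen adaptively: the amplitudes of all solutions at `2 ^ j` determine the `j`-th block, and
the equation on this block determines the amplitudes at `2 ^ (j + 1)` (`Schedule.state`). Each
block involves finitely many frequencies, and every frequency is present from some block on; it
joins so late that its coefficient is as small as required, and that the averaging estimate applies
to the frequencies present (`nonempty_schedule`). An amplitude that is divided by `4` while `x`
doubles is `O(⟨x⟩⁻²)`; as the potential is even and the solution odd, this holds on both sides
(`Schedule.exists_decaying_solution`), and `u` is an eigenfunction for `κ² = (θ / 2)²`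
(`mem_pointSpectrum_of_solution`).

Cutoffs rescaled to dyadic blocks with bounded amplitudes are symbols of order `0`
(`exists_symbol_bound`), and this makes the potential limit-periodic
(`Schedule.isLimitPeriodicCoefficient_potential`).

For the spectrum, each block contains a further positive term of size `h⁻²`, which does not affect
the averaging. The oscillating part of a block is `q'` up to terms of size `h⁻²`, where `q` is of
size `h⁻¹`; the additional term dominates these and `q²`, so `W ≥ q' + q²`
(`Schedule.exists_riccati`). Hence the quadratic form of `-Δ + W` is nonnegative on Schwartz
functions (`energy_nonneg`). The resolvent is constructed by hand: `1 - Δ / μ` with `μ = (2π)²` has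
a Bessel potential as its inverse, a Neumann series yields `S = (-Δ + W + μ)⁻¹`, and the
positivity, carried over to `S` by density, gives `σ(-Δ + W) ⊆ [0, ∞)`
(`spectrum_schrodinger_subset`). If the `θₙ` exhaust the positive rationals, the eigenvalues
`(θₙ / 2)²` are dense in `[0, ∞)`.
-/

namespace LimitPeriodic

open Set Filter Topology
open scoped NNReal ComplexConjugate

/-! ### Global solutions of Lipschitz differential equations -/

/-- The retraction of `ℂ` onto the square `[-M, M]²`. Composing a Lipschitz vector field with it
makes the field bounded, so that the Picard-Lindelöf theorem applies on intervals of any length. -/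
noncomputable def clamp (M : ℝ) (z : ℂ) : ℂ := ⟨max (-M) (min M z.re), max (-M) (min M z.im)⟩

theorem norm_le_norm_of_abs_le {z w : ℂ} (h1 : |z.re| ≤ |w.re|) (h2 : |z.im| ≤ |w.im|) :
    ‖z‖ ≤ ‖w‖ := by
  apply le_of_sq_le_sq _ (norm_nonneg _)
  rw [Complex.sq_norm, Complex.sq_norm, Complex.normSq_apply, Complex.normSq_apply]
  have := sq_le_sq.mpr h1
  have := sq_le_sq.mpr h2
  nlinarith

theorem norm_clamp_sub_le (M : ℝ) (z w : ℂ) : ‖clamp M z - clamp M w‖ ≤ ‖z - w‖ := by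
  have key : ∀ a b : ℝ, |max (-M) (min M a) - max (-M) (min M b)| ≤ |a - b| := fun a b =>
    (abs_max_sub_max_le_max _ _ _ _).trans
      (max_le (by simp) ((abs_min_sub_min_le_max _ _ _ _).trans (max_le (by simp) le_rfl)))
  exact norm_le_norm_of_abs_le (by simpa [clamp] using key z.re w.re)
    (by simpa [clamp] using key z.im w.im)

theorem clamp_zero {M : ℝ} (hM : 0 ≤ M) : clamp M 0 = 0 := by
  apply Complex.ext <;> simp [clamp, hM]

theorem clamp_eq_self {M : ℝ} {z : ℂ} (hz : ‖z‖ ≤ M) : clamp M z = z := by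
  have h1 := abs_le.mp ((Complex.abs_re_le_norm z).trans hz)
  have h2 := abs_le.mp ((Complex.abs_im_le_norm z).trans hz)
  apply Complex.ext
  · simp [clamp, h1]
  · simp [clamp, h2]

theorem norm_clamp_le {M : ℝ} (hM : 0 ≤ M) (z : ℂ) : ‖clamp M z‖ ≤ 2 * M := by
  refine (Complex.norm_le_abs_re_add_abs_im _).trans ?_
  have key : ∀ a : ℝ, |max (-M) (min M a)| ≤ M := fun a => by
    rw [abs_le]
    exact ⟨le_max_left _ _, max_le (by linarith) (min_le_left _ _)⟩
  have h1 := key z.re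
  have h2 := key z.im
  simp only [clamp]
  linarith

section GlobalSolutions

variable {f : ℝ → ℂ → ℂ} {K : ℝ≥0}

/-- Grönwall's inequality for a homogeneous linear bound. -/
theorem norm_le_exp_of_hasDerivAt {α α' : ℝ → ℂ} {C a b : ℝ}
    (hα : ContinuousOn α (Icc a b))
    (hd : ∀ t ∈ Ico a b, HasDerivWithinAt α (α' t) (Ici t) t)
    (hb : ∀ t ∈ Ico a b, ‖α' t‖ ≤ C * ‖α t‖) :
    ∀ t ∈ Icc a b, ‖α t‖ ≤ ‖α a‖ * Real.exp (C * (t - a)) := by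
  intro t ht
  have := norm_le_gronwallBound_of_norm_deriv_right_le (K := C) (ε := 0) hα hd le_rfl
    (fun t ht => by simpa using hb t ht) t ht
  rwa [gronwallBound_ε0] at this

theorem exists_solution_Icc (hf : ∀ t, LipschitzWith K (f t)) (hc : ∀ x, Continuous (f · x))
    (h0 : ∀ t, f t 0 = 0) (t₀ : ℝ) (x₀ : ℂ) {T : ℝ} (hT : 0 < T) :
    ∃ α : ℝ → ℂ, α t₀ = x₀ ∧ ContinuousOn α (Icc (t₀ - T) (t₀ + T)) ∧
      ∀ t ∈ Ioo (t₀ - T) (t₀ + T), HasDerivAt α (f t (α t)) t := by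
  have hfn : ∀ t x, ‖f t x‖ ≤ K * ‖x‖ := fun t x => by
    have := (hf t).dist_le_mul x 0
    simpa [h0, dist_eq_norm] using this
  set M : ℝ := ‖x₀‖ * Real.exp (K * T) with hM
  have hM0 : 0 ≤ M := by positivity
  set g : ℝ → ℂ → ℂ := fun t x => f t (clamp M x) with hg
  have hmem : t₀ ∈ Icc (t₀ - T) (t₀ + T) := ⟨by linarith, by linarith⟩
  have hpl : IsPicardLindelof g (tmin := t₀ - T) (tmax := t₀ + T) ⟨t₀, hmem⟩ x₀
      ((K * (2 * M.toNNReal)) * T.toNNReal) 0 (K * (2 * M.toNNReal)) K := by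
    refine ⟨fun t _ => ?_, fun x _ => ?_, fun t _ x _ => ?_, ?_⟩
    · refine LipschitzWith.lipschitzOnWith (LipschitzWith.of_dist_le_mul fun x y => ?_)
      refine ((hf t).dist_le_mul _ _).trans ?_
      gcongr
      rw [dist_eq_norm, dist_eq_norm]
      exact norm_clamp_sub_le _ _ _
    · exact (hc _).continuousOn
    · refine (hfn t _).trans ?_
      push_cast
      rw [Real.coe_toNNReal _ hM0]
      gcongr
      exact norm_clamp_le hM0 x
    · simp [hT.le]
  obtain ⟨α, hα0, hα⟩ := hpl.exists_eq_forall_mem_Icc_hasDerivWithinAt₀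
  have hcont : ContinuousOn α (Icc (t₀ - T) (t₀ + T)) := fun t ht => (hα t ht).continuousWithinAt
  have hder : ∀ t ∈ Ioo (t₀ - T) (t₀ + T), HasDerivAt α (g t (α t)) t := fun t ht =>
    (hα t (Ioo_subset_Icc_self ht)).hasDerivAt (Icc_mem_nhds ht.1 ht.2)
  have hgn : ∀ t x, ‖g t x‖ ≤ K * ‖x‖ := fun t x => by
    refine (hfn t _).trans ?_
    gcongr
    simpa [clamp_zero hM0] using norm_clamp_sub_le M x 0
  -- Grönwall's inequality keeps the solution in the region where the truncation is inactive.
  have hbound : ∀ t ∈ Icc (t₀ - T) (t₀ + T), ‖α t‖ ≤ M := by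
    intro t ht
    rcases le_total t₀ t with h | h
    · have h2 := norm_le_exp_of_hasDerivAt (α := α) (α' := fun t => g t (α t)) (C := K)
        (a := t₀) (b := t₀ + T) (hcont.mono (Icc_subset_Icc (by linarith) le_rfl))
        (fun s hs => (hder s ⟨by linarith [hs.1], hs.2⟩).hasDerivWithinAt) (fun s _ => hgn s _) t
        ⟨h, ht.2⟩
      refine h2.trans ?_
      change ‖α t₀‖ * _ ≤ _
      rw [show α t₀ = x₀ from hα0, hM]
      gcongr
      linarith [ht.2]
    · have hcomp : ContinuousOn (fun s => α (-s)) (Icc (-t₀) (-t₀ + T)) :=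
        hcont.comp (continuous_neg.continuousOn) fun s hs => ⟨by linarith [hs.2], by linarith [hs.1]⟩
      have h2 := norm_le_exp_of_hasDerivAt (α := fun s => α (-s)) (α' := fun t => -g (-t) (α (-t)))
        (C := K) (a := -t₀) (b := -t₀ + T) hcomp
        (fun s hs => by
          have h3 := (hder (-s) ⟨by linarith [hs.2], by linarith [hs.1]⟩).scomp s (hasDerivAt_neg s)
          simpa [Function.comp_def] using h3.hasDerivWithinAt)
        (fun s _ => by rw [norm_neg]; exact hgn _ _) (-t) ⟨by linarith, by linarith [ht.1]⟩
      simp only [neg_neg] at h2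
      refine h2.trans ?_
      rw [show α t₀ = x₀ from hα0, hM]
      gcongr
      linarith [ht.1]
  refine ⟨α, hα0, hcont, fun t ht => ?_⟩
  have := hder t ht
  simp only [hg] at this
  rwa [clamp_eq_self (hbound t (Ioo_subset_Icc_self ht))] at this

/-- A vector field on `ℂ` that is uniformly Lipschitz, continuous in time and vanishes at the
origin has global solutions. -/
theorem exists_global_solution (hf : ∀ t, LipschitzWith K (f t)) (hc : ∀ x, Continuous (f · x))
    (h0 : ∀ t, f t 0 = 0) (t₀ : ℝ) (x₀ : ℂ) :
    ∃ α : ℝ → ℂ, α t₀ = x₀ ∧ ∀ t, HasDerivAt α (f t (α t)) t := by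
  choose α hα0 hαc hα using fun n : ℕ => exists_solution_Icc hf hc h0 t₀ x₀ (T := n + 1)
    (by positivity)
  have hagree : ∀ n k : ℕ, n ≤ k → EqOn (α n) (α k) (Ioo (t₀ - (n + 1)) (t₀ + (n + 1))) := by
    intro n k hnk
    have hnk' : (n : ℝ) ≤ k := by exact_mod_cast hnk
    refine ODE_solution_unique_of_mem_Ioo (v := f) (s := fun _ => univ) (K := K) (t₀ := t₀)
      (fun t _ => (hf t).lipschitzOnWith) ⟨?_, ?_⟩ (fun t ht => ⟨hα n t ht, mem_univ _⟩)
      (fun t ht => ⟨hα k t ⟨?_, ?_⟩, mem_univ _⟩) ?_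
    · have : (0 : ℝ) ≤ n := n.cast_nonneg
      linarith
    · have : (0 : ℝ) ≤ n := n.cast_nonneg
      linarith
    · linarith [ht.1]
    · linarith [ht.2]
    · rw [hα0, hα0]
  have hex : ∀ t, ∃ n : ℕ, t ∈ Ioo (t₀ - (n + 1)) (t₀ + (n + 1)) := fun t => by
    obtain ⟨n, hn⟩ := exists_nat_ge |t - t₀|
    have := abs_le.mp hn
    exact ⟨n, by linarith, by linarith⟩
  choose N hN using hex
  have hglue : ∀ n : ℕ, ∀ t ∈ Ioo (t₀ - (n + 1)) (t₀ + (n + 1)), α (N t) t = α n t := by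
    intro n t ht
    rcases le_total n (N t) with h | h
    · exact (hagree _ _ h ht).symm
    · exact hagree _ _ h (hN t)
  refine ⟨fun t => α (N t) t, hα0 _, fun t => ?_⟩
  refine (hα (N t) t (hN t)).congr_of_eventuallyEq ?_
  filter_upwards [Ioo_mem_nhds (hN t).1 (hN t).2] with s hs
  exact hglue _ s hs

end GlobalSolutions

/-! ### Complex amplitudes -/

/-- The vector field governing the complex amplitude `c` of a real solution
`u = 2 Re (c e^{iκx})` of `u'' = (V - κ²) u`, under the constraint `u' = 2 Re (iκ c e^{iκx})`. -/
noncomputable def ampField (V : ℝ → ℝ) (κ : ℝ) (x : ℝ) (c : ℂ) : ℂ :=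
  (V x / (2 * κ) : ℝ) * (-Complex.I) * (c + conj c * Complex.exp (-(2 * κ * x : ℝ) * Complex.I))

theorem norm_ampField_le (V : ℝ → ℝ) {κ : ℝ} (hκ : 0 < κ) (x : ℝ) (c : ℂ) :
    ‖ampField V κ x c‖ ≤ |V x| / κ * ‖c‖ := by
  unfold ampField
  have h1 : ‖c + conj c * Complex.exp (-(2 * κ * x : ℝ) * Complex.I)‖ ≤ 2 * ‖c‖ := by
    refine (norm_add_le _ _).trans ?_
    rw [norm_mul, ← Complex.ofReal_neg, Complex.norm_exp_ofReal_mul_I, RCLike.norm_conj]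
    linarith
  rw [norm_mul, norm_mul, norm_neg, Complex.norm_I, Complex.norm_real, Real.norm_eq_abs, abs_div,
    abs_of_pos (show 0 < 2 * κ by positivity)]
  calc _ ≤ |V x| / (2 * κ) * 1 * (2 * ‖c‖) := by gcongr
    _ = _ := by field_simp

theorem ampField_sub (V : ℝ → ℝ) (κ x : ℝ) (c d : ℂ) :
    ampField V κ x c - ampField V κ x d = ampField V κ x (c - d) := by
  simp only [ampField, map_sub]
  ring

theorem ampField_lipschitz {V : ℝ → ℝ} {M : ℝ≥0} (hV : ∀ x, |V x| ≤ M) {κ : ℝ} (hκ : 0 < κ)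
    (x : ℝ) : LipschitzWith (M / κ.toNNReal) (ampField V κ x) := by
  refine LipschitzWith.of_dist_le_mul fun c d => ?_
  rw [dist_eq_norm, dist_eq_norm, ampField_sub]
  refine (norm_ampField_le V hκ x _).trans ?_
  rw [NNReal.coe_div, Real.coe_toNNReal _ hκ.le]
  gcongr
  exact hV x

theorem exists_amplitude {V : ℝ → ℝ} (hc : Continuous V) {M : ℝ} (hV : ∀ x, |V x| ≤ M) {κ : ℝ}
    (hκ : 0 < κ) (x₀ : ℝ) (c₀ : ℂ) :
    ∃ c : ℝ → ℂ, c x₀ = c₀ ∧ ∀ x, HasDerivAt c (ampField V κ x (c x)) x := by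
  have hM : 0 ≤ M := (abs_nonneg _).trans (hV 0)
  refine exists_global_solution (K := ⟨M, hM⟩ / κ.toNNReal) (f := ampField V κ)
    (ampField_lipschitz hV hκ) (fun c => ?_) (fun t => by simp [ampField]) x₀ c₀
  unfold ampField
  fun_prop

theorem amplitude_unique {V : ℝ → ℝ} {M : ℝ} (hV : ∀ x, |V x| ≤ M) {κ : ℝ} (hκ : 0 < κ)
    {c d : ℝ → ℂ} (hc : ∀ x, HasDerivAt c (ampField V κ x (c x)) x)
    (hd : ∀ x, HasDerivAt d (ampField V κ x (d x)) x) {x₀ : ℝ} (h : c x₀ = d x₀) : c = d := by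
  have hM : 0 ≤ M := (abs_nonneg _).trans (hV 0)
  exact ODE_solution_unique_univ (v := ampField V κ) (s := fun _ => univ) (K := ⟨M, hM⟩ / κ.toNNReal)
    (fun x => (ampField_lipschitz (M := ⟨M, hM⟩) hV hκ x).lipschitzOnWith)
    (fun t => ⟨hc t, mem_univ _⟩) (fun t => ⟨hd t, mem_univ _⟩) h

theorem amplitude_unique_Icc {V V' : ℝ → ℝ} {M : ℝ} (hV : ∀ x, |V x| ≤ M) {κ : ℝ} (hκ : 0 < κ)
    {a b : ℝ} (hVV : ∀ x ∈ Icc a b, V' x = V x)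
    {c d : ℝ → ℂ} (hc : ∀ x, HasDerivAt c (ampField V κ x (c x)) x)
    (hd : ∀ x, HasDerivAt d (ampField V' κ x (d x)) x) (h : c a = d a) :
    EqOn c d (Icc a b) := by
  have hM : 0 ≤ M := (abs_nonneg _).trans (hV 0)
  refine ODE_solution_unique (v := ampField V κ) (K := ⟨M, hM⟩ / κ.toNNReal)
    (fun x => ampField_lipschitz (M := ⟨M, hM⟩) hV hκ x)
    (fun t _ => (hc t).continuousAt.continuousWithinAt) (fun t _ => (hc t).hasDerivWithinAt)
    (fun t _ => (hd t).continuousAt.continuousWithinAt) (fun t ht => ?_) h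
  have := (hd t).hasDerivWithinAt (s := Ici t)
  unfold ampField at this ⊢
  rwa [hVV t ⟨ht.1, ht.2.le⟩] at this

theorem hasDerivAt_exp_mul_I (κ x : ℝ) :
    HasDerivAt (fun x : ℝ => Complex.exp ((κ * x : ℝ) * Complex.I))
      (Complex.exp ((κ * x : ℝ) * Complex.I) * (κ * Complex.I)) x := by
  have h : HasDerivAt (fun x : ℝ => ((κ * x : ℝ) : ℂ) * Complex.I) (κ * Complex.I) x := by
    have := ((hasDerivAt_id x).const_mul κ).ofReal_comp.mul_const Complex.I
    simpa using this
  exact h.cexp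

/-- An amplitude solves the first-order system equivalent to `u'' = (V - κ²) u`. -/
theorem hasDerivAt_of_amplitude {V : ℝ → ℝ} {κ : ℝ} (hκ : 0 < κ) {c : ℝ → ℂ} {x : ℝ}
    (hc : HasDerivAt c (ampField V κ x (c x)) x) :
    HasDerivAt (fun x : ℝ => 2 * (c x * Complex.exp ((κ * x : ℝ) * Complex.I)).re)
      (-(2 * κ) * (c x * Complex.exp ((κ * x : ℝ) * Complex.I)).im) x ∧
    HasDerivAt (fun x : ℝ => -(2 * κ) * (c x * Complex.exp ((κ * x : ℝ) * Complex.I)).im)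
      ((V x - κ ^ 2) * (2 * (c x * Complex.exp ((κ * x : ℝ) * Complex.I)).re)) x := by
  set e := Complex.exp ((κ * x : ℝ) * Complex.I) with he
  set g := c x * e with hg
  have hee : Complex.exp (-(2 * κ * x : ℝ) * Complex.I) * e = conj e := by
    rw [he, ← Complex.exp_add, ← Complex.exp_conj]
    congr 1
    simp
    ring
  have hd := hc.mul (hasDerivAt_exp_mul_I κ x)
  have hval : ampField V κ x (c x) * Complex.exp ((κ * x : ℝ) * Complex.I) +
      c x * (Complex.exp ((κ * x : ℝ) * Complex.I) * (κ * Complex.I)) =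
      ((V x / (2 * κ) : ℝ) : ℂ) * (-Complex.I) * (2 * g.re : ℝ) + κ * (Complex.I * g) := by
    rw [← he, ampField]
    have h2 : ((2 * g.re : ℝ) : ℂ) = g + conj g := by
      rw [Complex.add_conj]
    rw [h2, hg, map_mul, ← hee]
    ring
  obtain ⟨v, hv⟩ : ∃ v, v = V x / (2 * κ) := ⟨_, rfl⟩
  have hVv : V x = v * (2 * κ) := by rw [hv]; field_simp
  rw [hval, ← hv] at hd
  have hre := (Complex.reCLM.hasFDerivAt.comp_hasDerivAt x hd).const_mul 2
  have him := (Complex.imCLM.hasFDerivAt.comp_hasDerivAt x hd).const_mul (-(2 * κ))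
  constructor
  · refine hre.congr_deriv ?_
    simp [Complex.mul_re, Complex.mul_im]
    ring
  · refine him.congr_deriv ?_
    rw [hVv]
    simp [Complex.mul_re, Complex.mul_im]
    ring

/-! ### Cutoff functions -/

/-- The cutoff that localises the oscillating part of the potential to a dyadic block. -/
noncomputable def bump : ContDiffBump (3 / 2 : ℝ) := ⟨1 / 8, 1 / 4, by norm_num, by norm_num⟩

/-- A wider cutoff, equal to `1` on the support of `bump`. -/
noncomputable def wideBump : ContDiffBump (3 / 2 : ℝ) := ⟨1 / 4, 3 / 8, by norm_num, by norm_num⟩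

theorem bump_ne_zero {x : ℝ} (h : bump x ≠ 0) : 5 / 4 < x ∧ x < 7 / 4 := by
  have : x ∈ Metric.ball (3 / 2 : ℝ) (1 / 4) := by
    have := bump.support_eq ▸ (Function.mem_support.mpr h)
    exact this
  rw [Metric.mem_ball, Real.dist_eq, abs_lt] at this
  constructor <;> linarith

theorem wideBump_ne_zero {x : ℝ} (h : wideBump x ≠ 0) : 9 / 8 < x ∧ x < 15 / 8 := by
  have : x ∈ Metric.ball (3 / 2 : ℝ) (3 / 8) := by
    have := wideBump.support_eq ▸ (Function.mem_support.mpr h)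
    exact this
  rw [Metric.mem_ball, Real.dist_eq, abs_lt] at this
  constructor <;> linarith

theorem bump_eq_one {x : ℝ} (h1 : 11 / 8 ≤ x) (h2 : x ≤ 13 / 8) : bump x = 1 := by
  apply bump.one_of_mem_closedBall
  change x ∈ Metric.closedBall (3 / 2 : ℝ) (1 / 8)
  rw [Metric.mem_closedBall, Real.dist_eq, abs_le]
  constructor <;> linarith

theorem wideBump_eq_one {x : ℝ} (h1 : 5 / 4 ≤ x) (h2 : x ≤ 7 / 4) : wideBump x = 1 := by
  apply wideBump.one_of_mem_closedBall
  change x ∈ Metric.closedBall (3 / 2 : ℝ) (1 / 4)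
  rw [Metric.mem_closedBall, Real.dist_eq, abs_le]
  constructor <;> linarith

theorem exists_deriv_bump_le : ∃ M : ℝ, 0 ≤ M ∧ ∀ x, |deriv bump x| ≤ M := by
  have hc : Continuous (deriv bump) := (bump.contDiff (n := 1)).continuous_deriv le_rfl
  obtain ⟨M, hM⟩ := hc.bounded_above_of_compact_support bump.hasCompactSupport.deriv
  exact ⟨M, (norm_nonneg _).trans (hM 0), fun x => by simpa using hM x⟩

/-- A bound for the derivative of `bump`. -/
noncomputable def bumpSlope : ℝ := exists_deriv_bump_le.choose

theorem bumpSlope_nonneg : 0 ≤ bumpSlope := exists_deriv_bump_le.choose_spec.1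

theorem abs_deriv_bump_le (x : ℝ) : |deriv bump x| ≤ bumpSlope :=
  exists_deriv_bump_le.choose_spec.2 x

theorem abs_deriv_bump_le_wideBump (x : ℝ) : |deriv bump x| ≤ bumpSlope * wideBump x := by
  by_cases h : 5 / 4 ≤ x ∧ x ≤ 7 / 4
  · rw [wideBump_eq_one h.1 h.2, mul_one]
    exact abs_deriv_bump_le x
  · have hz : (bump : ℝ → ℝ) =ᶠ[𝓝 x] fun _ => 0 := by
      have hx : x ∈ (Icc (5 / 4 : ℝ) (7 / 4))ᶜ := fun hx => h hx
      filter_upwards [isClosed_Icc.isOpen_compl.mem_nhds hx] with y hy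
      by_contra hne
      exact hy ⟨(bump_ne_zero hne).1.le, (bump_ne_zero hne).2.le⟩
    rw [hz.deriv_eq]
    simpa using mul_nonneg bumpSlope_nonneg (wideBump.nonneg' x)

theorem bump_le_wideBump (x : ℝ) : bump x ≤ wideBump x := by
  by_cases h : bump x = 0
  · rw [h]
    exact wideBump.nonneg' x
  · rw [wideBump_eq_one (bump_ne_zero h).1.le (bump_ne_zero h).2.le]
    exact bump.le_one

/-! ### Gluing along dyadic blocks -/

/-- The index `j` of the dyadic block `2 ^ j ≤ |x| < 2 ^ (j + 1)` containing `x`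
(and `0` if `|x| < 1`). -/
noncomputable def dyadic (x : ℝ) : ℕ := Nat.log 2 ⌊|x|⌋₊

theorem dyadic_eq {x : ℝ} {j : ℕ} (h1 : (2 : ℝ) ^ j ≤ |x|) (h2 : |x| < 2 ^ (j + 1)) :
    dyadic x = j := by
  have hx : 0 ≤ |x| := abs_nonneg x
  apply Nat.log_eq_of_pow_le_of_lt_pow
  · rw [Nat.le_floor_iff hx]
    exact_mod_cast h1
  · rw [Nat.floor_lt hx]
    exact_mod_cast h2

theorem dyadic_of_lt_one {x : ℝ} (h : |x| < 1) : dyadic x = 0 := by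
  rw [dyadic, Nat.floor_eq_zero.mpr h, Nat.log_zero_right]

theorem lt_two_pow_dyadic_succ (x : ℝ) : |x| < 2 ^ (dyadic x + 1) := by
  have h := Nat.lt_pow_succ_log_self (b := 2) (by norm_num) ⌊|x|⌋₊
  have h2 := (Nat.floor_lt (abs_nonneg x)).mp h
  exact_mod_cast h2

theorem two_pow_dyadic_le {x : ℝ} (h : 1 ≤ |x|) : (2 : ℝ) ^ dyadic x ≤ |x| := by
  have h0 : ⌊|x|⌋₊ ≠ 0 := (Nat.floor_pos.mpr h).ne'
  have h1 := Nat.pow_log_le_self 2 h0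
  have h2 := (Nat.le_floor_iff (abs_nonneg x)).mp h1
  exact_mod_cast h2

theorem dyadic_neg (x : ℝ) : dyadic (-x) = dyadic x := by
  rw [dyadic, dyadic, abs_neg]

theorem bracket_pos (x : ℝ) : 0 < bracket x := Real.sqrt_pos.mpr (by positivity)

theorem bracket_le_one_add_abs (x : ℝ) : bracket x ≤ 1 + |x| := by
  rw [bracket, Real.sqrt_le_left (by positivity)]
  nlinarith [sq_abs x, abs_nonneg x]

theorem bracket_le_dyadic (x : ℝ) : bracket x ≤ 4 * 2 ^ dyadic x := by
  have h1 := bracket_le_one_add_abs x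
  have h2 := lt_two_pow_dyadic_succ x
  have h3 : (1 : ℝ) ≤ 2 ^ dyadic x := one_le_pow₀ (by norm_num)
  rw [pow_succ] at h2
  linarith

/-- The function that agrees with `f j` on the `j`-th dyadic block. -/
noncomputable def glue {E : Type*} (f : ℕ → ℝ → E) (x : ℝ) : E := f (dyadic x) x

/-- The functions `f j` are supported well inside the respective dyadic blocks, so that gluing them
creates no singularity. -/
def IsBlockFamily {E : Type*} [Zero E] (f : ℕ → ℝ → E) : Prop :=
  ∀ j y, f j y ≠ 0 → 9 / 8 * (2 : ℝ) ^ j < |y| ∧ |y| < 15 / 8 * (2 : ℝ) ^ j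

theorem IsBlockFamily.glue_eventuallyEq {E : Type*} [Zero E] {f : ℕ → ℝ → E}
    (hf : IsBlockFamily f) (x : ℝ) : glue f =ᶠ[𝓝 x] f (dyadic x) := by
  have key : ∀ᶠ y in 𝓝 x, ∀ i, i ≠ dyadic x → f i y = 0 := by
    have hpos : (0 : ℝ) < 2 ^ dyadic x := by positivity
    have h1 : ∀ᶠ y in 𝓝 x, |y| < 17 / 16 * 2 ^ (dyadic x + 1) :=
      continuous_abs.continuousAt.eventually_lt continuousAt_const
        (by linarith [lt_two_pow_dyadic_succ x, pow_succ (2 : ℝ) (dyadic x)])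
    have h2 : ∀ᶠ y in 𝓝 x, dyadic x = 0 ∨ 15 / 16 * 2 ^ dyadic x < |y| := by
      by_cases h0 : dyadic x = 0
      · exact Eventually.of_forall fun _ => Or.inl h0
      · have hx : 1 ≤ |x| := by
          by_contra hlt
          exact h0 (dyadic_of_lt_one (not_le.mp hlt))
        have h3 : ∀ᶠ y in 𝓝 x, 15 / 16 * 2 ^ dyadic x < |y| :=
          continuousAt_const.eventually_lt continuous_abs.continuousAt
            (by linarith [two_pow_dyadic_le hx])
        exact h3.mono fun _ h => Or.inr h
    filter_upwards [h1, h2] with y hy1 hy2 i hi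
    by_contra hne
    obtain ⟨ha, hb⟩ := hf i y hne
    rcases lt_or_gt_of_ne hi with h | h
    · rcases hy2 with h0 | h3
      · omega
      · have : (2 : ℝ) ^ (i + 1) ≤ 2 ^ dyadic x := pow_le_pow_right₀ (by norm_num) h
        rw [pow_succ] at this
        linarith
    · have : (2 : ℝ) ^ (dyadic x + 1) ≤ 2 ^ i := pow_le_pow_right₀ (by norm_num) h
      linarith
  filter_upwards [key] with y hy
  -- Near `x`, a point of a neighbouring block lies outside the supports of both blocks.
  by_cases h : dyadic y = dyadic x
  · rw [glue, h]
  · rw [glue, hy _ h]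
    by_contra hne
    have hne' : f (dyadic x) y ≠ 0 := fun h0 => hne h0.symm
    obtain ⟨ha, hb⟩ := hf _ y hne'
    have hpos : (0 : ℝ) < 2 ^ dyadic x := by positivity
    refine h (dyadic_eq (by linarith) ?_)
    rw [pow_succ]
    linarith

theorem IsBlockFamily.contDiff_glue {E : Type*} [NormedAddCommGroup E] [NormedSpace ℝ E]
    {f : ℕ → ℝ → E} (hf : IsBlockFamily f) (hs : ∀ j, ContDiff ℝ ∞ (f j)) :
    ContDiff ℝ ∞ (glue f) :=
  contDiff_iff_contDiffAt.mpr fun x =>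
    (hs _).contDiffAt.congr_of_eventuallyEq (hf.glue_eventuallyEq x)

/-- On the closed dyadic block, endpoints included, a glued function is given by its block. -/
theorem IsBlockFamily.glue_eq_of_mem {E : Type*} [Zero E] {f : ℕ → ℝ → E} (hf : IsBlockFamily f)
    {j : ℕ} {x : ℝ} (h1 : (2 : ℝ) ^ j ≤ |x|) (h2 : |x| ≤ 2 ^ (j + 1)) : glue f x = f j x := by
  rcases h2.lt_or_eq with h | h
  · rw [glue, dyadic_eq h1 h]
  · have hj : dyadic x = j + 1 := dyadic_eq h.ge (by
      have hpos : (0 : ℝ) < 2 ^ (j + 1) := by positivity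
      rw [h, pow_succ _ (j + 1)]
      linarith)
    have hpos : (0 : ℝ) < 2 ^ j := by positivity
    have hz1 : f (j + 1) x = 0 := by
      by_contra hne
      have := (hf _ _ hne).1
      rw [h, pow_succ] at this
      linarith
    have hz2 : f j x = 0 := by
      by_contra hne
      have := (hf _ _ hne).2
      rw [h, pow_succ] at this
      linarith
    rw [glue, hj, hz1, hz2]

theorem IsBlockFamily.glue_eq_zero {E : Type*} [Zero E] {f : ℕ → ℝ → E} (hf : IsBlockFamily f)
    {x : ℝ} (h : |x| ≤ 1) : glue f x = 0 := by
  by_contra hne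
  have := (hf _ _ hne).1
  have h1 : (1 : ℝ) ≤ 2 ^ dyadic x := one_le_pow₀ (by norm_num)
  linarith

/-! ### Symbols glued from rescaled cutoffs -/

/-- The `j`-th block (with `h = 2 ^ j`) of a coefficient: amplitude `a` on the positive and `conj a`
on the negative half-line, plus an even real term `b`. -/
noncomputable def coeffBlock (a : ℂ) (b : ℝ) (h : ℝ) (x : ℝ) : ℂ :=
  a * (bump (x / h) : ℝ) + conj a * (bump (-x / h) : ℝ) + (b : ℂ) * (wideBump (x / h) : ℝ) +
    (b : ℂ) * (wideBump (-x / h) : ℝ)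

theorem abs_bounds_of_div {x h r s : ℝ} (hh : 0 < h) (hr : 0 ≤ r) (h1 : r < x / h)
    (h2 : x / h < s) :
    r * h < |x| ∧ |x| < s * h := by
  rw [lt_div_iff₀ hh] at h1
  rw [div_lt_iff₀ hh] at h2
  rw [abs_of_pos (lt_of_le_of_lt (by positivity) h1)]
  exact ⟨h1, h2⟩

theorem isBlockFamily_of_bumps {E : Type*} [Zero E] {f : ℕ → ℝ → E}
    (hf : ∀ j x, bump (x / 2 ^ j) = 0 → bump (-x / 2 ^ j) = 0 → wideBump (x / 2 ^ j) = 0 →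
      wideBump (-x / 2 ^ j) = 0 → f j x = 0) : IsBlockFamily f := by
  intro j y hne
  have hpos : (0 : ℝ) < 2 ^ j := by positivity
  have key : ∀ z : ℝ, |z| = |y| → (bump (z / 2 ^ j) ≠ 0 ∨ wideBump (z / 2 ^ j) ≠ 0) →
      9 / 8 * (2 : ℝ) ^ j < |y| ∧ |y| < 15 / 8 * (2 : ℝ) ^ j := by
    intro z hz h
    have h' : 9 / 8 < z / 2 ^ j ∧ z / 2 ^ j < 15 / 8 := by
      rcases h with h | h
      · have := bump_ne_zero h
        constructor <;> linarith
      · exact wideBump_ne_zero h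
    rw [← hz]
    exact abs_bounds_of_div hpos (by norm_num) h'.1 h'.2
  by_contra hcon
  have h1 : ∀ z : ℝ, |z| = |y| → bump (z / 2 ^ j) = 0 ∧ wideBump (z / 2 ^ j) = 0 := by
    intro z hz
    by_contra hcon'
    exact hcon (key z hz (by tauto))
  exact hne (hf j y (h1 y rfl).1 (h1 (-y) (abs_neg y)).1 (h1 y rfl).2 (h1 (-y) (abs_neg y)).2)

theorem isBlockFamily_coeffBlock (a : ℕ → ℂ) (b : ℕ → ℝ) :
    IsBlockFamily fun j => coeffBlock (a j) (b j) (2 ^ j) :=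
  isBlockFamily_of_bumps fun j x h1 h2 h3 h4 => by simp [coeffBlock, h1, h2, h3, h4]

theorem contDiff_scaled (ψ : ContDiffBump (3 / 2 : ℝ)) (a : ℂ) (s : ℝ) :
    ContDiff ℝ ∞ (fun x : ℝ => a * ((ψ (s * x) : ℝ) : ℂ)) :=
  contDiff_const.mul (Complex.ofRealCLM.contDiff.comp
    (ψ.contDiff.comp (contDiff_const.mul contDiff_id)))

theorem coeffBlock_eq (a : ℂ) (b h : ℝ) : coeffBlock a b h = fun x =>
    a * (bump (h⁻¹ * x) : ℝ) + conj a * (bump (-h⁻¹ * x) : ℝ) + (b : ℂ) * (wideBump (h⁻¹ * x) : ℝ) +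
    (b : ℂ) * (wideBump (-h⁻¹ * x) : ℝ) := by
  funext x
  rw [coeffBlock, div_eq_inv_mul x h, div_eq_inv_mul (-x) h, neg_mul, mul_neg]

theorem contDiff_coeffBlock (a : ℂ) (b h : ℝ) : ContDiff ℝ ∞ (coeffBlock a b h) := by
  rw [coeffBlock_eq]
  exact (((contDiff_scaled _ _ _).add (contDiff_scaled _ _ _)).add (contDiff_scaled _ _ _)).add
    (contDiff_scaled _ _ _)

theorem exists_iteratedDeriv_scaled_le (ψ : ContDiffBump (3 / 2 : ℝ)) (k : ℕ) :
    ∃ M : ℝ, 0 ≤ M ∧ ∀ (a : ℂ) (s x : ℝ),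
      ‖iteratedDeriv k (fun x : ℝ => a * ((ψ (s * x) : ℝ) : ℂ)) x‖ ≤ ‖a‖ * |s| ^ k * M := by
  have hψ : ContDiff ℝ k (fun x : ℝ => ((ψ x : ℝ) : ℂ)) :=
    Complex.ofRealCLM.contDiff.comp ψ.contDiff
  have hsupp : HasCompactSupport (fun x : ℝ => ((ψ x : ℝ) : ℂ)) :=
    ψ.hasCompactSupport.comp_left (g := fun r : ℝ => (r : ℂ)) Complex.ofReal_zero
  obtain ⟨M, hM⟩ := (hψ.continuous_iteratedFDeriv le_rfl).bounded_above_of_compact_support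
    (hsupp.iteratedFDeriv k)
  refine ⟨M, (norm_nonneg _).trans (hM 0), fun a s x => ?_⟩
  rw [iteratedDeriv_const_mul_field, iteratedDeriv_comp_const_smul hψ s, norm_mul, norm_smul,
    norm_pow, Real.norm_eq_abs, mul_assoc]
  gcongr
  rw [← norm_iteratedFDeriv_eq_norm_iteratedDeriv]
  exact hM _

/-- A coefficient glued from blocks of amplitude at most `D` is a symbol of order `0`, with
seminorms at most a universal multiple of `D`. -/
theorem exists_symbol_bound (k : ℕ) : ∃ C : ℝ, 0 ≤ C ∧ ∀ (a : ℕ → ℂ) (b : ℕ → ℝ) (D : ℝ),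
    (∀ j, ‖a j‖ + |b j| ≤ D) → ∀ x,
    ‖iteratedDeriv k (glue fun j => coeffBlock (a j) (b j) (2 ^ j)) x‖ ≤
      D * C * (bracket x ^ k)⁻¹ := by
  obtain ⟨M, hM0, hM⟩ := exists_iteratedDeriv_scaled_le bump k
  obtain ⟨M', hM0', hM'⟩ := exists_iteratedDeriv_scaled_le wideBump k
  refine ⟨2 * (M + M') * 4 ^ k, by positivity, fun a b D hD x => ?_⟩
  have hD0 : 0 ≤ D := (by positivity : 0 ≤ ‖a 0‖ + |b 0|).trans (hD 0)
  rw [((isBlockFamily_coeffBlock a b).glue_eventuallyEq x).iteratedDeriv_eq k]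
  set j := dyadic x
  have hs : ∀ (ψ : ContDiffBump (3 / 2 : ℝ)) (a : ℂ) (s : ℝ),
      ContDiffAt ℝ k (fun x : ℝ => a * ((ψ (s * x) : ℝ) : ℂ)) x := fun ψ a s =>
    ((contDiff_scaled ψ a s).of_le (by exact_mod_cast le_top)).contDiffAt
  have hfun : coeffBlock (a j) (b j) (2 ^ j) =
      (fun x : ℝ => a j * ((bump ((2 ^ j : ℝ)⁻¹ * x) : ℝ) : ℂ)) +
      (fun x : ℝ => conj (a j) * ((bump (-(2 ^ j : ℝ)⁻¹ * x) : ℝ) : ℂ)) +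
      (fun x : ℝ => (b j : ℂ) * ((wideBump ((2 ^ j : ℝ)⁻¹ * x) : ℝ) : ℂ)) +
      (fun x : ℝ => (b j : ℂ) * ((wideBump (-(2 ^ j : ℝ)⁻¹ * x) : ℝ) : ℂ)) :=
    coeffBlock_eq _ _ _
  have hadd : ∀ f₁ f₂ f₃ f₄ : ℝ → ℂ, ContDiffAt ℝ k f₁ x → ContDiffAt ℝ k f₂ x →
      ContDiffAt ℝ k f₃ x → ContDiffAt ℝ k f₄ x → iteratedDeriv k (f₁ + f₂ + f₃ + f₄) x =
        iteratedDeriv k f₁ x + iteratedDeriv k f₂ x + iteratedDeriv k f₃ x +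
          iteratedDeriv k f₄ x := fun f₁ f₂ f₃ f₄ g₁ g₂ g₃ g₄ => by
    have g₁₂ : ContDiffAt ℝ k (f₁ + f₂) x := g₁.add g₂
    have g₁₂₃ : ContDiffAt ℝ k (f₁ + f₂ + f₃) x := g₁₂.add g₃
    rw [iteratedDeriv_add g₁₂₃ g₄, iteratedDeriv_add g₁₂ g₃, iteratedDeriv_add g₁ g₂]
  rw [hfun, hadd _ _ _ _ (hs _ _ _) (hs _ _ _) (hs _ _ _) (hs _ _ _)]
  have e : |(2 ^ j : ℝ)⁻¹| = (2 ^ j : ℝ)⁻¹ := abs_of_pos (by positivity)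
  have h1 := hM (a j) (2 ^ j : ℝ)⁻¹ x
  have h2 := hM (conj (a j)) (-(2 ^ j : ℝ)⁻¹) x
  have h3 := hM' (b j : ℂ) (2 ^ j : ℝ)⁻¹ x
  have h4 := hM' (b j : ℂ) (-(2 ^ j : ℝ)⁻¹) x
  rw [abs_neg, e] at h2 h4
  rw [e] at h1 h3
  rw [RCLike.norm_conj] at h2
  rw [Complex.norm_real, Real.norm_eq_abs] at h3 h4
  have hbr : ((2 ^ j : ℝ)⁻¹) ^ k ≤ 4 ^ k * (bracket x ^ k)⁻¹ := by
    rw [← inv_pow (bracket x), ← mul_pow]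
    gcongr
    rw [← div_eq_mul_inv, le_div_iff₀ (bracket_pos x), inv_mul_le_iff₀ (by positivity)]
    linarith [bracket_le_dyadic x]
  set q := ((2 ^ j : ℝ)⁻¹) ^ k
  have hq : 0 ≤ q := by positivity
  have ha : ‖a j‖ ≤ D := by linarith [hD j, abs_nonneg (b j)]
  have hb : |b j| ≤ D := by linarith [hD j, norm_nonneg (a j)]
  calc _ ≤ ‖a j‖ * q * M + ‖a j‖ * q * M + |b j| * q * M' + |b j| * q * M' := by
        refine (norm_add_le _ _).trans (add_le_add ?_ h4)
        refine (norm_add_le _ _).trans (add_le_add ?_ h3)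
        exact (norm_add_le _ _).trans (add_le_add h1 h2)
    _ ≤ D * q * M + D * q * M + D * q * M' + D * q * M' := by gcongr
    _ = D * (2 * (M + M')) * q := by ring
    _ ≤ D * (2 * (M + M')) * (4 ^ k * (bracket x ^ k)⁻¹) := by gcongr
    _ = _ := by ring

/-! ### Averaging -/

/-- Averaging for an amplitude equation: if the non-resonant coefficients `p` and `q` have
primitives bounded by `δ`, then up to an error `O(δ)` the amplitude decays as it does under the
resonant term `ρ β` alone, whose phase `β` is aligned with the initial value. -/
theorem norm_le_of_averaging {d p q P Q : ℝ → ℂ} {ρ R : ℝ → ℝ} {β : ℂ} {K δ : ℝ} (hK0 : 0 < K)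
    (hδ : 0 ≤ δ)
    (hd : ∀ t ∈ Icc (1 : ℝ) 2, HasDerivAt d (p t * d t + (q t + ρ t * β) * conj (d t)) t)
    (hP : ∀ t ∈ Icc (1 : ℝ) 2, HasDerivAt P (p t) t)
    (hQ : ∀ t ∈ Icc (1 : ℝ) 2, HasDerivAt Q (q t) t)
    (hR : ∀ t ∈ Icc (1 : ℝ) 2, HasDerivAt R (ρ t) t)
    (hP1 : P 1 = 0) (hQ1 : Q 1 = 0) (hR1 : R 1 = 0)
    (hPb : ∀ t ∈ Icc (1 : ℝ) 2, ‖P t‖ ≤ δ) (hQb : ∀ t ∈ Icc (1 : ℝ) 2, ‖Q t‖ ≤ δ)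
    (hβ : ‖β‖ ≤ 1) (hβ0 : β * conj (d 1) = -d 1)
    (hK : ∀ t ∈ Icc (1 : ℝ) 2, ‖p t‖ + ‖q t‖ + |ρ t| ≤ K) :
    ∀ t ∈ Icc (1 : ℝ) 2, ‖d t‖ ≤ (Real.exp (-R t) + 4 * δ * Real.exp (2 * K)) * ‖d 1‖ := by
  have hd'K : ∀ t ∈ Icc (1 : ℝ) 2,
      ‖p t * d t + (q t + ρ t * β) * conj (d t)‖ ≤ K * ‖d t‖ := by
    intro t ht
    have h1 : ‖q t + ρ t * β‖ ≤ ‖q t‖ + |ρ t| := by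
      refine (norm_add_le _ _).trans ?_
      rw [norm_mul, Complex.norm_real, Real.norm_eq_abs]
      nlinarith [abs_nonneg (ρ t)]
    calc _ ≤ ‖p t‖ * ‖d t‖ + ‖q t + ρ t * β‖ * ‖d t‖ := by
          refine (norm_add_le _ _).trans ?_
          rw [norm_mul, norm_mul, RCLike.norm_conj]
      _ ≤ ‖p t‖ * ‖d t‖ + (‖q t‖ + |ρ t|) * ‖d t‖ := by gcongr
      _ = (‖p t‖ + ‖q t‖ + |ρ t|) * ‖d t‖ := by ring
      _ ≤ _ := by gcongr; exact hK t ht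
  set M := ‖d 1‖ * Real.exp K with hM
  have hM0 : 0 ≤ M := by positivity
  have hdM : ∀ t ∈ Icc (1 : ℝ) 2, ‖d t‖ ≤ M := by
    intro t ht
    refine (norm_le_exp_of_hasDerivAt (fun s hs => (hd s hs).continuousAt.continuousWithinAt)
      (fun s hs => (hd s (Ico_subset_Icc_self hs)).hasDerivWithinAt)
      (fun s hs => hd'K s (Ico_subset_Icc_self hs)) t ht).trans ?_
    rw [hM]
    gcongr
    nlinarith [ht.2]
  set E : ℝ → ℂ := fun t => (Real.exp (-R t) : ℝ) with hE
  have hEd : ∀ t ∈ Icc (1 : ℝ) 2, HasDerivAt E (-(ρ t : ℂ) * E t) t := by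
    intro t ht
    have := ((hR t ht).neg.exp).ofReal_comp
    refine this.congr_deriv ?_
    simp only [hE, Pi.neg_apply]
    push_cast
    ring
  set d' : ℝ → ℂ := fun t => p t * d t + (q t + ρ t * β) * conj (d t) with hd'
  -- The change of variables `d - P d - Q conj d` removes the terms `p` and `q` up to errors `O(δ)`;
  -- `e` compares the result with `E d(1)`, the exact solution of `y' = ρ β conj y`.
  set e : ℝ → ℂ := fun t => d t - P t * d t - Q t * conj (d t) - E t * d 1 with he
  set e' : ℝ → ℂ := fun t => ρ t * β * conj (e t + P t * d t + Q t * conj (d t)) -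
    P t * d' t - Q t * conj (d' t) with he'
  have hconj : ∀ t ∈ Icc (1 : ℝ) 2, HasDerivAt (fun t => conj (d t)) (conj (d' t)) t := fun t ht =>
    (Complex.conjCLE.toContinuousLinearMap.hasFDerivAt.comp_hasDerivAt t (hd t ht))
  have hed : ∀ t ∈ Icc (1 : ℝ) 2, HasDerivAt e (e' t) t := by
    intro t ht
    have h := (((hd t ht).sub ((hP t ht).mul (hd t ht))).sub ((hQ t ht).mul (hconj t ht))).sub
      ((hEd t ht).mul_const (d 1))
    refine h.congr_deriv ?_
    have hEc : conj (E t) = E t := Complex.conj_ofReal _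
    have hdt : e t + P t * d t + Q t * conj (d t) = d t - E t * d 1 := by simp only [he]; ring
    simp only [he']
    rw [hdt, map_sub, map_mul, hEc]
    simp only [hd']
    linear_combination ((ρ t : ℂ) * E t) * hβ0
  have hbound : ∀ t ∈ Ico (1 : ℝ) 2, ‖e' t‖ ≤ K * ‖e t‖ + 4 * δ * K * M := by
    intro t ht'
    have ht := Ico_subset_Icc_self ht'
    have hρ : |ρ t| ≤ K := by linarith [hK t ht, norm_nonneg (p t), norm_nonneg (q t)]
    have hd'M : ‖d' t‖ ≤ K * M := (hd'K t ht).trans (by gcongr; exact hdM t ht)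
    have h1 : ‖e t + P t * d t + Q t * conj (d t)‖ ≤ ‖e t‖ + δ * M + δ * M := by
      refine (norm_add_le _ _).trans (add_le_add ((norm_add_le _ _).trans (add_le_add le_rfl ?_)) ?_)
      · rw [norm_mul]
        gcongr
        exacts [hPb t ht, hdM t ht]
      · rw [norm_mul, RCLike.norm_conj]
        gcongr
        exacts [hQb t ht, hdM t ht]
    have h2 : ‖(ρ t : ℂ) * β * conj (e t + P t * d t + Q t * conj (d t))‖ ≤
        K * 1 * (‖e t‖ + δ * M + δ * M) := by
      rw [norm_mul, norm_mul, RCLike.norm_conj, Complex.norm_real, Real.norm_eq_abs]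
      gcongr
    have h3 : ‖P t * d' t‖ ≤ δ * (K * M) := by
      rw [norm_mul]
      gcongr
      exact hPb t ht
    have h4 : ‖Q t * conj (d' t)‖ ≤ δ * (K * M) := by
      rw [norm_mul, RCLike.norm_conj]
      gcongr
      exact hQb t ht
    calc ‖e' t‖ ≤ K * 1 * (‖e t‖ + δ * M + δ * M) + δ * (K * M) + δ * (K * M) :=
          (norm_sub_le _ _).trans (add_le_add ((norm_sub_le _ _).trans (add_le_add h2 h3)) h4)
      _ = _ := by ring
  have he1 : e 1 = 0 := by simp [he, hP1, hQ1, hE, hR1]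
  intro t ht
  have hgr := norm_le_gronwallBound_of_norm_deriv_right_le (δ := 0)
    (fun s hs => (hed s hs).continuousAt.continuousWithinAt)
    (fun s hs => (hed s (Ico_subset_Icc_self hs)).hasDerivWithinAt) (by simp [he1]) hbound t ht
  rw [gronwallBound_of_K_ne_0 hK0.ne'] at hgr
  have hexp : Real.exp (K * (t - 1)) ≤ Real.exp K := by
    gcongr
    nlinarith [ht.2]
  have hgr2 : ‖e t‖ ≤ 4 * δ * M * (Real.exp K - 1) := by
    refine hgr.trans ?_
    have : 4 * δ * K * M / K = 4 * δ * M := by field_simp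
    simp only [this, zero_mul, zero_add]
    gcongr
  have hdt : d t = e t + P t * d t + Q t * conj (d t) + E t * d 1 := by simp only [he]; ring
  have h5 : ‖E t * d 1‖ = Real.exp (-R t) * ‖d 1‖ := by
    rw [norm_mul, hE, Complex.norm_real, Real.norm_eq_abs, abs_of_pos (Real.exp_pos _)]
  have h6 : ‖P t * d t‖ ≤ δ * M := by
    rw [norm_mul]
    gcongr
    exacts [hPb t ht, hdM t ht]
  have h7 : ‖Q t * conj (d t)‖ ≤ δ * M := by
    rw [norm_mul, RCLike.norm_conj]
    gcongr
    exacts [hQb t ht, hdM t ht]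
  have h8 : ‖d t‖ ≤ ‖e t‖ + δ * M + δ * M + Real.exp (-R t) * ‖d 1‖ := by
    conv_lhs => rw [hdt]
    rw [← h5]
    exact (norm_add_le _ _).trans (add_le_add ((norm_add_le _ _).trans (add_le_add
      ((norm_add_le _ _).trans (add_le_add le_rfl h6)) h7)) le_rfl)
  have h9 : M * Real.exp K = Real.exp (2 * K) * ‖d 1‖ := by
    rw [hM, mul_assoc, ← Real.exp_add]
    ring_nf
  have h10 : 0 ≤ δ * M := by positivity
  calc ‖d t‖ ≤ 4 * δ * M * (Real.exp K - 1) + δ * M + δ * M + Real.exp (-R t) * ‖d 1‖ := by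
        linarith
    _ ≤ 4 * δ * (M * Real.exp K) + Real.exp (-R t) * ‖d 1‖ := by linarith
    _ = _ := by rw [h9]; ring

/-! ### Oscillatory integrals -/

/-- The oscillatory integral `∫₁ᵗ χ(s) e^{iΩs} ds` of a cutoff `χ`. -/
noncomputable def osc (ψ : ContDiffBump (3 / 2 : ℝ)) (Ω t : ℝ) : ℂ :=
  ∫ s in (1 : ℝ)..t, (ψ s : ℂ) * Complex.exp ((Ω * s : ℝ) * Complex.I)

theorem continuous_oscillating (ψ : ContDiffBump (3 / 2 : ℝ)) (Ω : ℝ) :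
    Continuous fun s : ℝ => (ψ s : ℂ) * Complex.exp ((Ω * s : ℝ) * Complex.I) := by
  have := ψ.continuous
  fun_prop

theorem hasDerivAt_osc (ψ : ContDiffBump (3 / 2 : ℝ)) (Ω t : ℝ) :
    HasDerivAt (osc ψ Ω) ((ψ t : ℂ) * Complex.exp ((Ω * t : ℝ) * Complex.I)) t :=
  ((continuous_oscillating ψ Ω).integral_hasStrictDerivAt 1 t).hasDerivAt

theorem osc_one (ψ : ContDiffBump (3 / 2 : ℝ)) (Ω : ℝ) : osc ψ Ω 1 = 0 := by simp [osc]

theorem norm_osc_le_one (ψ : ContDiffBump (3 / 2 : ℝ)) (Ω : ℝ) {t : ℝ} (ht : t ∈ Icc (1 : ℝ) 2) :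
    ‖osc ψ Ω t‖ ≤ 1 := by
  have := intervalIntegral.norm_integral_le_of_norm_le_const (a := 1) (b := t) (C := 1)
    (f := fun s : ℝ => (ψ s : ℂ) * Complex.exp ((Ω * s : ℝ) * Complex.I)) (fun s _ => by
      rw [norm_mul, Complex.norm_exp_ofReal_mul_I, mul_one, Complex.norm_real, Real.norm_eq_abs,
        abs_of_nonneg (ψ.nonneg' s)]
      exact ψ.le_one)
  refine this.trans ?_
  rw [abs_of_nonneg (by linarith [ht.1])]
  linarith [ht.2]

theorem norm_osc_bump_le {Ω : ℝ} (hΩ : Ω ≠ 0) {t : ℝ} (ht : t ∈ Icc (1 : ℝ) 2) :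
    ‖osc bump Ω t‖ ≤ (1 + bumpSlope) / |Ω| := by
  set w : ℂ := Ω * Complex.I with hw
  have hw0 : w ≠ 0 := by simp [hw, hΩ]
  have hwn : ‖w‖ = |Ω| := by simp [hw]
  have hbd : ∀ s : ℝ, HasDerivAt (fun s : ℝ => (bump s : ℂ)) (deriv bump s : ℝ) s := fun s =>
    (((bump.contDiff (n := 1)).differentiable (by norm_num)) s).hasDerivAt.ofReal_comp
  have hdc : Continuous (deriv bump) := (bump.contDiff (n := 1)).continuous_deriv le_rfl
  -- Integration by parts against the primitive `e^{iΩs} / (iΩ)`.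
  have hparts : ∀ s : ℝ, HasDerivAt
      (fun s : ℝ => (bump s : ℂ) * Complex.exp ((Ω * s : ℝ) * Complex.I) / w)
      ((deriv bump s : ℝ) * Complex.exp ((Ω * s : ℝ) * Complex.I) / w +
        (bump s : ℂ) * Complex.exp ((Ω * s : ℝ) * Complex.I)) s := fun s => by
    refine (((hbd s).mul (hasDerivAt_exp_mul_I Ω s)).div_const w).congr_deriv ?_
    field_simp
    simp only [hw]
    ring
  have hc2 : Continuous fun s : ℝ =>
      ((deriv bump s : ℝ) : ℂ) * Complex.exp ((Ω * s : ℝ) * Complex.I) / w := by fun_prop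
  have hint := intervalIntegral.integral_eq_sub_of_hasDerivAt (a := 1) (b := t)
    (fun s _ => hparts s) ((hc2.add (continuous_oscillating bump Ω)).intervalIntegrable _ _)
  rw [intervalIntegral.integral_add (hc2.intervalIntegrable _ _)
    ((continuous_oscillating bump Ω).intervalIntegrable _ _)] at hint
  have h1 : bump (1 : ℝ) = 0 := by
    by_contra hne
    linarith [(bump_ne_zero hne).1]
  have heq : osc bump Ω t = (bump t : ℂ) * Complex.exp ((Ω * t : ℝ) * Complex.I) / w -
      ∫ s in (1 : ℝ)..t, ((deriv bump s : ℝ) : ℂ) * Complex.exp ((Ω * s : ℝ) * Complex.I) / w := by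
    rw [osc, eq_sub_iff_add_eq', hint, h1]
    simp
  have hb1 : ‖(bump t : ℂ) * Complex.exp ((Ω * t : ℝ) * Complex.I) / w‖ ≤ 1 / |Ω| := by
    rw [norm_div, hwn, norm_mul, Complex.norm_exp_ofReal_mul_I, mul_one, Complex.norm_real,
      Real.norm_eq_abs, abs_of_nonneg (bump.nonneg' t)]
    gcongr
    exact bump.le_one
  have hb2 := intervalIntegral.norm_integral_le_of_norm_le_const (a := 1) (b := t)
    (C := bumpSlope / |Ω|)
    (f := fun s : ℝ => ((deriv bump s : ℝ) : ℂ) * Complex.exp ((Ω * s : ℝ) * Complex.I) / w)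
    (fun s _ => by
      rw [norm_div, hwn, norm_mul, Complex.norm_exp_ofReal_mul_I, mul_one, Complex.norm_real,
        Real.norm_eq_abs]
      gcongr
      exact abs_deriv_bump_le s)
  have hb3 : bumpSlope / |Ω| * |t - 1| ≤ bumpSlope / |Ω| := by
    have : 0 ≤ bumpSlope / |Ω| := div_nonneg bumpSlope_nonneg (abs_nonneg _)
    rw [abs_of_nonneg (show 0 ≤ t - 1 by linarith [ht.1])]
    nlinarith [ht.2]
  rw [heq]
  refine (norm_sub_le _ _).trans ?_
  rw [add_div]
  linarith

/-! ### One dyadic block of the potential -/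

section Block

variable {ι : Type*}

/-- The constant in front of the non-oscillating part of the potential. It is large enough to make
`W` dominate `q' + q²` for the function `q` built from `blockRiccati`. -/
noncomputable def blockConst : ℝ := 24 * bumpSlope + 576

theorem blockConst_nonneg : 0 ≤ blockConst := by
  have := bumpSlope_nonneg
  unfold blockConst
  positivity

/-- The block of the potential at scale `h`: a resonant oscillation of amplitude `24 θₙ / h` for each
frequency `θₙ`, `n ∈ F`, with phase and relative amplitude `zₙ`, and a positive term of size
`h⁻²`. -/
noncomputable def blockPotential (θ : ι → ℝ) (F : Finset ι) (z : ι → ℂ) (h x : ℝ) : ℝ :=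
  (∑ n ∈ F, 24 * θ n / h * bump (x / h) * (z n * Complex.exp ((θ n * x : ℝ) * Complex.I)).re) +
    blockConst * (F.card : ℝ) ^ 2 / h ^ 2 * wideBump (x / h)

theorem contDiff_blockPotential (θ : ι → ℝ) (F : Finset ι) (z : ι → ℂ) (h : ℝ) :
    ContDiff ℝ ∞ (blockPotential θ F z h) := by
  have hdiv : ContDiff ℝ ∞ fun x : ℝ => x / h := contDiff_id.div_const h
  refine ContDiff.add (ContDiff.sum fun n _ => ?_)
    (contDiff_const.mul (wideBump.contDiff.comp hdiv))
  refine (contDiff_const.mul (bump.contDiff.comp hdiv)).mul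
    (Complex.reCLM.contDiff.comp (contDiff_const.mul (Complex.contDiff_exp.comp
      ((Complex.ofRealCLM.contDiff.comp (contDiff_const.mul contDiff_id)).mul contDiff_const))))

theorem abs_blockPotential_le {θ : ι → ℝ} (hθ : ∀ n, 0 < θ n) (F : Finset ι) {z : ι → ℂ}
    (hz : ∀ n, ‖z n‖ ≤ 1) {h : ℝ} (hh : 0 < h) (x : ℝ) :
    |blockPotential θ F z h x| ≤
      ∑ n ∈ F, 24 * θ n / h + blockConst * (F.card : ℝ) ^ 2 / h ^ 2 := by
  have hB := blockConst_nonneg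
  refine (abs_add_le _ _).trans (add_le_add ((Finset.abs_sum_le_sum_abs _ _).trans
    (Finset.sum_le_sum fun n _ => ?_)) ?_)
  · have h1 : |(z n * Complex.exp ((θ n * x : ℝ) * Complex.I)).re| ≤ 1 := by
      refine (Complex.abs_re_le_norm _).trans ?_
      rw [norm_mul, Complex.norm_exp_ofReal_mul_I, mul_one]
      exact hz n
    have h2 : |bump (x / h)| ≤ 1 := by
      rw [abs_of_nonneg (bump.nonneg' _)]
      exact bump.le_one
    have h3 : 0 < 24 * θ n / h := by have := hθ n; positivity
    rw [abs_mul, abs_mul, abs_of_pos h3]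
    calc _ ≤ 24 * θ n / h * 1 * 1 := by gcongr
      _ = _ := by ring
  · have h3 : 0 ≤ blockConst * (F.card : ℝ) ^ 2 / h ^ 2 := by positivity
    rw [abs_mul, abs_of_nonneg h3, abs_of_nonneg (wideBump.nonneg' _)]
    exact mul_le_of_le_one_right h3 wideBump.le_one

/-- The rescaled block, decomposed into exponentials. -/
theorem rescaled_blockPotential (θ : ι → ℝ) (F : Finset ι) (z : ι → ℂ) {h : ℝ} (hh : 0 < h)
    (t : ℝ) : ((h * blockPotential θ F z h (h * t) : ℝ) : ℂ) =
      (∑ n ∈ F, ((12 * θ n : ℝ) : ℂ) * (bump t : ℝ) *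
        (z n * Complex.exp ((θ n * h * t : ℝ) * Complex.I) +
          conj (z n) * Complex.exp ((-(θ n * h) * t : ℝ) * Complex.I))) +
      ((blockConst * (F.card : ℝ) ^ 2 / h : ℝ) : ℂ) * (wideBump t : ℝ) := by
  have hdiv : h * t / h = t := by field_simp
  have hre : ∀ w : ℂ, ((2 * w.re : ℝ) : ℂ) = w + conj w := fun w => by rw [Complex.add_conj]
  have hterm : ∀ n, h * (24 * θ n / h * bump t *
      (z n * Complex.exp ((θ n * (h * t) : ℝ) * Complex.I)).re) =
      12 * θ n * bump t * (2 * (z n * Complex.exp ((θ n * (h * t) : ℝ) * Complex.I)).re) :=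
    fun n => by field_simp; ring
  have hlast : h * (blockConst * (F.card : ℝ) ^ 2 / h ^ 2 * wideBump t) =
      blockConst * (F.card : ℝ) ^ 2 / h * wideBump t := by field_simp
  rw [blockPotential, hdiv, mul_add, Finset.mul_sum, hlast, Complex.ofReal_add, Complex.ofReal_sum,
    Complex.ofReal_mul (blockConst * (F.card : ℝ) ^ 2 / h)]
  congr 1
  refine Finset.sum_congr rfl fun n _ => ?_
  rw [hterm, Complex.ofReal_mul, hre, Complex.ofReal_mul, map_mul, ← Complex.exp_conj]
  congr 3
  · rw [mul_assoc]
  · congr 2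
    simp
    ring

/-- A primitive of the rescaled block `h V(ht) e^{-iτt}` from which the terms listed as resonant
(`ε n = 0`) are removed. -/
noncomputable def blockPrimitive (θ : ι → ℝ) (F : Finset ι) (z : ι → ℂ) (ε : ι → ℂ) (h τ t : ℝ) :
    ℂ :=
  (∑ n ∈ F, ((12 * θ n : ℝ) : ℂ) * (ε n * z n * osc bump (θ n * h - τ) t +
      conj (z n) * osc bump (-(θ n * h) - τ) t)) +
    ((blockConst * (F.card : ℝ) ^ 2 / h : ℝ) : ℂ) * osc wideBump (-τ) t

/-- The derivative of `blockPrimitive`. -/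
noncomputable def blockIntegrand (θ : ι → ℝ) (F : Finset ι) (z : ι → ℂ) (ε : ι → ℂ) (h τ t : ℝ) :
    ℂ :=
  (∑ n ∈ F, ((12 * θ n : ℝ) : ℂ) * (ε n * z n *
      ((bump t : ℂ) * Complex.exp (((θ n * h - τ) * t : ℝ) * Complex.I)) +
      conj (z n) * ((bump t : ℂ) * Complex.exp (((-(θ n * h) - τ) * t : ℝ) * Complex.I)))) +
    ((blockConst * (F.card : ℝ) ^ 2 / h : ℝ) : ℂ) *
      ((wideBump t : ℂ) * Complex.exp ((-τ * t : ℝ) * Complex.I))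

theorem hasDerivAt_blockPrimitive (θ : ι → ℝ) (F : Finset ι) (z ε : ι → ℂ) (h τ t : ℝ) :
    HasDerivAt (blockPrimitive θ F z ε h τ) (blockIntegrand θ F z ε h τ t) t := by
  refine HasDerivAt.add (HasDerivAt.fun_sum fun n _ => ?_) ((hasDerivAt_osc _ _ _).const_mul _)
  exact (((hasDerivAt_osc _ _ _).const_mul _).add ((hasDerivAt_osc _ _ _).const_mul _)).const_mul _

theorem blockPrimitive_one (θ : ι → ℝ) (F : Finset ι) (z ε : ι → ℂ) (h τ : ℝ) :
    blockPrimitive θ F z ε h τ 1 = 0 := by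
  simp [blockPrimitive, osc_one]

theorem norm_blockPrimitive_le {θ : ι → ℝ} (hθ : ∀ n, 0 < θ n) (F : Finset ι) {z ε : ι → ℂ}
    (hz : ∀ n, ‖z n‖ ≤ 1) (hε : ∀ n, ‖ε n‖ ≤ 1) {h τ γ : ℝ} (hh : 0 < h) (hγ : 0 < γ)
    (h1 : ∀ n ∈ F, ε n = 0 ∨ γ * h ≤ |θ n * h - τ|) (h2 : ∀ n ∈ F, γ * h ≤ |-(θ n * h) - τ|)
    {t : ℝ} (ht : t ∈ Icc (1 : ℝ) 2) :
    ‖blockPrimitive θ F z ε h τ t‖ ≤ ((∑ n ∈ F, 24 * θ n) * ((1 + bumpSlope) / γ) +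
      blockConst * (F.card : ℝ) ^ 2) / h := by
  have hB := blockConst_nonneg
  have hs := bumpSlope_nonneg
  have hosc : ∀ Ω, γ * h ≤ |Ω| → ‖osc bump Ω t‖ ≤ (1 + bumpSlope) / γ / h := by
    intro Ω hΩ
    have hpos : 0 < γ * h := by positivity
    refine (norm_osc_bump_le (abs_pos.mp (hpos.trans_le hΩ)) ht).trans ?_
    rw [div_div]
    gcongr
  set S := (1 + bumpSlope) / γ / h with hS
  have hS0 : 0 ≤ S := by positivity
  have hterm : ∀ n ∈ F, ‖((12 * θ n : ℝ) : ℂ) * (ε n * z n * osc bump (θ n * h - τ) t +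
      conj (z n) * osc bump (-(θ n * h) - τ) t)‖ ≤ 24 * θ n * S := by
    intro n hn
    have hp : 0 < 12 * θ n := by have := hθ n; positivity
    have ha : ‖ε n * z n * osc bump (θ n * h - τ) t‖ ≤ S := by
      rcases h1 n hn with h0 | h0
      · simpa [h0] using hS0
      · rw [norm_mul, norm_mul]
        calc _ ≤ 1 * 1 * S := by gcongr; exacts [hε n, hz n, hosc _ h0]
          _ = S := by ring
    have hb : ‖conj (z n) * osc bump (-(θ n * h) - τ) t‖ ≤ S := by
      rw [norm_mul, RCLike.norm_conj]
      calc _ ≤ 1 * S := by gcongr; exacts [hz n, hosc _ (h2 n hn)]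
        _ = S := by ring
    rw [norm_mul, Complex.norm_real, Real.norm_eq_abs, abs_of_pos hp]
    calc _ ≤ 12 * θ n * (S + S) := by gcongr; exact (norm_add_le _ _).trans (add_le_add ha hb)
      _ = _ := by ring
  have hlast : ‖((blockConst * (F.card : ℝ) ^ 2 / h : ℝ) : ℂ) * osc wideBump (-τ) t‖ ≤
      blockConst * (F.card : ℝ) ^ 2 / h := by
    have hp : 0 ≤ blockConst * (F.card : ℝ) ^ 2 / h := by positivity
    rw [norm_mul, Complex.norm_real, Real.norm_eq_abs, abs_of_nonneg hp]
    exact mul_le_of_le_one_right hp (norm_osc_le_one _ _ ht)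
  calc _ ≤ ∑ n ∈ F, 24 * θ n * S + blockConst * (F.card : ℝ) ^ 2 / h :=
        (norm_add_le _ _).trans (add_le_add ((norm_sum_le _ _).trans (Finset.sum_le_sum hterm))
          hlast)
    _ = _ := by rw [← Finset.sum_mul, hS]; ring

theorem norm_blockIntegrand_le {θ : ι → ℝ} (hθ : ∀ n, 0 < θ n) (F : Finset ι) {z ε : ι → ℂ}
    (hz : ∀ n, ‖z n‖ ≤ 1) (hε : ∀ n, ‖ε n‖ ≤ 1) {h : ℝ} (hh : 1 ≤ h) (τ t : ℝ) :
    ‖blockIntegrand θ F z ε h τ t‖ ≤ (∑ n ∈ F, 24 * θ n) + blockConst * (F.card : ℝ) ^ 2 := by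
  have hB := blockConst_nonneg
  have hh0 : 0 < h := by linarith
  have hb : ∀ (ψ : ContDiffBump (3 / 2 : ℝ)) (r : ℝ),
      ‖(ψ t : ℂ) * Complex.exp ((r : ℝ) * Complex.I)‖ ≤ 1 := fun ψ r => by
    rw [norm_mul, Complex.norm_exp_ofReal_mul_I, mul_one, Complex.norm_real, Real.norm_eq_abs,
      abs_of_nonneg (ψ.nonneg' t)]
    exact ψ.le_one
  refine (norm_add_le _ _).trans (add_le_add ((norm_sum_le _ _).trans
    (Finset.sum_le_sum fun n _ => ?_)) ?_)
  · have hp : 0 < 12 * θ n := by have := hθ n; positivity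
    rw [norm_mul, Complex.norm_real, Real.norm_eq_abs, abs_of_pos hp]
    have h1 : ‖ε n * z n * ((bump t : ℂ) * Complex.exp (((θ n * h - τ) * t : ℝ) * Complex.I))‖
        ≤ 1 := by
      rw [norm_mul, norm_mul]
      calc _ ≤ 1 * 1 * (1 : ℝ) := by gcongr; exacts [hε n, hz n, hb _ _]
        _ = 1 := by ring
    have h2 : ‖conj (z n) * ((bump t : ℂ) * Complex.exp (((-(θ n * h) - τ) * t : ℝ) * Complex.I))‖
        ≤ 1 := by
      rw [norm_mul, RCLike.norm_conj]
      calc _ ≤ 1 * (1 : ℝ) := by gcongr; exacts [hz n, hb _ _]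
        _ = 1 := by ring
    calc _ ≤ 12 * θ n * (1 + 1) := by gcongr; exact (norm_add_le _ _).trans (add_le_add h1 h2)
      _ = _ := by ring
  · have hp : 0 ≤ blockConst * (F.card : ℝ) ^ 2 / h := by positivity
    rw [norm_mul, Complex.norm_real, Real.norm_eq_abs, abs_of_nonneg hp]
    refine (mul_le_of_le_one_right hp (hb _ _)).trans ?_
    exact div_le_self (by positivity) hh

theorem blockIntegrand_zero (θ : ι → ℝ) (F : Finset ι) (z : ι → ℂ) {h : ℝ} (hh : 0 < h) (t : ℝ) :
    blockIntegrand θ F z (fun _ => 1) h 0 t = ((h * blockPotential θ F z h (h * t) : ℝ) : ℂ) := by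
  rw [rescaled_blockPotential θ F z hh, blockIntegrand]
  congr 1
  · refine Finset.sum_congr rfl fun n _ => ?_
    rw [sub_zero, sub_zero]
    ring
  · simp

open Classical in
/-- Shifting frequencies by `τ = θ_l h` makes exactly one term of the rescaled block stationary. -/
theorem blockIntegrand_shift (θ : ι → ℝ) (F : Finset ι) (z : ι → ℂ) {h : ℝ} (hh : 0 < h) {l : ι}
    (hl : l ∈ F) (t : ℝ) :
    ((h * blockPotential θ F z h (h * t) : ℝ) : ℂ) *
        Complex.exp (-(θ l * (h * t) : ℝ) * Complex.I) =
      blockIntegrand θ F z (fun n => if n = l then 0 else 1) h (θ l * h) t +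
        ((12 * θ l : ℝ) : ℂ) * (bump t : ℂ) * z l := by
  have hexp : ∀ a : ℝ, Complex.exp ((a * t : ℝ) * Complex.I) *
      Complex.exp (-(θ l * (h * t) : ℝ) * Complex.I) =
      Complex.exp (((a - θ l * h) * t : ℝ) * Complex.I) := fun a => by
    rw [← Complex.exp_add]
    congr 1
    push_cast
    ring
  have hres : ((12 * θ l : ℝ) : ℂ) * (bump t : ℂ) * z l = ∑ n ∈ F, if n = l then
      ((12 * θ n : ℝ) : ℂ) * (z n * ((bump t : ℂ) *
        Complex.exp (((θ n * h - θ l * h) * t : ℝ) * Complex.I))) else 0 := by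
    rw [Finset.sum_ite_eq' F l, if_pos hl]
    simp
    ring
  have hsum : ∑ n ∈ F, ((12 * θ n : ℝ) : ℂ) * (bump t : ℝ) *
        (z n * Complex.exp ((θ n * h * t : ℝ) * Complex.I) +
          conj (z n) * Complex.exp ((-(θ n * h) * t : ℝ) * Complex.I)) *
        Complex.exp (-(θ l * (h * t) : ℝ) * Complex.I) =
      ∑ n ∈ F, ((12 * θ n : ℝ) : ℂ) * ((if n = l then 0 else 1) * z n * ((bump t : ℂ) *
        Complex.exp (((θ n * h - θ l * h) * t : ℝ) * Complex.I)) + conj (z n) * ((bump t : ℂ) *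
        Complex.exp (((-(θ n * h) - θ l * h) * t : ℝ) * Complex.I))) +
      ∑ n ∈ F, if n = l then ((12 * θ n : ℝ) : ℂ) * (z n * ((bump t : ℂ) *
        Complex.exp (((θ n * h - θ l * h) * t : ℝ) * Complex.I))) else 0 := by
    rw [← Finset.sum_add_distrib]
    refine Finset.sum_congr rfl fun n _ => ?_
    rw [← hexp (θ n * h), ← hexp (-(θ n * h))]
    split_ifs <;> ring
  rw [rescaled_blockPotential θ F z hh, blockIntegrand, add_mul, Finset.sum_mul, hsum, hres,
    show -(θ l * h) * t = 0 * t - θ l * h * t by ring]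
  have := hexp 0
  rw [sub_mul] at this
  rw [← this]
  simp
  ring

theorem bump_primitive_two : 3 ≤ ∫ s in (1 : ℝ)..2, 12 * bump s := by
  have hint : ∀ a b : ℝ, IntervalIntegrable (fun s => 12 * bump s) volume a b := fun a b =>
    (continuous_const.mul bump.continuous).intervalIntegrable _ _
  have hnn : ∀ s : ℝ, 0 ≤ 12 * bump s := fun s => by have := bump.nonneg' s; positivity
  rw [← intervalIntegral.integral_add_adjacent_intervals (hint 1 (11 / 8)) (hint (11 / 8) 2),
    ← intervalIntegral.integral_add_adjacent_intervals (hint (11 / 8) (13 / 8)) (hint (13 / 8) 2)]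
  have h1 : 0 ≤ ∫ s in (1 : ℝ)..(11 / 8), 12 * bump s :=
    intervalIntegral.integral_nonneg (by norm_num) fun s _ => hnn s
  have h2 : 0 ≤ ∫ s in (13 / 8 : ℝ)..2, 12 * bump s :=
    intervalIntegral.integral_nonneg (by norm_num) fun s _ => hnn s
  have h3 : ∫ s in (11 / 8 : ℝ)..(13 / 8), 12 * bump s = 3 := by
    rw [intervalIntegral.integral_congr (g := fun _ => (12 : ℝ))]
    · rw [intervalIntegral.integral_const]
      norm_num
    · intro s hs
      rw [uIcc_of_le (by norm_num)] at hs
      simp [bump_eq_one hs.1 hs.2]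
  linarith

theorem exp_neg_three_le : Real.exp (-3) ≤ 1 / 8 := by
  have h1 : (2 : ℝ) ≤ Real.exp 1 := by linarith [Real.exp_one_gt_d9]
  have h2 : Real.exp (-3) * (Real.exp 1) ^ 3 = 1 := by
    rw [← Real.exp_nat_mul, ← Real.exp_add]
    norm_num
  have h3 : (2 : ℝ) ^ 3 ≤ Real.exp 1 ^ 3 := pow_le_pow_left₀ (by norm_num) h1 3
  nlinarith [Real.exp_pos (-3)]

/-- A sufficiently remote block whose phases are aligned with the incoming amplitude of the
`l`-th solution reduces this amplitude by a factor of at least `4`. Positive distinct frequencies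
do not interact at leading order. -/
theorem eventually_block_reduction {θ : ι → ℝ} (hθ : ∀ n, 0 < θ n) (F : Finset ι)
    (hinj : Set.InjOn θ F) {l : ι} (hl : l ∈ F) :
    ∀ᶠ h : ℝ in atTop, ∀ z : ι → ℂ, (∀ n, ‖z n‖ ≤ 1) → ∀ c : ℝ → ℂ,
      (∀ x, HasDerivAt c (ampField (blockPotential θ F z h) (θ l / 2) x (c x)) x) →
      z l * conj (c h) = -Complex.I * c h →
      (∀ x ∈ Icc h (2 * h), ‖c x‖ ≤ 2 * ‖c h‖) ∧ ‖c (2 * h)‖ ≤ ‖c h‖ / 4 := by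
  classical
  have hB := blockConst_nonneg
  have hs := bumpSlope_nonneg
  have hl0 := hθ l
  -- All non-resonant terms oscillate, after rescaling, at least at the rate `γ h`.
  obtain ⟨γ, hγ0, hγ⟩ : ∃ γ : ℝ, 0 < γ ∧ ∀ n ∈ F, γ ≤ θ n ∧ (n = l ∨ γ ≤ |θ n - θ l|) := by
    obtain ⟨n₀, _, hmin⟩ := F.exists_min_image
      (fun n => min (θ n) (if n = l then 1 else |θ n - θ l|)) ⟨l, hl⟩
    refine ⟨min (θ n₀) (if n₀ = l then 1 else |θ n₀ - θ l|), lt_min (hθ _) ?_, fun n hn => ?_⟩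
    · split_ifs with h
      · norm_num
      · exact abs_pos.mpr (sub_ne_zero.mpr fun he => h (hinj ‹_› hl he))
    · refine ⟨(hmin n hn).trans (min_le_left _ _), ?_⟩
      by_cases h : n = l
      · exact Or.inl h
      · refine Or.inr ((hmin n hn).trans ((min_le_right _ _).trans ?_))
        rw [if_neg h]
  have hS0 : 0 ≤ ∑ n ∈ F, 24 * θ n :=
    Finset.sum_nonneg fun n _ => by have := hθ n; positivity
  set A := (∑ n ∈ F, 24 * θ n) + blockConst * (F.card : ℝ) ^ 2 with hA
  set D := (∑ n ∈ F, 24 * θ n) * ((1 + bumpSlope) / γ) + blockConst * (F.card : ℝ) ^ 2 with hD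
  have hA0 : 0 ≤ A := by positivity
  have hD0 : 0 ≤ D := by positivity
  set K := 2 * A / θ l + 12 with hK
  filter_upwards [eventually_ge_atTop 1, eventually_ge_atTop (32 * (D / θ l) * Real.exp (2 * K))]
    with h hh1 hh2 z hz c hc hzl
  have hh : 0 < h := by linarith
  set m : ℂ := -Complex.I / (θ l : ℂ) with hm
  have hmn : ‖m‖ = (θ l)⁻¹ := by
    rw [hm, norm_div, norm_neg, Complex.norm_I, Complex.norm_real, Real.norm_eq_abs,
      abs_of_pos hl0, one_div]
  set ε₀ : ι → ℂ := fun _ => 1 with hε₀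
  set ε₁ : ι → ℂ := fun n => if n = l then 0 else 1 with hε₁
  have hε₀n : ∀ n, ‖ε₀ n‖ ≤ 1 := fun n => by simp [hε₀]
  have hε₁n : ∀ n, ‖ε₁ n‖ ≤ 1 := fun n => by simp only [hε₁]; split_ifs <;> simp
  have hscale : ∀ r : ℝ, γ ≤ |r| → γ * h ≤ |r * h| := fun r hr => by
    rw [abs_mul, abs_of_pos hh]
    gcongr
  have hP := fun (t : ℝ) (ht : t ∈ Icc (1 : ℝ) 2) => norm_blockPrimitive_le hθ F hz hε₀n (τ := 0) hh hγ0
    (fun n hn => Or.inr (by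
      rw [sub_zero]
      exact hscale _ (by rw [abs_of_pos (hθ n)]; exact (hγ n hn).1)))
    (fun n hn => by
      rw [sub_zero, ← neg_mul]
      exact hscale _ (by rw [abs_neg, abs_of_pos (hθ n)]; exact (hγ n hn).1)) ht
  have hQ := fun (t : ℝ) (ht : t ∈ Icc (1 : ℝ) 2) => norm_blockPrimitive_le hθ F hz hε₁n (τ := θ l * h) hh hγ0
    (fun n hn => by
      rcases (hγ n hn).2 with h0 | h0
      · exact Or.inl (by simp [hε₁, h0])
      · refine Or.inr ?_
        rw [← sub_mul]
        exact hscale _ h0)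
    (fun n hn => by
      rw [show -(θ n * h) - θ l * h = -(θ n + θ l) * h by ring]
      refine hscale _ ?_
      rw [abs_neg, abs_of_pos (by linarith [hθ n])]
      linarith [(hγ n hn).1]) ht
  have hp := fun t => norm_blockIntegrand_le hθ F hz hε₀n hh1 0 t
  have hq := fun t => norm_blockIntegrand_le hθ F hz hε₁n hh1 (θ l * h) t
  set R : ℝ → ℝ := fun t => ∫ s in (1 : ℝ)..t, 12 * bump s with hR
  have hRd : ∀ t, HasDerivAt R (12 * bump t) t := fun t =>
    ((continuous_const.mul bump.continuous).integral_hasStrictDerivAt 1 t).hasDerivAt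
  set d : ℝ → ℂ := fun t => c (h * t) with hd
  have hd1 : d 1 = c h := by simp [hd]
  have hdd : ∀ t, HasDerivAt d (m * blockIntegrand θ F z ε₀ h 0 t * d t +
      (m * blockIntegrand θ F z ε₁ h (θ l * h) t + (12 * bump t : ℝ) * (-Complex.I * z l)) *
        conj (d t)) t := by
    intro t
    have h1 := (hc (h * t)).scomp t ((hasDerivAt_id t).const_mul h)
    refine h1.congr_deriv ?_
    have h2 := blockIntegrand_zero θ F z hh t
    have h3 := blockIntegrand_shift θ F z hh hl t
    have hθl : (θ l : ℂ) ≠ 0 := by exact_mod_cast hl0.ne'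
    rw [← hε₀] at h2
    rw [← hε₁] at h3
    rw [h2, show m * blockIntegrand θ F z ε₁ h (θ l * h) t + (12 * bump t : ℝ) * (-Complex.I * z l)
      = m * (((h * blockPotential θ F z h (h * t) : ℝ) : ℂ) *
        Complex.exp (-(θ l * (h * t) : ℝ) * Complex.I)) by
      rw [h3, hm]
      push_cast
      field_simp
      ring]
    rw [ampField, show 2 * (θ l / 2) = θ l by ring, hm]
    simp only [hd, mul_one, Complex.real_smul]
    push_cast
    field_simp
    ring
  have hδ0 : 0 ≤ D / θ l / h := by positivity
  have key := norm_le_of_averaging (K := K) (δ := D / θ l / h) (R := R)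
    (P := fun t => m * blockPrimitive θ F z ε₀ h 0 t)
    (Q := fun t => m * blockPrimitive θ F z ε₁ h (θ l * h) t) (by positivity) hδ0
    (fun t _ => hdd t) (fun t _ => (hasDerivAt_blockPrimitive _ _ _ _ _ _ _).const_mul m)
    (fun t _ => (hasDerivAt_blockPrimitive _ _ _ _ _ _ _).const_mul m)
    (fun t _ => hRd t) (by simp [blockPrimitive_one]) (by simp [blockPrimitive_one]) (by simp [hR])
    (fun t ht => by
      rw [norm_mul, hmn]
      calc _ ≤ (θ l)⁻¹ * (D / h) := by gcongr; exact hP t ht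
        _ = _ := by field_simp)
    (fun t ht => by
      rw [norm_mul, hmn]
      calc _ ≤ (θ l)⁻¹ * (D / h) := by gcongr; exact hQ t ht
        _ = _ := by field_simp)
    (by rw [norm_mul, norm_neg, Complex.norm_I, one_mul]; exact hz l)
    (by
      rw [hd1, mul_assoc, hzl]
      linear_combination (c h) * Complex.I_mul_I)
    (fun t _ => by
      rw [norm_mul, norm_mul, hmn, hK, abs_of_nonneg (by have := bump.nonneg' t; positivity)]
      have h1 : 12 * bump t ≤ 12 := by linarith [bump.le_one (x := t)]
      have h2 : (θ l)⁻¹ * ‖blockIntegrand θ F z ε₀ h 0 t‖ ≤ (θ l)⁻¹ * A := by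
        gcongr
        exact hp t
      have h3 : (θ l)⁻¹ * ‖blockIntegrand θ F z ε₁ h (θ l * h) t‖ ≤ (θ l)⁻¹ * A := by
        gcongr
        exact hq t
      have h4 : 2 * A / θ l = (θ l)⁻¹ * A + (θ l)⁻¹ * A := by field_simp; ring
      linarith)
  rw [hd1] at key
  have herr : 4 * (D / θ l / h) * Real.exp (2 * K) ≤ 1 / 8 := by
    rw [show 4 * (D / θ l / h) * Real.exp (2 * K) = 4 * (D / θ l) * Real.exp (2 * K) / h by ring,
      div_le_iff₀ hh]
    linarith
  constructor
  · intro x hx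
    have ht : x / h ∈ Icc (1 : ℝ) 2 := by
      rw [mem_Icc, le_div_iff₀ hh, div_le_iff₀ hh]
      exact ⟨by linarith [hx.1], hx.2⟩
    have h1 := key _ ht
    have h2 : d (x / h) = c x := by
      simp only [hd]
      congr 1
      field_simp
    have h3 : 0 ≤ R (x / h) := intervalIntegral.integral_nonneg ht.1 fun s _ => by
      have := bump.nonneg' s
      positivity
    have h4 : Real.exp (-R (x / h)) ≤ 1 := Real.exp_le_one_iff.mpr (by linarith)
    rw [h2] at h1
    refine h1.trans ?_
    gcongr
    linarith
  · have h1 := key 2 ⟨by norm_num, le_rfl⟩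
    have h2 : d 2 = c (2 * h) := by simp only [hd]; rw [mul_comm]
    have h3 : Real.exp (-R 2) ≤ 1 / 8 := by
      refine le_trans ?_ exp_neg_three_le
      gcongr
      exact bump_primitive_two
    rw [h2] at h1
    refine h1.trans ?_
    rw [show ‖c h‖ / 4 = 1 / 4 * ‖c h‖ by ring]
    gcongr
    linarith

end Block

/-! ### The schedule of active frequencies -/

theorem freq_pos (m : ℕ+ → ℕ+) (n : ℕ+) : 0 < freq m n := by
  unfold freq
  have h1 : (0 : ℝ) < m n := by exact_mod_cast (m n).pos
  have h2 : (0 : ℝ) < n := by exact_mod_cast n.pos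
  positivity

/-- The index chosen to represent the value `freq m n`: the largest index of this value if there
are finitely many, the smallest one otherwise. Decay in the representative then implies decay in
every index that counts for this value, see `IsRepresentative.le_of_indexCounts`. -/
def IsRepresentative (m : ℕ+ → ℕ+) (n : ℕ+) : Prop :=
  ({k | freq m k = freq m n}.Finite ∧ ∀ k, freq m k = freq m n → k ≤ n) ∨
    ({k | freq m k = freq m n}.Infinite ∧ ∀ k, freq m k = freq m n → n ≤ k)

theorem exists_isRepresentative (m : ℕ+ → ℕ+) (n : ℕ+) :
    ∃ k, freq m k = freq m n ∧ IsRepresentative m k := by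
  by_cases h : {k | freq m k = freq m n}.Finite
  · obtain ⟨k, hk, hmax⟩ := h.exists_maximalFor id _ ⟨n, rfl⟩
    refine ⟨k, hk, Or.inl ?_⟩
    rw [show freq m k = freq m n from hk]
    refine ⟨h, fun k' hk' => ?_⟩
    rcases le_total k' k with h' | h'
    · exact h'
    · exact hmax hk' h'
  · obtain ⟨k, hk, hmin⟩ := WellFounded.has_min (wellFounded_lt (α := ℕ+))
      {k | freq m k = freq m n} ⟨n, rfl⟩
    refine ⟨k, hk, Or.inr ?_⟩
    rw [show freq m k = freq m n from hk]
    exact ⟨h, fun k' hk' => not_lt.mp (hmin k' hk')⟩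

theorem IsRepresentative.eq {m : ℕ+ → ℕ+} {n k : ℕ+} (hn : IsRepresentative m n)
    (hk : IsRepresentative m k) (h : freq m n = freq m k) : n = k := by
  rcases hn with ⟨h1, h2⟩ | ⟨h1, h2⟩ <;> rcases hk with ⟨h3, h4⟩ | ⟨h3, h4⟩
  · exact le_antisymm (h4 _ h) (h2 _ h.symm)
  · rw [h] at h1
    exact absurd h1 h3
  · rw [h] at h1
    exact absurd h3 h1
  · exact le_antisymm (h2 _ h.symm) (h4 _ h)

theorem IsRepresentative.le_of_indexCounts {m : ℕ+ → ℕ+} {n k : ℕ+} (hn : IsRepresentative m n)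
    (hk : IndexCounts m k) (h : freq m k = freq m n) : k ≤ n := by
  rcases hn with ⟨h1, h2⟩ | ⟨h1, h2⟩
  · exact h2 k h
  · rcases hk with h3 | h3
    · rw [h] at h3
      exact absurd h3 h1
    · exact h3 n h.symm

/-- The block at scale `h` with active set `F` reduces the amplitude of each of its solutions by a
factor of at least `4`, whatever the incoming phases. -/
def BlockReduces (θ : ℕ+ → ℝ) (F : Finset ℕ+) (h : ℝ) : Prop :=
  ∀ l ∈ F, ∀ z : ℕ+ → ℂ, (∀ n, ‖z n‖ ≤ 1) → ∀ c : ℝ → ℂ,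
    (∀ x, HasDerivAt c (ampField (blockPotential θ F z h) (θ l / 2) x (c x)) x) →
    z l * conj (c h) = -Complex.I * c h →
    (∀ x ∈ Icc h (2 * h), ‖c x‖ ≤ 2 * ‖c h‖) ∧ ‖c (2 * h)‖ ≤ ‖c h‖ / 4

/-- A choice, for each dyadic block, of the finite set of indices that are active there: new
frequencies join so late that they obey every required bound. -/
structure Schedule (m : ℕ+ → ℕ+) where
  /-- The indices that are active on the `j`-th dyadic block. -/
  active : ℕ → Finset ℕ+
  isRepresentative : ∀ j, ∀ n ∈ active j, IsRepresentative m n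
  reduces : ∀ j, BlockReduces (freq m) (active j) (2 ^ j)
  small : ∀ j, ∑ n ∈ active j, 24 * freq m n / 2 ^ j +
    blockConst * ((active j).card : ℝ) ^ 2 / (2 ^ j) ^ 2 ≤ 1
  decay : ∀ j, ∀ n ∈ active j, 24 * freq m n / 2 ^ j ≤ Real.exp (-((n : ℝ) + freq m n))
  eventually_active : ∀ n, IsRepresentative m n → ∀ᶠ j in atTop, n ∈ active j

theorem Schedule.injOn {m : ℕ+ → ℕ+} (S : Schedule m) (j : ℕ) :
    Set.InjOn (freq m) (S.active j) := fun n hn k hk h =>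
  (S.isRepresentative j n hn).eq (S.isRepresentative j k hk) h

theorem nonempty_schedule (m : ℕ+ → ℕ+) : Nonempty (Schedule m) := by
  classical
  set S : ℕ+ → Finset ℕ+ := fun N => (Finset.Icc 1 N).filter (IsRepresentative m) with hS
  have hmemS : ∀ N n, n ∈ S N ↔ n ≤ N ∧ IsRepresentative m n := fun N n => by
    simp [hS]
  have hinjS : ∀ N, Set.InjOn (freq m) (S N) := fun N n hn k hk h =>
    ((hmemS N n).mp hn).2.eq ((hmemS N k).mp hk).2 h
  have hlim : ∀ a : ℝ, Tendsto (fun h : ℝ => a / h) atTop (𝓝 0) := fun a =>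
    tendsto_const_nhds.div_atTop tendsto_id
  have hpow : Tendsto (fun j : ℕ => (2 : ℝ) ^ j) atTop atTop :=
    tendsto_pow_atTop_atTop_of_one_lt (by norm_num)
  have hev : ∀ N : ℕ+, ∀ᶠ h : ℝ in atTop, BlockReduces (freq m) (S N) h ∧
      (∑ n ∈ S N, 24 * freq m n / h + blockConst * ((S N).card : ℝ) ^ 2 / h ^ 2 ≤ 1) ∧
      24 * freq m N / h ≤ Real.exp (-((N : ℝ) + freq m N)) := by
    intro N
    refine Eventually.and ?_ (Eventually.and ?_ ?_)
    · exact (Filter.eventually_all_finset (S N)).mpr fun l hl =>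
        eventually_block_reduction (freq_pos m) (S N) (hinjS N) hl
    · have h1 : Tendsto (fun h : ℝ => ∑ n ∈ S N, 24 * freq m n / h +
          blockConst * ((S N).card : ℝ) ^ 2 / h ^ 2) atTop (𝓝 (∑ n ∈ S N, 0 + 0)) :=
        (tendsto_finsetSum _ fun n _ => hlim _).add
          (tendsto_const_nhds.div_atTop (tendsto_pow_atTop (by norm_num)))
      rw [Finset.sum_const_zero, add_zero] at h1
      exact h1.eventually (eventually_le_nhds one_pos)
    · exact (hlim _).eventually (eventually_le_nhds (Real.exp_pos _))
  have hev2 : ∀ N : ℕ+, ∃ H : ℕ, ∀ j ≥ H, BlockReduces (freq m) (S N) (2 ^ j) ∧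
      (∑ n ∈ S N, 24 * freq m n / 2 ^ j +
        blockConst * ((S N).card : ℝ) ^ 2 / (2 ^ j) ^ 2 ≤ 1) ∧
      24 * freq m N / 2 ^ j ≤ Real.exp (-((N : ℝ) + freq m N)) := fun N =>
    eventually_atTop.mp (hpow.eventually (hev N))
  choose H hH using hev2
  set F : ℕ → Finset ℕ+ := fun j => (Finset.Icc 1 j.succPNat).filter
    (fun n => IsRepresentative m n ∧ ∀ k ≤ n, H k ≤ j) with hF
  have hmemF : ∀ j n, n ∈ F j ↔ n ≤ j.succPNat ∧ IsRepresentative m n ∧ ∀ k ≤ n, H k ≤ j :=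
    fun j n => by simp [hF]
  -- Each active set is empty or one of the sets `S N` with `H N ≤ j`.
  have hFS : ∀ j, F j = ∅ ∨ ∃ N, H N ≤ j ∧ F j = S N := by
    intro j
    set G := (Finset.Icc 1 j.succPNat).filter (fun n => ∀ k ≤ n, H k ≤ j) with hG
    have hmemG : ∀ n, n ∈ G ↔ n ≤ j.succPNat ∧ ∀ k ≤ n, H k ≤ j := fun n => by simp [hG]
    by_cases hne : G.Nonempty
    · right
      have hN := (hmemG _).mp (G.max'_mem hne)
      refine ⟨G.max' hne, hN.2 _ le_rfl, ?_⟩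
      ext n
      rw [hmemF, hmemS]
      constructor
      · rintro ⟨h1, h2, h3⟩
        exact ⟨G.le_max' n ((hmemG n).mpr ⟨h1, h3⟩), h2⟩
      · rintro ⟨h1, h2⟩
        exact ⟨h1.trans hN.1, h2, fun k hk => hN.2 k (hk.trans h1)⟩
    · left
      rw [Finset.eq_empty_iff_forall_notMem]
      intro n hn
      have := (hmemF j n).mp hn
      exact hne ⟨n, (hmemG n).mpr ⟨this.1, this.2.2⟩⟩
  refine ⟨⟨F, fun j n hn => ((hmemF j n).mp hn).2.1, fun j => ?_, fun j => ?_, fun j n hn => ?_,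
    fun n hn => ?_⟩⟩
  · rcases hFS j with h | ⟨N, hN, h⟩
    · rw [h]
      intro l hl
      simp at hl
    · rw [h]
      exact (hH N j hN).1
  · rcases hFS j with h | ⟨N, hN, h⟩
    · simp [h]
    · rw [h]
      exact (hH N j hN).2.1
  · exact (hH n j (((hmemF j n).mp hn).2.2 n le_rfl)).2.2
  · have h1 : ∀ᶠ j : ℕ in atTop, ∀ k ∈ Finset.Icc 1 n, H k ≤ j :=
      (Filter.eventually_all_finset _).mpr fun k _ => eventually_ge_atTop (H k)
    filter_upwards [h1, eventually_ge_atTop (n : ℕ)] with j hj1 hj2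
    refine (hmemF j n).mpr ⟨?_, hn, fun k hk => hj1 k (by simp [hk])⟩
    rw [← PNat.coe_le_coe, Nat.succPNat_coe]
    omega

/-! ### The potential -/

/-- The phase with which the block has to oscillate to damp a solution of incoming amplitude `s`;
it is `0` (no oscillation) if `s = 0`. -/
noncomputable def dampingPhase (s : ℂ) : ℂ := -Complex.I * s / conj s

theorem norm_dampingPhase_le (s : ℂ) : ‖dampingPhase s‖ ≤ 1 := by
  rw [dampingPhase, norm_div, norm_mul, norm_neg, Complex.norm_I, one_mul, RCLike.norm_conj]
  exact div_self_le_one _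

theorem dampingPhase_mul_conj (s : ℂ) : dampingPhase s * conj s = -Complex.I * s := by
  by_cases h : s = 0
  · simp [h]
  · have : conj s ≠ 0 := by simpa using h
    rw [dampingPhase, div_mul_cancel₀ _ this]

namespace Schedule

variable {m : ℕ+ → ℕ+} (S : Schedule m)

/-- The block at scale `2 ^ j` of the potential on the positive half-line when the solutions enter
it with amplitudes `s`. -/
noncomputable def block (j : ℕ) (s : ℕ+ → ℂ) : ℝ → ℝ :=
  blockPotential (freq m) (S.active j) (fun n => dampingPhase (s n)) (2 ^ j)

theorem contDiff_block (j : ℕ) (s : ℕ+ → ℂ) : ContDiff ℝ ∞ (S.block j s) :=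
  contDiff_blockPotential _ _ _ _

theorem abs_block_le (j : ℕ) (s : ℕ+ → ℂ) (x : ℝ) : |S.block j s x| ≤ 1 :=
  (abs_blockPotential_le (freq_pos m) _ (fun _ => norm_dampingPhase_le _) (by positivity) x).trans
    (S.small j)

theorem exists_block_solution (j : ℕ) (s : ℕ+ → ℂ) (n : ℕ+) :
    ∃ c : ℝ → ℂ, c (2 ^ j) = s n ∧
      ∀ x, HasDerivAt c (ampField (S.block j s) (freq m n / 2) x (c x)) x :=
  exists_amplitude (S.contDiff_block j s).continuous (S.abs_block_le j s)
    (by have := freq_pos m n; positivity) _ _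

/-- The amplitude of the `n`-th solution across the `j`-th block. -/
noncomputable def blockSolution (j : ℕ) (s : ℕ+ → ℂ) (n : ℕ+) : ℝ → ℂ :=
  (S.exists_block_solution j s n).choose

theorem blockSolution_left (j : ℕ) (s : ℕ+ → ℂ) (n : ℕ+) : S.blockSolution j s n (2 ^ j) = s n :=
  (S.exists_block_solution j s n).choose_spec.1

theorem hasDerivAt_blockSolution (j : ℕ) (s : ℕ+ → ℂ) (n : ℕ+) (x : ℝ) :
    HasDerivAt (S.blockSolution j s n)
      (ampField (S.block j s) (freq m n / 2) x (S.blockSolution j s n x)) x :=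
  (S.exists_block_solution j s n).choose_spec.2 x

/-- The amplitudes of all solutions at the point `2 ^ j`, determined recursively: they fix the
phases of the `j`-th block, which in turn fixes the amplitudes at `2 ^ (j + 1)`. The initial value
corresponds to the solution `sin (θₙ x / 2)` of the free equation. -/
noncomputable def state : ℕ → ℕ+ → ℂ
  | 0 => fun _ => -Complex.I / 2
  | j + 1 => fun n => S.blockSolution j (state j) n (2 ^ (j + 1))

/-- The even extension of the `j`-th block. -/
noncomputable def evenBlock (j : ℕ) (x : ℝ) : ℝ :=
  S.block j (S.state j) x + S.block j (S.state j) (-x)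

/-- The potential. -/
noncomputable def potential : ℝ → ℝ := glue S.evenBlock

theorem isBlockFamily_evenBlock : IsBlockFamily S.evenBlock :=
  isBlockFamily_of_bumps fun j x h1 h2 h3 h4 => by
    simp [evenBlock, block, blockPotential, h1, h2, h3, h4]

theorem contDiff_potential : ContDiff ℝ ∞ S.potential :=
  S.isBlockFamily_evenBlock.contDiff_glue fun j =>
    (S.contDiff_block j _).add ((S.contDiff_block j _).comp contDiff_neg)

theorem potential_neg (x : ℝ) : S.potential (-x) = S.potential x := by
  rw [potential, glue, glue, dyadic_neg, evenBlock, evenBlock, neg_neg, add_comm]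

theorem block_of_nonpos (j : ℕ) (s : ℕ+ → ℂ) {x : ℝ} (hx : x ≤ 0) : S.block j s x = 0 := by
  have hd : x / 2 ^ j ≤ 0 := div_nonpos_of_nonpos_of_nonneg hx (by positivity)
  have h1 : bump (x / 2 ^ j) = 0 := by
    by_contra hne
    linarith [(bump_ne_zero hne).1]
  have h2 : wideBump (x / 2 ^ j) = 0 := by
    by_contra hne
    linarith [(wideBump_ne_zero hne).1]
  simp [block, blockPotential, h1, h2]

theorem abs_potential_le (x : ℝ) : |S.potential x| ≤ 1 := by
  rw [potential, glue, evenBlock]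
  rcases le_total x 0 with h | h
  · rw [S.block_of_nonpos _ _ h, zero_add]
    exact S.abs_block_le _ _ _
  · rw [S.block_of_nonpos _ _ (neg_nonpos.mpr h), add_zero]
    exact S.abs_block_le _ _ _

theorem potential_eq_block {j : ℕ} {x : ℝ} (hx : x ∈ Icc ((2 : ℝ) ^ j) (2 ^ (j + 1))) :
    S.potential x = S.block j (S.state j) x := by
  have h0 : 0 < x := lt_of_lt_of_le (by positivity) hx.1
  rw [potential, S.isBlockFamily_evenBlock.glue_eq_of_mem (j := j) (by rw [abs_of_pos h0]; exact hx.1)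
    (by rw [abs_of_pos h0]; exact hx.2), evenBlock, S.block_of_nonpos _ _ (neg_nonpos.mpr h0.le),
    add_zero]

/-! ### Decaying solutions -/

theorem exists_global_amplitude (n : ℕ+) : ∃ c : ℝ → ℂ, c 0 = -Complex.I / 2 ∧
    ∀ x, HasDerivAt c (ampField S.potential (freq m n / 2) x (c x)) x :=
  exists_amplitude S.contDiff_potential.continuous S.abs_potential_le
    (by have := freq_pos m n; positivity) _ _

variable {S} {n : ℕ+} {c : ℝ → ℂ}

theorem amplitude_eqOn_block (hc : ∀ x, HasDerivAt c (ampField S.potential (freq m n / 2) x (c x)) x)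
    {j : ℕ} (hj : c (2 ^ j) = S.state j n) :
    EqOn c (S.blockSolution j (S.state j) n) (Icc (2 ^ j) (2 ^ (j + 1))) :=
  amplitude_unique_Icc S.abs_potential_le (by have := freq_pos m n; positivity)
    (fun _ hx => (S.potential_eq_block hx).symm) hc (S.hasDerivAt_blockSolution j _ n)
    (by rw [hj, S.blockSolution_left])

/-- The recursively defined `state` is the restriction of the global amplitude to the powers of `2`:
the phases of each block are those that damp every active solution. -/
theorem amplitude_two_pow (hc0 : c 0 = -Complex.I / 2)
    (hc : ∀ x, HasDerivAt c (ampField S.potential (freq m n / 2) x (c x)) x) (j : ℕ) :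
    c (2 ^ j) = S.state j n := by
  induction j with
  | zero =>
    have h := amplitude_unique_Icc (V' := 0) (d := fun _ => -Complex.I / 2) (a := 0) (b := 1)
      S.abs_potential_le (by have := freq_pos m n; positivity)
      (fun x hx => (S.isBlockFamily_evenBlock.glue_eq_zero
        (by rw [abs_of_nonneg hx.1]; exact hx.2)).symm) hc
      (fun x => by simpa [ampField] using hasDerivAt_const x (-Complex.I / 2)) hc0
    rw [pow_zero, h ⟨zero_le_one, le_rfl⟩, state]
  | succ j ih =>
    rw [amplitude_eqOn_block hc ih ⟨pow_le_pow_right₀ (by norm_num) (by omega), le_rfl⟩, state]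

theorem amplitude_block_bounds (hc0 : c 0 = -Complex.I / 2)
    (hc : ∀ x, HasDerivAt c (ampField S.potential (freq m n / 2) x (c x)) x) {j : ℕ}
    (hn : n ∈ S.active j) :
    (∀ x ∈ Icc ((2 : ℝ) ^ j) (2 ^ (j + 1)), ‖c x‖ ≤ 2 * ‖c (2 ^ j)‖) ∧
      ‖c (2 ^ (j + 1))‖ ≤ ‖c (2 ^ j)‖ / 4 := by
  have hj := amplitude_two_pow hc0 hc j
  have heq := amplitude_eqOn_block hc hj
  have h := S.reduces j n hn (fun n => dampingPhase (S.state j n))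
    (fun _ => norm_dampingPhase_le _) _ (S.hasDerivAt_blockSolution j (S.state j) n)
    (by rw [S.blockSolution_left]; exact dampingPhase_mul_conj _)
  rw [S.blockSolution_left, ← hj, show (2 : ℝ) * 2 ^ j = 2 ^ (j + 1) by rw [pow_succ, mul_comm]] at h
  refine ⟨fun x hx => ?_, ?_⟩
  · rw [heq hx]
    exact h.1 x hx
  · rw [heq ⟨pow_le_pow_right₀ (by norm_num) (by omega), le_rfl⟩]
    exact h.2

/-- The potential is even and the initial value describes an odd solution, so that decay on the
positive half-line is decay on both sides. -/
theorem amplitude_neg (hc0 : c 0 = -Complex.I / 2)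
    (hc : ∀ x, HasDerivAt c (ampField S.potential (freq m n / 2) x (c x)) x) (x : ℝ) :
    c (-x) = -conj (c x) := by
  have hd : ∀ x, HasDerivAt (fun x => -conj (c (-x)))
      (ampField S.potential (freq m n / 2) x (-conj (c (-x)))) x := by
    intro x
    have h1 : HasDerivAt (fun x => c (-x)) (-ampField S.potential (freq m n / 2) (-x) (c (-x))) x := by
      have := (hc (-x)).scomp x (hasDerivAt_neg x)
      simpa [Function.comp_def] using this
    have h2 := (Complex.conjCLE.toContinuousLinearMap.hasFDerivAt.comp_hasDerivAt x h1).neg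
    refine h2.congr_deriv ?_
    change -conj (-ampField S.potential (freq m n / 2) (-x) (c (-x))) = _
    unfold ampField
    rw [S.potential_neg]
    simp only [map_neg, map_mul, map_add, Complex.conj_ofReal, Complex.conj_I, Complex.conj_conj,
      ← Complex.exp_conj, neg_neg]
    rw [show 2 * (freq m n / 2) * -x = -(2 * (freq m n / 2) * x) by ring]
    simp only [Complex.ofReal_neg]
    ring_nf
  have h := amplitude_unique S.abs_potential_le (by have := freq_pos m n; positivity) hc hd (x₀ := 0)
    (by simp [hc0, neg_div, map_ofNat (starRingEnd ℂ) 2])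
  have := congrFun h (-x)
  rwa [neg_neg] at this

/-- Once the `n`-th frequency is active, its amplitude drops by a factor `4` while `|x|` doubles,
which is decay like `⟨x⟩⁻²`. -/
theorem exists_amplitude_bound (hn : IsRepresentative m n) (hc0 : c 0 = -Complex.I / 2)
    (hc : ∀ x, HasDerivAt c (ampField S.potential (freq m n / 2) x (c x)) x) :
    ∃ C, ∀ x, ‖c x‖ ≤ C / (1 + x ^ 2) := by
  obtain ⟨J, hJ⟩ := eventually_atTop.mp (S.eventually_active n hn)
  have hcont : Continuous c := continuous_iff_continuousAt.mpr fun x => (hc x).continuousAt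
  obtain ⟨B, hB⟩ := (isCompact_Icc (a := (0 : ℝ)) (b := 2 ^ J)).exists_bound_of_continuousOn
    hcont.continuousOn
  have hB0 : 0 ≤ B := (norm_nonneg _).trans (hB 0 ⟨le_rfl, by positivity⟩)
  have hgeom : ∀ i, 4 ^ (J + i) * ‖c (2 ^ (J + i))‖ ≤ 4 ^ J * ‖c (2 ^ J)‖ := by
    intro i
    induction i with
    | zero => simp
    | succ i ih =>
      refine le_trans ?_ ih
      have := (amplitude_block_bounds hc0 hc (hJ (J + i) (by omega))).2
      rw [← add_assoc, pow_succ (4 : ℝ)]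
      have h4 : (0 : ℝ) < 4 ^ (J + i) := by positivity
      nlinarith
  have hpos : ∀ x, 0 ≤ x → ‖c x‖ ≤ (B * (1 + (2 ^ J) ^ 2) + 10 * (4 ^ J * ‖c (2 ^ J)‖)) /
      (1 + x ^ 2) := by
    intro x hx
    rw [le_div_iff₀ (by positivity)]
    rcases le_total x (2 ^ J) with h | h
    · have h1 : ‖c x‖ * (1 + x ^ 2) ≤ B * (1 + (2 ^ J) ^ 2) := by
        gcongr
        exact hB x ⟨hx, h⟩
      have : 0 ≤ 10 * (4 ^ J * ‖c (2 ^ J)‖) := by positivity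
      linarith
    · have hx1 : 1 ≤ |x| := by
        rw [abs_of_nonneg hx]
        exact le_trans (one_le_pow₀ (by norm_num)) h
      have h1 := two_pow_dyadic_le hx1
      have h2 := lt_two_pow_dyadic_succ x
      rw [abs_of_nonneg hx] at h1 h2
      have hJj : J ≤ dyadic x := by
        have : (2 : ℝ) ^ J < 2 ^ (dyadic x + 1) := h.trans_lt h2
        have := (pow_lt_pow_iff_right₀ (by norm_num : (1 : ℝ) < 2)).mp this
        omega
      obtain ⟨i, hi⟩ := Nat.exists_eq_add_of_le hJj
      have h3 := (amplitude_block_bounds hc0 hc (hJ _ hJj)).1 x ⟨h1, h2.le⟩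
      have h4 := hgeom i
      rw [← hi] at h4
      have h5 : 1 + x ^ 2 ≤ 5 * 4 ^ dyadic x := by
        have e : (4 : ℝ) ^ dyadic x = (2 ^ dyadic x) ^ 2 := by
          rw [← pow_mul, mul_comm, pow_mul]
          norm_num
        have h6 : (1 : ℝ) ≤ 2 ^ dyadic x := one_le_pow₀ (by norm_num)
        rw [pow_succ] at h2
        rw [e]
        nlinarith
      have h7 : 0 ≤ B * (1 + (2 ^ J) ^ 2) := by positivity
      calc ‖c x‖ * (1 + x ^ 2) ≤ (2 * ‖c (2 ^ dyadic x)‖) * (5 * 4 ^ dyadic x) := by gcongr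
        _ = 10 * (4 ^ dyadic x * ‖c (2 ^ dyadic x)‖) := by ring
        _ ≤ 10 * (4 ^ J * ‖c (2 ^ J)‖) := by gcongr
        _ ≤ _ := by linarith
  refine ⟨B * (1 + (2 ^ J) ^ 2) + 10 * (4 ^ J * ‖c (2 ^ J)‖), fun x => ?_⟩
  rcases le_total 0 x with h | h
  · exact hpos x h
  · have h1 := hpos (-x) (by linarith)
    rwa [amplitude_neg hc0 hc, norm_neg, RCLike.norm_conj, neg_sq] at h1

/-- For every frequency there is a solution of `u'' = (W - (θₙ / 2)²) u` which, together with its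
derivative, is `O(⟨x⟩⁻²)`. -/
theorem exists_decaying_solution (S : Schedule m) (n : ℕ+) :
    ∃ u v : ℝ → ℝ, (∀ x, HasDerivAt u (v x) x) ∧
      (∀ x, HasDerivAt v ((S.potential x - (freq m n / 2) ^ 2) * u x) x) ∧
      (∃ C, ∀ x, |u x| ≤ C / (1 + x ^ 2) ∧ |v x| ≤ C / (1 + x ^ 2)) ∧ v 0 ≠ 0 := by
  obtain ⟨k, hk, hrep⟩ := exists_isRepresentative m n
  obtain ⟨c, hc0, hc⟩ := S.exists_global_amplitude k
  obtain ⟨C, hC⟩ := exists_amplitude_bound hrep hc0 hc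
  have hκ : 0 < freq m k / 2 := by have := freq_pos m k; positivity
  rw [← hk]
  set κ := freq m k / 2
  refine ⟨fun x => 2 * (c x * Complex.exp ((κ * x : ℝ) * Complex.I)).re,
    fun x => -(2 * κ) * (c x * Complex.exp ((κ * x : ℝ) * Complex.I)).im,
    fun x => (hasDerivAt_of_amplitude hκ (hc x)).1, fun x => (hasDerivAt_of_amplitude hκ (hc x)).2,
    ⟨(2 + 2 * κ) * C, fun x => ?_⟩, ?_⟩
  · have hn : ‖c x * Complex.exp ((κ * x : ℝ) * Complex.I)‖ ≤ C / (1 + x ^ 2) := by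
      rw [norm_mul, Complex.norm_exp_ofReal_mul_I, mul_one]
      exact hC x
    have h0 : 0 ≤ C / (1 + x ^ 2) := (norm_nonneg _).trans hn
    have h1 := (Complex.abs_re_le_norm _).trans hn
    have h2 := (Complex.abs_im_le_norm _).trans hn
    rw [mul_div_assoc]
    constructor
    · rw [abs_mul, abs_two]
      nlinarith
    · rw [abs_mul, abs_neg, abs_of_pos (by positivity : 0 < 2 * κ)]
      nlinarith
  · simp [hc0]
    exact hκ.ne'

end Schedule

/-! ### The potential is limit-periodic -/

theorem exp_neg_le_bracket (N : ℕ) {t : ℝ} (ht : 0 ≤ t) :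
    Real.exp (-t) ≤ N.factorial * Real.exp 1 * (bracket t ^ N)⁻¹ := by
  have h1 : bracket t ^ N ≤ (1 + t) ^ N := by
    have := bracket_le_one_add_abs t
    rw [abs_of_nonneg ht] at this
    exact pow_le_pow_left₀ (bracket_pos t).le this N
  have h2 := Real.pow_div_factorial_le_exp (1 + t) (by linarith) N
  rw [div_le_iff₀ (by positivity), Real.exp_add] at h2
  have hb : 0 < bracket t ^ N := pow_pos (bracket_pos t) N
  rw [← div_eq_mul_inv, le_div_iff₀ hb, Real.exp_neg, inv_mul_le_iff₀ (Real.exp_pos t)]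
  linarith

theorem bracket_abs (x : ℝ) : bracket |x| = bracket x := by
  rw [bracket, bracket, sq_abs]

theorem isLimitPeriodicCoefficient_zero (m : ℕ+ → ℕ+) : IsLimitPeriodicCoefficient m 0 := by
  have hi : ∀ k x, iteratedDeriv k (fun _ : ℝ => (0 : ℂ)) x = 0 := fun k x => by
    rw [iteratedDeriv_const]
    split_ifs <;> rfl
  refine ⟨contDiff_const, fun _ _ => 0, fun _ _ => contDiff_const, fun x => ?_,
    fun k N => ⟨0, fun θ _ x => ?_⟩, fun k N => ⟨0, fun n _ x => ?_⟩⟩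
  · simp
  · simp [hi]
  · simp [hi]

namespace Schedule

variable {m : ℕ+ → ℕ+} (S : Schedule m)

/-- The Fourier coefficient of the oscillating part of the `j`-th block at the frequency `θ`. -/
noncomputable def oscCoeff (θ : ℝ) (j : ℕ) : ℂ :=
  ∑ n ∈ S.active j, ((12 * freq m n / 2 ^ j : ℝ) : ℂ) *
    ((if freq m n = θ then dampingPhase (S.state j n) else 0) +
      (if -freq m n = θ then conj (dampingPhase (S.state j n)) else 0))

/-- The coefficient of the non-oscillating part of the `j`-th block, which is assigned to the
frequency `0`. -/
noncomputable def meanCoeff (θ : ℝ) (j : ℕ) : ℝ :=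
  if 0 = θ then blockConst * ((S.active j).card : ℝ) ^ 2 / (2 ^ j) ^ 2 else 0

/-- The slowly varying coefficient of the potential at the frequency `θ`. -/
noncomputable def coeff (θ : ℝ) : ℝ → ℂ :=
  glue fun j => coeffBlock (S.oscCoeff θ j) (S.meanCoeff θ j) (2 ^ j)

theorem contDiff_coeff (θ : ℝ) : ContDiff ℝ ∞ (S.coeff θ) :=
  (isBlockFamily_coeffBlock _ _).contDiff_glue fun _ => contDiff_coeffBlock _ _ _

/-- The coefficient as a sum of terms each of which lives at a single frequency `±θₙ` or `0`. -/
theorem coeff_eq (θ x : ℝ) : S.coeff θ x =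
    ∑ n ∈ S.active (dyadic x), ((12 * freq m n / 2 ^ dyadic x : ℝ) : ℂ) *
      ((if freq m n = θ then dampingPhase (S.state (dyadic x) n) * bump (x / 2 ^ dyadic x) +
          conj (dampingPhase (S.state (dyadic x) n)) * bump (-x / 2 ^ dyadic x) else 0) +
        (if -freq m n = θ then conj (dampingPhase (S.state (dyadic x) n)) * bump (x / 2 ^ dyadic x) +
          dampingPhase (S.state (dyadic x) n) * bump (-x / 2 ^ dyadic x) else 0)) +
    if 0 = θ then ((blockConst * ((S.active (dyadic x)).card : ℝ) ^ 2 / (2 ^ dyadic x) ^ 2 *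
      (wideBump (x / 2 ^ dyadic x) + wideBump (-x / 2 ^ dyadic x)) : ℝ) : ℂ) else 0 := by
  rw [coeff, glue, coeffBlock, add_assoc (_ + _)]
  congr 1
  · rw [oscCoeff, map_sum, Finset.sum_mul, Finset.sum_mul, ← Finset.sum_add_distrib]
    refine Finset.sum_congr rfl fun n _ => ?_
    rw [map_mul, Complex.conj_ofReal, map_add, apply_ite conj, apply_ite conj, Complex.conj_conj,
      map_zero]
    split_ifs <;> ring
  · rw [meanCoeff]
    split_ifs
    · push_cast
      ring
    · simp

theorem hasSum_coeff (x : ℝ) : HasSum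
    (fun θ : freqSet m => Complex.exp (Complex.I * ((θ : ℝ) : ℂ) * (x : ℂ)) * S.coeff θ x)
    (S.potential x : ℂ) := by
  -- A summand that is present at a single frequency only.
  have hsingle : ∀ (t : ℝ), t ∈ freqSet m → ∀ G : ℂ, HasSum
      (fun θ : freqSet m => Complex.exp (Complex.I * ((θ : ℝ) : ℂ) * (x : ℂ)) *
        (if t = (θ : ℝ) then G else 0)) (Complex.exp (Complex.I * (t : ℂ) * (x : ℂ)) * G) := by
    intro t ht G
    have h := hasSum_single (f := fun θ : freqSet m =>
      Complex.exp (Complex.I * ((θ : ℝ) : ℂ) * (x : ℂ)) * (if t = (θ : ℝ) then G else 0))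
      ⟨t, ht⟩ fun θ hθ => by
        have : t ≠ (θ : ℝ) := fun h => hθ (Subtype.ext h.symm)
        simp [this]
    simpa using h
  simp_rw [S.coeff_eq, mul_add, Finset.mul_sum]
  set j := dyadic x with hj
  have hsum := (hasSum_sum fun n (_ : n ∈ S.active j) =>
    (((hsingle (freq m n) (Or.inl (Or.inl ⟨n, rfl⟩))
      (dampingPhase (S.state j n) * bump (x / 2 ^ j) +
          conj (dampingPhase (S.state j n)) * bump (-x / 2 ^ j))).add
      (hsingle (-freq m n) (Or.inl (Or.inr ⟨n, rfl⟩))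
      (conj (dampingPhase (S.state j n)) * bump (x / 2 ^ j) +
          dampingPhase (S.state j n) * bump (-x / 2 ^ j)))).mul_left
            ((12 * freq m n / 2 ^ j : ℝ) : ℂ))).add
    (hsingle 0 (Or.inr rfl) ((blockConst * ((S.active j).card : ℝ) ^ 2 / (2 ^ j) ^ 2 *
      (wideBump (x / 2 ^ j) + wideBump (-x / 2 ^ j)) : ℝ) : ℂ))
  refine Eq.mp (congrArg₂ (fun f a => HasSum f a) (funext fun θ => ?_) ?_) hsum
  · congr 1
    · refine Finset.sum_congr rfl fun n _ => ?_
      ring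
    · simp only [mul_add]
  · have hre : ∀ w : ℂ, ((w.re : ℝ) : ℂ) = (w + conj w) / 2 := fun w => by
      rw [Complex.add_conj]
      push_cast
      ring
    symm
    rw [potential, glue, ← hj, evenBlock, block, blockPotential, blockPotential]
    push_cast
    rw [add_add_add_comm, ← Finset.sum_add_distrib]
    congr 1
    · refine Finset.sum_congr rfl fun n _ => ?_
      rw [hre, hre, map_mul, map_mul, ← Complex.exp_conj, ← Complex.exp_conj]
      simp only [map_mul, Complex.conj_ofReal, Complex.conj_I, map_neg]
      rw [show (freq m n : ℂ) * (x : ℂ) * Complex.I = Complex.I * freq m n * x by ring,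
        show (freq m n : ℂ) * (x : ℂ) * -Complex.I = Complex.I * -freq m n * x by ring,
        show (freq m n : ℂ) * -(x : ℂ) * Complex.I = Complex.I * -freq m n * x by ring,
        show (freq m n : ℂ) * -(x : ℂ) * -Complex.I = Complex.I * freq m n * x by ring]
      ring
    · simp
      ring

/-- At most one active index has a given frequency, so that a single summand bounds the
coefficient. -/
theorem norm_oscCoeff_le {θ : ℝ} {j : ℕ} {D : ℝ} (hD : 0 ≤ D)
    (h : ∀ n ∈ S.active j, freq m n = |θ| → 24 * freq m n / 2 ^ j ≤ D) : ‖S.oscCoeff θ j‖ ≤ D := by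
  have hvanish : ∀ n, freq m n ≠ |θ| → ((if freq m n = θ then dampingPhase (S.state j n) else 0) +
      (if -freq m n = θ then conj (dampingPhase (S.state j n)) else 0)) = 0 := by
    intro n hn
    rw [if_neg, if_neg, add_zero]
    · intro h'
      rw [← h', abs_neg, abs_of_pos (freq_pos m n)] at hn
      exact hn rfl
    · intro h'
      rw [← h', abs_of_pos (freq_pos m n)] at hn
      exact hn rfl
  by_cases hex : ∃ n ∈ S.active j, freq m n = |θ|
  · obtain ⟨n, hn, hnθ⟩ := hex
    rw [oscCoeff, Finset.sum_eq_single_of_mem n hn fun k hk hkn => by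
      rw [hvanish k fun h' => hkn (S.injOn j hk hn (h'.trans hnθ.symm)), mul_zero]]
    have hp := freq_pos m n
    have h1 : ‖(if freq m n = θ then dampingPhase (S.state j n) else 0)‖ ≤ 1 := by
      split_ifs
      · exact norm_dampingPhase_le _
      · simp
    have h2 : ‖(if -freq m n = θ then conj (dampingPhase (S.state j n)) else 0)‖ ≤ 1 := by
      split_ifs
      · rw [RCLike.norm_conj]
        exact norm_dampingPhase_le _
      · simp
    rw [norm_mul, Complex.norm_real, Real.norm_eq_abs, abs_of_nonneg (by positivity)]
    calc _ ≤ 12 * freq m n / 2 ^ j * (1 + 1) := by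
          gcongr
          exact (norm_add_le _ _).trans (add_le_add h1 h2)
      _ = 24 * freq m n / 2 ^ j := by ring
      _ ≤ D := h n hn hnθ
  · push Not at hex
    rw [oscCoeff, Finset.sum_eq_zero fun n hn => by rw [hvanish n (hex n hn), mul_zero], norm_zero]
    exact hD

theorem mean_le_one (j : ℕ) : blockConst * ((S.active j).card : ℝ) ^ 2 / (2 ^ j) ^ 2 ≤ 1 := by
  have h : 0 ≤ ∑ n ∈ S.active j, 24 * freq m n / 2 ^ j :=
    Finset.sum_nonneg fun n _ => by have := freq_pos m n; positivity
  linarith [S.small j]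

/-- Decay in `θ`, uniformly over all blocks: it holds by the choice of the schedule, which admits a
frequency only to those blocks where its amplitude is small enough. -/
theorem coeff_bound (θ : ℝ) (j : ℕ) : ‖S.oscCoeff θ j‖ + |S.meanCoeff θ j| ≤ Real.exp (-|θ|) := by
  by_cases h0 : 0 = θ
  · subst h0
    have h1 : ‖S.oscCoeff 0 j‖ ≤ 0 := S.norm_oscCoeff_le le_rfl fun n _ hn => by
      rw [abs_zero] at hn
      exact absurd hn (freq_pos m n).ne'
    have hb := blockConst_nonneg
    rw [meanCoeff, if_pos rfl, abs_of_nonneg (by positivity), abs_zero, neg_zero, Real.exp_zero]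
    linarith [S.mean_le_one j]
  · rw [meanCoeff, if_neg h0, abs_zero, add_zero]
    refine S.norm_oscCoeff_le (Real.exp_pos _).le fun n hn hnθ => (S.decay j n hn).trans ?_
    rw [Real.exp_le_exp, hnθ]
    have : (0 : ℝ) ≤ n := by positivity
    linarith

/-- Decay in `n`: the active index `k` of the frequency `θₙ` is its representative, so `n ≤ k`. -/
theorem coeff_bound_index {n : ℕ+} (hn : IndexCounts m n) {θ : ℝ} (hθ : |θ| = freq m n) (j : ℕ) :
    ‖S.oscCoeff θ j‖ + |S.meanCoeff θ j| ≤ Real.exp (-(n : ℝ)) := by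
  have h0 : 0 ≠ θ := by
    rintro rfl
    rw [abs_zero] at hθ
    exact (freq_pos m n).ne hθ
  rw [meanCoeff, if_neg h0, abs_zero, add_zero]
  refine S.norm_oscCoeff_le (Real.exp_pos _).le fun k hk hkθ => (S.decay j k hk).trans ?_
  rw [Real.exp_le_exp]
  have h1 : n ≤ k := (S.isRepresentative j k hk).le_of_indexCounts hn (hθ.symm.trans hkθ.symm)
  have h2 : (n : ℝ) ≤ k := by exact_mod_cast h1
  linarith [freq_pos m k]

theorem isLimitPeriodicCoefficient_potential : IsLimitPeriodicCoefficient m S.potential := by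
  -- A bound `exp (-t)` on the coefficients of all blocks is a bound by any power of `⟨t⟩⁻¹`.
  have key : ∀ k N : ℕ, ∃ C : ℝ, ∀ θ t : ℝ, 0 ≤ t →
      (∀ j, ‖S.oscCoeff θ j‖ + |S.meanCoeff θ j| ≤ Real.exp (-t)) → ∀ x,
      ‖iteratedDeriv k (S.coeff θ) x‖ ≤ C * (bracket x ^ k)⁻¹ * (bracket t ^ N)⁻¹ := by
    intro k N
    obtain ⟨C, hC0, hC⟩ := exists_symbol_bound k
    refine ⟨N.factorial * Real.exp 1 * C, fun θ t ht hj x => (hC _ _ _ hj x).trans ?_⟩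
    have hb : 0 ≤ (bracket x ^ k)⁻¹ := by have := bracket_pos x; positivity
    calc Real.exp (-t) * C * (bracket x ^ k)⁻¹
        ≤ (N.factorial * Real.exp 1 * (bracket t ^ N)⁻¹) * C * (bracket x ^ k)⁻¹ := by
          gcongr
          exact exp_neg_le_bracket N ht
      _ = _ := by ring
  refine ⟨S.contDiff_potential, S.coeff, fun θ _ => S.contDiff_coeff θ, S.hasSum_coeff,
    fun k N => ?_, fun k N => ?_⟩
  · obtain ⟨C, hC⟩ := key k N
    refine ⟨C, fun θ _ x => ?_⟩
    have := hC θ |θ| (abs_nonneg θ) (S.coeff_bound θ) x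
    rwa [bracket_abs] at this
  · obtain ⟨C, hC⟩ := key k N
    refine ⟨C, fun n hn x => ⟨hC _ _ (by positivity) (S.coeff_bound_index hn ?_) x,
      hC _ _ (by positivity) (S.coeff_bound_index hn ?_) x⟩⟩
    · exact abs_of_pos (freq_pos m n)
    · rw [abs_neg, abs_of_pos (freq_pos m n)]

end Schedule

/-! ### A Riccati lower bound for the potential -/

section Riccati

variable {ι : Type*}

/-- A function `r` with `r' + r² ≤ blockPotential θ F z h`: up to the derivative of the cutoff, it is
a primitive of the oscillating part of the block. -/
noncomputable def blockRiccati (θ : ι → ℝ) (F : Finset ι) (z : ι → ℂ) (h x : ℝ) : ℝ :=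
  24 / h * bump (x / h) * ∑ n ∈ F, (z n * Complex.exp ((θ n * x : ℝ) * Complex.I)).im

/-- The derivative of `blockRiccati`. -/
noncomputable def blockRiccatiDeriv (θ : ι → ℝ) (F : Finset ι) (z : ι → ℂ) (h x : ℝ) : ℝ :=
  24 / h * (deriv bump (x / h) / h) * ∑ n ∈ F, (z n * Complex.exp ((θ n * x : ℝ) * Complex.I)).im +
    ∑ n ∈ F, 24 * θ n / h * bump (x / h) * (z n * Complex.exp ((θ n * x : ℝ) * Complex.I)).re

theorem hasDerivAt_blockRiccati (θ : ι → ℝ) (F : Finset ι) (z : ι → ℂ) (h x : ℝ) :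
    HasDerivAt (blockRiccati θ F z h) (blockRiccatiDeriv θ F z h x) x := by
  have h1 : HasDerivAt (fun x => 24 / h * bump (x / h)) (24 / h * (deriv bump (x / h) / h)) x := by
    have hb : HasDerivAt bump (deriv bump (x / h)) (x / h) :=
      ((bump.contDiff (n := 1)).differentiable one_ne_zero _).hasDerivAt
    refine ((hb.comp x ((hasDerivAt_id x).div_const h)).const_mul (24 / h)).congr_deriv ?_
    ring
  have h2 : ∀ n ∈ F, HasDerivAt
      (fun x => (z n * Complex.exp ((θ n * x : ℝ) * Complex.I)).im)
      (θ n * (z n * Complex.exp ((θ n * x : ℝ) * Complex.I)).re) x := fun n _ => by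
    have he := (hasDerivAt_exp_mul_I (θ n) x).const_mul (z n)
    refine (Complex.imCLM.hasFDerivAt.comp_hasDerivAt x he).congr_deriv ?_
    simp only [Complex.imCLM_apply, Complex.mul_im, Complex.mul_re, Complex.ofReal_re,
      Complex.ofReal_im, Complex.I_re, Complex.I_im]
    ring
  refine (h1.mul (HasDerivAt.fun_sum h2)).congr_deriv ?_
  rw [blockRiccatiDeriv, Finset.mul_sum _ _ (24 / h * bump (x / h))]
  congr 1
  refine Finset.sum_congr rfl fun n _ => ?_
  ring

theorem abs_sum_im_le (θ : ι → ℝ) (F : Finset ι) {z : ι → ℂ} (hz : ∀ n, ‖z n‖ ≤ 1) (x : ℝ) :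
    |∑ n ∈ F, (z n * Complex.exp ((θ n * x : ℝ) * Complex.I)).im| ≤ F.card := by
  refine (Finset.abs_sum_le_sum_abs _ _).trans ?_
  rw [← nsmul_one, ← Finset.sum_const]
  refine Finset.sum_le_sum fun n _ => (Complex.abs_im_le_norm _).trans ?_
  rw [norm_mul, Complex.norm_exp_ofReal_mul_I, mul_one]
  exact hz n

theorem blockRiccati_le (θ : ι → ℝ) (F : Finset ι) {z : ι → ℂ} (hz : ∀ n, ‖z n‖ ≤ 1) {h : ℝ}
    (hh : 0 < h) (x : ℝ) :
    blockRiccatiDeriv θ F z h x + blockRiccati θ F z h x ^ 2 ≤ blockPotential θ F z h x := by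
  have hs := abs_sum_im_le θ F hz x
  rw [blockRiccatiDeriv, blockPotential, blockRiccati, add_assoc, add_comm, add_assoc]
  set s := ∑ n ∈ F, (z n * Complex.exp ((θ n * x : ℝ) * Complex.I)).im with hsdef
  gcongr
  set β := bump (x / h) with hβ
  set w := wideBump (x / h) with hw
  have hβ0 : 0 ≤ β := bump.nonneg
  have hβ1 : β ≤ 1 := bump.le_one
  have hβw : β ≤ w := bump_le_wideBump _
  have hd := abs_deriv_bump_le_wideBump (x / h)
  rw [← hw] at hd
  set d := deriv bump (x / h) with hddef
  have hM := bumpSlope_nonneg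
  have hw0 : 0 ≤ w := hβ0.trans hβw
  have hF : (F.card : ℝ) ≤ (F.card : ℝ) ^ 2 := by exact_mod_cast Nat.le_self_pow two_ne_zero _
  have hF0 : (0 : ℝ) ≤ F.card := by positivity
  have e1 : d * s ≤ bumpSlope * w * (F.card : ℝ) ^ 2 := by
    calc d * s ≤ |d| * |s| := by rw [← abs_mul]; exact le_abs_self _
      _ ≤ (bumpSlope * w) * (F.card : ℝ) ^ 2 := by gcongr; exact hs.trans hF
  have e2 : β ^ 2 * s ^ 2 ≤ w * (F.card : ℝ) ^ 2 := by
    have : s ^ 2 ≤ (F.card : ℝ) ^ 2 := by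
      rw [← sq_abs s]
      gcongr
    have : β ^ 2 ≤ w := by nlinarith
    gcongr
  have e3 : (24 / h * β * s) ^ 2 + 24 / h * (d / h) * s = (576 * (β ^ 2 * s ^ 2) + 24 * (d * s)) / h ^ 2 := by
    field_simp
    ring
  have e4 : blockConst * (F.card : ℝ) ^ 2 / h ^ 2 * w =
      (576 * (w * (F.card : ℝ) ^ 2) + 24 * (bumpSlope * w * (F.card : ℝ) ^ 2)) / h ^ 2 := by
    rw [blockConst]
    ring
  rw [e3, e4]
  gcongr

end Riccati

namespace Schedule

variable {m : ℕ+ → ℕ+} (S : Schedule m)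

/-- The odd extension of `blockRiccati` on the `j`-th block. -/
noncomputable def oddRiccati (j : ℕ) (x : ℝ) : ℝ :=
  blockRiccati (freq m) (S.active j) (fun n => dampingPhase (S.state j n)) (2 ^ j) x -
    blockRiccati (freq m) (S.active j) (fun n => dampingPhase (S.state j n)) (2 ^ j) (-x)

/-- `W ≥ q' + q²` with a bounded function `q`, which forces `-Δ + W ≥ 0`. -/
theorem exists_riccati : ∃ q q' : ℝ → ℝ, (∀ x, HasDerivAt q (q' x) x) ∧ (∃ B, ∀ x, |q x| ≤ B) ∧
    ∀ x, q' x + q x ^ 2 ≤ S.potential x := by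
  have hfam : IsBlockFamily S.oddRiccati := isBlockFamily_of_bumps fun j x h1 h2 _ _ => by
    simp [oddRiccati, blockRiccati, h1, h2]
  set r : ℕ → ℝ → ℝ := fun j => blockRiccati (freq m) (S.active j)
    (fun n => dampingPhase (S.state j n)) (2 ^ j) with hr
  set r' : ℕ → ℝ → ℝ := fun j => blockRiccatiDeriv (freq m) (S.active j)
    (fun n => dampingPhase (S.state j n)) (2 ^ j) with hr'
  have hder : ∀ j x, HasDerivAt (S.oddRiccati j) (r' j x + r' j (-x)) x := fun j x => by
    have h1 := hasDerivAt_blockRiccati (freq m) (S.active j)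
      (fun n => dampingPhase (S.state j n)) (2 ^ j) x
    have h2 := hasDerivAt_blockRiccati (freq m) (S.active j)
      (fun n => dampingPhase (S.state j n)) (2 ^ j) (-x)
    refine (h1.sub (h2.comp x (hasDerivAt_neg x))).congr_deriv ?_
    simp [hr']
  have hneg : ∀ j x, x ≤ 0 → r j x = 0 := fun j x hx => by
    have hd : x / 2 ^ j ≤ 0 := div_nonpos_of_nonpos_of_nonneg hx (by positivity)
    have h1 : bump (x / 2 ^ j) = 0 := by
      by_contra hne
      linarith [(bump_ne_zero hne).1]
    simp [hr, blockRiccati, h1]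
  have hprod : ∀ j x, r j x * r j (-x) = 0 := fun j x => by
    rcases le_total x 0 with h | h
    · rw [hneg j x h, zero_mul]
    · rw [hneg j (-x) (neg_nonpos.mpr h), mul_zero]
  have hbd : ∀ j x, |r j x| ≤ 24 := fun j x => by
    have h1 := abs_sum_im_le (freq m) (S.active j) (z := fun n => dampingPhase (S.state j n))
      (fun _ => norm_dampingPhase_le _) x
    have h2 : ((S.active j).card : ℝ) / 2 ^ j ≤ 1 := by
      have h3 := S.mean_le_one j
      have h4 : (1 : ℝ) ≤ blockConst := by
        rw [blockConst]
        linarith [bumpSlope_nonneg]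
      have h5 : (((S.active j).card : ℝ) / 2 ^ j) ^ 2 ≤ 1 := by
        refine le_trans ?_ h3
        rw [div_pow, mul_div_assoc]
        exact le_mul_of_one_le_left (by positivity) h4
      exact (sq_le_one_iff₀ (by positivity)).mp h5
    have hb1 : bump (x / 2 ^ j) ≤ 1 := bump.le_one
    have hb0 : 0 ≤ bump (x / 2 ^ j) := bump.nonneg
    rw [hr]
    simp only [blockRiccati]
    rw [abs_mul, abs_of_nonneg (by positivity)]
    calc _ ≤ 24 / 2 ^ j * 1 * ((S.active j).card : ℝ) := by gcongr
      _ = 24 * (((S.active j).card : ℝ) / 2 ^ j) := by ring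
      _ ≤ 24 := by linarith
  refine ⟨glue S.oddRiccati, fun x => r' (dyadic x) x + r' (dyadic x) (-x), fun x => ?_,
    ⟨48, fun x => ?_⟩, fun x => ?_⟩
  · exact (hder _ x).congr_of_eventuallyEq (hfam.glue_eventuallyEq x)
  · have := abs_sub (r (dyadic x) x) (r (dyadic x) (-x))
    exact this.trans (by linarith [hbd (dyadic x) x, hbd (dyadic x) (-x)])
  · have h1 := blockRiccati_le (freq m) (S.active (dyadic x))
      (z := fun n => dampingPhase (S.state (dyadic x) n)) (fun _ => norm_dampingPhase_le _)
      (h := 2 ^ dyadic x) (by positivity) x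
    have h2 := blockRiccati_le (freq m) (S.active (dyadic x))
      (z := fun n => dampingPhase (S.state (dyadic x) n)) (fun _ => norm_dampingPhase_le _)
      (h := 2 ^ dyadic x) (by positivity) (-x)
    have e : (glue S.oddRiccati x) ^ 2 = r (dyadic x) x ^ 2 + r (dyadic x) (-x) ^ 2 := by
      have := hprod (dyadic x) x
      change (r (dyadic x) x - r (dyadic x) (-x)) ^ 2 = _
      linear_combination -2 * this
    rw [e]
    change _ ≤ blockPotential _ _ _ _ _ + blockPotential _ _ _ _ _
    simp only [hr, hr']
    linarith

end Schedule

/-! ### Multiplication operators and Bessel potentials on `L²(ℝ)` -/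

theorem memLp_top_of_norm_le_one {g : ℝ → ℂ} (hc : Continuous g) (hg : ∀ x, ‖g x‖ ≤ 1) :
    MemLp g ⊤ (volume : Measure ℝ) :=
  memLp_top_of_bound hc.aestronglyMeasurable 1 (Eventually.of_forall hg)

theorem norm_toLp_top_le_one {g : ℝ → ℂ} (hc : Continuous g) (hg : ∀ x, ‖g x‖ ≤ 1) :
    ‖(memLp_top_of_norm_le_one hc hg).toLp g‖ ≤ 1 := by
  rw [Lp.norm_toLp, eLpNorm_exponent_top]
  refine ENNReal.toReal_le_of_le_ofReal zero_le_one ?_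
  exact eLpNormEssSup_le_of_ae_bound (Eventually.of_forall hg)

/-- Multiplication by a bounded function as an operator on `L²(ℝ)`. -/
noncomputable def mulCLM (g : Lp ℂ ⊤ (volume : Measure ℝ)) : L2 →L[ℂ] L2 :=
  LinearMap.mkContinuous
    { toFun := fun f => g • f
      map_add' := fun f₁ f₂ => Lp.add_smul g f₁ f₂
      map_smul' := fun c f => (Lp.smul_comm c g f).symm }
    ‖g‖ fun f => Lp.norm_smul_le g f

theorem mulCLM_apply (g : Lp ℂ ⊤ (volume : Measure ℝ)) (f : L2) : mulCLM g f = g • f := rfl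

theorem norm_mulCLM_le (g : Lp ℂ ⊤ (volume : Measure ℝ)) : ‖mulCLM g‖ ≤ ‖g‖ :=
  LinearMap.mkContinuous_norm_le _ (norm_nonneg _) _

open FourierTransform TemperedDistribution in
/-- The Bessel potential of order `-2` maps `L²(ℝ)` to itself, being conjugate under the Fourier
transform to a multiplication by a function bounded by `1`. -/
theorem exists_besselPotential_neg_two : ∃ R : L2 →L[ℂ] L2, ‖R‖ ≤ 1 ∧
    ∀ f : L2, ((R f : L2) : 𝓢'(ℝ, ℂ)) = besselPotential ℝ ℂ (-2) (f : 𝓢'(ℝ, ℂ)) := by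
  set g : ℝ → ℂ := fun x => (((1 + ‖x‖ ^ 2) ^ ((-2 : ℝ) / 2) : ℝ) : ℂ) with hg
  have htg : g.HasTemperateGrowth := by fun_prop
  have hc : Continuous g := htg.1.continuous
  have hb : ∀ x, ‖g x‖ ≤ 1 := fun x => by
    rw [hg, Complex.norm_real, Real.norm_eq_abs, abs_of_nonneg (by positivity)]
    exact Real.rpow_le_one_of_one_le_of_nonpos (by nlinarith [sq_nonneg ‖x‖]) (by norm_num)
  set G := (memLp_top_of_norm_le_one hc hb).toLp g with hG
  have hGn : ‖G‖ ≤ 1 := norm_toLp_top_le_one hc hb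
  set e := (Lp.fourierTransformₗᵢ ℝ ℂ) with he
  refine ⟨(e.symm.toContinuousLinearEquiv : L2 →L[ℂ] L2) ∘L mulCLM G ∘L
    (e.toContinuousLinearEquiv : L2 →L[ℂ] L2), ?_, fun f => ?_⟩
  · refine ContinuousLinearMap.opNorm_le_bound _ zero_le_one fun f => ?_
    change ‖e.symm (mulCLM G (e f))‖ ≤ _
    rw [LinearIsometryEquiv.norm_map]
    refine ((mulCLM G).le_opNorm _).trans ?_
    rw [LinearIsometryEquiv.norm_map]
    gcongr
    exact (norm_mulCLM_le G).trans hGn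
  · change ((𝓕⁻ (mulCLM G (𝓕 f)) : L2) : 𝓢'(ℝ, ℂ)) = _
    rw [← Lp.fourierInv_toTemperedDistribution_eq, mulCLM_apply, hG,
      Lp.toTemperedDistribution_smul_eq htg, ← Lp.fourier_toTemperedDistribution_eq,
      besselPotential, TemperedDistribution.fourierMultiplierCLM_apply]

/-- The resolvent `(1 - (2π)⁻² Δ)⁻¹` of the Laplacian, as an operator on `L²(ℝ)`. -/
noncomputable def freeResolvent : L2 →L[ℂ] L2 := exists_besselPotential_neg_two.choose

theorem norm_freeResolvent_le : ‖freeResolvent‖ ≤ 1 :=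
  exists_besselPotential_neg_two.choose_spec.1

open TemperedDistribution in
theorem freeResolvent_eq (f : L2) :
    ((freeResolvent f : L2) : 𝓢'(ℝ, ℂ)) = besselPotential ℝ ℂ (-2) (f : 𝓢'(ℝ, ℂ)) :=
  exists_besselPotential_neg_two.choose_spec.2 f

open FourierTransform TemperedDistribution in
theorem besselPotential_two (f : 𝓢'(ℝ, ℂ)) :
    ((2 * Real.pi) ^ 2 : ℝ) • besselPotential ℝ ℂ 2 f = ((2 * Real.pi) ^ 2 : ℝ) • f - Δ f := by
  have h1 : (fun x : ℝ => (((1 + ‖x‖ ^ 2) ^ ((2 : ℝ) / 2) : ℝ) : ℂ)) =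
      (fun _ => (1 : ℂ)) + (fun x : ℝ => Complex.ofReal (‖x‖ ^ 2)) := by
    funext x
    simp
  have h2 : besselPotential ℝ ℂ 2 f =
      f + TemperedDistribution.fourierMultiplierCLM ℂ (fun x : ℝ => Complex.ofReal (‖x‖ ^ 2)) f := by
    rw [besselPotential, h1, TemperedDistribution.fourierMultiplierCLM_apply,
      TemperedDistribution.smulLeftCLM_add (by fun_prop) (by fun_prop),
      TemperedDistribution.fourierMultiplierCLM_apply]
    simp
  rw [h2, TemperedDistribution.laplacian_eq_fourierMultiplierCLM, smul_add, neg_smul, sub_neg_eq_add]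

open TemperedDistribution in
theorem memSobolev_freeResolvent (f : L2) :
    MemSobolev 2 2 ((freeResolvent f : L2) : 𝓢'(ℝ, ℂ)) :=
  ⟨f, by rw [freeResolvent_eq]; simp⟩

open TemperedDistribution in
theorem exists_freeResolvent_of_memSobolev {u : L2} (hu : MemSobolev 2 2 (u : 𝓢'(ℝ, ℂ))) :
    ∃ f, freeResolvent f = u := by
  obtain ⟨f, hf⟩ := hu
  refine ⟨f, toTempered_injective ?_⟩
  rw [freeResolvent_eq, ← hf]
  simp

theorem toTempered_sub (u v : L2) :
    ((u - v : L2) : 𝓢'(ℝ, ℂ)) = (u : 𝓢'(ℝ, ℂ)) - (v : 𝓢'(ℝ, ℂ)) := by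
  simp only [← MeasureTheory.Lp.toTemperedDistributionCLM_apply, map_sub]

theorem toTempered_real_smul (r : ℝ) (u : L2) :
    (((r : ℂ) • u : L2) : 𝓢'(ℝ, ℂ)) = r • (u : 𝓢'(ℝ, ℂ)) := by
  rw [← MeasureTheory.Lp.toTemperedDistributionCLM_apply, map_smul, Complex.coe_smul]
  rfl

/-- The constant `μ = (2π)²`, for which `(μ - Δ)⁻¹` is `μ⁻¹` times a Bessel potential. -/
noncomputable def besselConst : ℝ := (2 * Real.pi) ^ 2

theorem one_lt_besselConst : 1 < besselConst := by
  have := Real.pi_gt_three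
  unfold besselConst
  nlinarith

theorem laplacian_freeResolvent (f : L2) : Δ ((freeResolvent f : L2) : 𝓢'(ℝ, ℂ)) =
    (((besselConst : ℂ) • (freeResolvent f - f) : L2) : 𝓢'(ℝ, ℂ)) := by
  have h := besselPotential_two ((freeResolvent f : L2) : 𝓢'(ℝ, ℂ))
  have h2 : TemperedDistribution.besselPotential ℝ ℂ 2 ((freeResolvent f : L2) : 𝓢'(ℝ, ℂ)) = f := by
    rw [freeResolvent_eq]
    simp
  rw [h2] at h
  rw [toTempered_real_smul, toTempered_sub, smul_sub, besselConst, h]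
  abel

open TemperedDistribution in
/-- A square integrable function with square integrable second derivative is in `H²(ℝ)`. -/
theorem memSobolev_two_of_laplacian {u v : L2} (h : Δ (u : 𝓢'(ℝ, ℂ)) = (v : 𝓢'(ℝ, ℂ))) :
    MemSobolev 2 2 (u : 𝓢'(ℝ, ℂ)) := by
  have hμ : besselConst ≠ 0 := by linarith [one_lt_besselConst]
  refine ⟨((besselConst⁻¹ : ℝ) : ℂ) • ((besselConst : ℂ) • u - v), ?_⟩
  rw [toTempered_real_smul, toTempered_sub, toTempered_real_smul, ← h, besselConst,
    ← besselPotential_two, ← besselConst, inv_smul_smul₀ hμ]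

/-! ### Decaying classical solutions are eigenfunctions -/

theorem laplacian_apply_real (φ : 𝓢(ℝ, ℂ)) (x : ℝ) : (Δ φ) x = deriv (deriv φ) x := by
  rw [SchwartzMap.laplacian_apply, InnerProductSpace.laplacian_eq_iteratedDeriv_real,
    iteratedDeriv_succ, iteratedDeriv_one]

theorem hasDerivAt_schwartz (φ : 𝓢(ℝ, ℂ)) (x : ℝ) : HasDerivAt φ (deriv φ x) x :=
  φ.differentiableAt.hasDerivAt

theorem hasDerivAt_deriv_schwartz (φ : 𝓢(ℝ, ℂ)) (x : ℝ) : HasDerivAt (deriv φ) ((Δ φ) x) x := by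
  rw [laplacian_apply_real]
  have h : (deriv φ) = SchwartzMap.derivCLM ℝ ℂ φ := by
    funext y
    rw [SchwartzMap.derivCLM_apply]
  rw [h]
  exact (SchwartzMap.derivCLM ℝ ℂ φ).differentiableAt.hasDerivAt

theorem tendsto_schwartz (φ : 𝓢(ℝ, ℂ)) :
    Tendsto φ atBot (𝓝 0) ∧ Tendsto φ atTop (𝓝 0) := by
  have h := φ.tendsto_cocompact
  rw [cocompact_eq_atBot_atTop] at h
  exact tendsto_sup.mp h

theorem coe_derivCLM (φ : 𝓢(ℝ, ℂ)) : ((SchwartzMap.derivCLM ℝ ℂ φ : 𝓢(ℝ, ℂ)) : ℝ → ℂ) = deriv φ := by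
  funext y
  rw [SchwartzMap.derivCLM_apply]

theorem memLp_two_of_decay {f : ℝ → ℂ} (hf : Continuous f) {C : ℝ}
    (hC : ∀ x, ‖f x‖ ≤ C / (1 + x ^ 2)) : MemLp f 2 (volume : Measure ℝ) := by
  rw [memLp_two_iff_integrable_sq_norm hf.aestronglyMeasurable]
  refine (integrable_inv_one_add_sq.const_mul (C ^ 2)).mono'
    (hf.norm.pow 2).aestronglyMeasurable (Eventually.of_forall fun x => ?_)
  rw [Real.norm_eq_abs, abs_of_nonneg (by positivity)]
  have h1 : (1 : ℝ) ≤ 1 + x ^ 2 := by nlinarith [sq_nonneg x]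
  calc ‖f x‖ ^ 2 ≤ (C / (1 + x ^ 2)) ^ 2 := by gcongr; exact hC x
    _ = C ^ 2 * ((1 + x ^ 2)⁻¹ * (1 + x ^ 2)⁻¹) := by field_simp
    _ ≤ C ^ 2 * ((1 + x ^ 2)⁻¹ * 1) := by gcongr; exact inv_le_one_of_one_le₀ h1
    _ = _ := by ring

theorem decay_le {C x : ℝ} (hC : 0 ≤ C) : C / (1 + x ^ 2) ≤ C :=
  div_le_self hC (by nlinarith [sq_nonneg x])

/-- A classical solution that decays together with its derivative satisfies the eigenvalue equation
in the sense of distributions, hence lies in `H²(ℝ)`; it is nonzero because `u'(0) ≠ 0`. -/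
theorem mem_pointSpectrum_of_solution {W : ℝ → ℝ} (hW : Continuous W) (hW1 : ∀ x, |W x| ≤ 1) {E : ℝ}
    {u v : ℝ → ℝ} (hu : ∀ x, HasDerivAt u (v x) x)
    (hv : ∀ x, HasDerivAt v ((W x - E) * u x) x)
    (hC : ∃ C, ∀ x, |u x| ≤ C / (1 + x ^ 2) ∧ |v x| ≤ C / (1 + x ^ 2)) (hv0 : v 0 ≠ 0) :
    (E : ℂ) ∈ pointSpectrum (schrodinger W) := by
  obtain ⟨C, hC⟩ := hC
  have hC0 : 0 ≤ C := by simpa using (abs_nonneg _).trans (hC 0).1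
  have huc : Continuous u := continuous_iff_continuousAt.mpr fun x => (hu x).continuousAt
  have hvc : Continuous v := continuous_iff_continuousAt.mpr fun x => (hv x).continuousAt
  have hf : Continuous fun x => (u x : ℂ) := by fun_prop
  have hf2 : Continuous fun x => (((W x - E) * u x : ℝ) : ℂ) := by fun_prop
  have hf3 : Continuous fun x => ((W x : ℂ) * (u x : ℂ)) := by fun_prop
  have hm : MemLp (fun x => (u x : ℂ)) 2 (volume : Measure ℝ) := memLp_two_of_decay hf (C := C)
    fun x => by rw [Complex.norm_real]; exact (hC x).1
  have hm2 : MemLp (fun x => (((W x - E) * u x : ℝ) : ℂ)) 2 (volume : Measure ℝ) :=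
    memLp_two_of_decay hf2 (C := (1 + |E|) * C) fun x => by
      rw [Complex.norm_real, Real.norm_eq_abs, abs_mul, mul_div_assoc]
      have : |W x - E| ≤ 1 + |E| := (abs_sub _ _).trans (by linarith [hW1 x])
      gcongr
      exact (hC x).1
  have hm3 : MemLp (fun x => ((W x : ℂ) * (u x : ℂ))) 2 (volume : Measure ℝ) :=
    memLp_two_of_decay hf3 (C := C) fun x => by
      rw [norm_mul, Complex.norm_real, Complex.norm_real, Real.norm_eq_abs]
      calc _ ≤ 1 * (C / (1 + x ^ 2)) := by gcongr; exacts [hW1 x, (hC x).1]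
        _ = _ := one_mul _
  set U : L2 := hm.toLp _ with hU
  set V : L2 := hm2.toLp _ with hV
  have hlap : Δ (U : 𝓢'(ℝ, ℂ)) = (V : 𝓢'(ℝ, ℂ)) := by
    ext φ
    rw [TemperedDistribution.laplacian_apply_apply, Lp.toTemperedDistribution_apply,
      Lp.toTemperedDistribution_apply]
    have e1 : ∫ x, (Δ φ) x • U x = ∫ x, (Δ φ) x * (u x : ℂ) :=
      integral_congr_ae (by filter_upwards [hm.coeFn_toLp] with x hx; rw [hU, hx, smul_eq_mul])
    have e2 : ∫ x, φ x • V x = ∫ x, φ x * (((W x - E) * u x : ℝ) : ℂ) :=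
      integral_congr_ae (by filter_upwards [hm2.coeFn_toLp] with x hx; rw [hV, hx, smul_eq_mul])
    have hbd : ∀ (ψ : 𝓢(ℝ, ℂ)) (r : ℝ → ℝ), (∃ B, ∀ x, |r x| ≤ B) →
        Tendsto (fun x => ψ x * (r x : ℂ)) atBot (𝓝 0) ∧
        Tendsto (fun x => ψ x * (r x : ℂ)) atTop (𝓝 0) := by
      rintro ψ r ⟨B, hB⟩
      have hr : ∀ l : Filter ℝ, IsBoundedUnder (· ≤ ·) l (norm ∘ fun x => (r x : ℂ)) := fun l =>
        isBoundedUnder_of ⟨B, fun x => by simpa using hB x⟩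
      exact ⟨(tendsto_schwartz ψ).1.zero_mul_isBoundedUnder_le (hr _),
        (tendsto_schwartz ψ).2.zero_mul_isBoundedUnder_le (hr _)⟩
    have hub : ∃ B, ∀ x, |u x| ≤ B := ⟨C, fun x => (hC x).1.trans (decay_le hC0)⟩
    have hvb : ∃ B, ∀ x, |v x| ≤ B := ⟨C, fun x => (hC x).2.trans (decay_le hC0)⟩
    have hint : ∀ (ψ : 𝓢(ℝ, ℂ)) (r : ℝ → ℂ), Continuous r → (∃ B, ∀ x, ‖r x‖ ≤ B) →
        Integrable (fun x => ψ x * r x) := by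
      rintro ψ r hr ⟨B, hB⟩
      exact ψ.integrable.mul_bdd (c := B) hr.aestronglyMeasurable (Eventually.of_forall hB)
    have hi1 : Integrable fun x => (Δ φ) x * (u x : ℂ) :=
      hint _ _ hf ⟨C, fun x => by rw [Complex.norm_real]; exact (hC x).1.trans (decay_le hC0)⟩
    have hi2 : Integrable fun x => φ x * (((W x - E) * u x : ℝ) : ℂ) :=
      hint _ _ hf2 ⟨(1 + |E|) * C, fun x => by
        rw [Complex.norm_real, Real.norm_eq_abs, abs_mul]
        have : |W x - E| ≤ 1 + |E| := (abs_sub _ _).trans (by linarith [hW1 x])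
        gcongr
        exact (hC x).1.trans (decay_le hC0)⟩
    have hder : ∀ x, HasDerivAt (fun x => deriv φ x * (u x : ℂ) - φ x * (v x : ℂ))
        ((Δ φ) x * (u x : ℂ) - φ x * (((W x - E) * u x : ℝ) : ℂ)) x := fun x => by
      refine (((hasDerivAt_deriv_schwartz φ x).mul (hu x).ofReal_comp).sub
        ((hasDerivAt_schwartz φ x).mul (hv x).ofReal_comp)).congr_deriv ?_
      ring
    have h1 := hbd (SchwartzMap.derivCLM ℝ ℂ φ) u hub
    rw [coe_derivCLM] at h1
    have h2 := hbd φ v hvb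
    -- Green's identity: `φ'' u - φ u''` is the derivative of `φ' u - φ u'`.
    have hzero := integral_of_hasDerivAt_of_tendsto hder (hi1.sub hi2) (h1.1.sub h2.1)
      (h1.2.sub h2.2)
    rw [integral_sub hi1 hi2] at hzero
    simp only [sub_self, sub_eq_zero] at hzero
    rw [e1, e2, hzero]
  have hdom : U ∈ (schrodinger W).domain := by
    refine ⟨memSobolev_two_of_laplacian hlap, (memLp_congr_ae ?_).mpr hm3⟩
    filter_upwards [hm.coeFn_toLp] with x hx
    rw [hU, hx]
  refine ⟨⟨U, hdom⟩, fun h0 => ?_, ?_⟩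
  · have hU0 : U = 0 := congrArg Subtype.val h0
    have hae : (fun x => (u x : ℂ)) =ᵐ[volume] fun _ => 0 := by
      have h1 := hm.coeFn_toLp
      have h2 := Lp.coeFn_zero ℂ 2 (volume : Measure ℝ)
      rw [← hU, hU0] at h1
      filter_upwards [h1, h2] with x hx1 hx2
      rw [← hx1, hx2]
      rfl
    have hz := (Continuous.ae_eq_iff_eq volume hf continuous_const).mp hae
    have hz' : u = fun _ => 0 := by
      funext x
      exact_mod_cast congrFun hz x
    have := (hu 0).unique (by rw [hz']; exact hasDerivAt_const 0 0)
    exact hv0 this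
  · have hsec : secondDeriv (⟨U, hdom⟩ : schrodingerDomain W) = V :=
      toTempered_injective (by rw [← secondDeriv_spec, ← hlap])
    change -secondDeriv (⟨U, hdom⟩ : schrodingerDomain W) +
      potentialMul (⟨U, hdom⟩ : schrodingerDomain W) = (E : ℂ) • U
    rw [hsec]
    apply Lp.ext
    have hpot := MemLp.coeFn_toLp (⟨U, hdom⟩ : schrodingerDomain W).2.2
    filter_upwards [Lp.coeFn_add (-V) (potentialMul (⟨U, hdom⟩ : schrodingerDomain W)),
      Lp.coeFn_neg V, hm2.coeFn_toLp, hm.coeFn_toLp, hpot, Lp.coeFn_smul (E : ℂ) U]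
      with x h1 h2 h3 h4 h5 h6
    rw [h1, Pi.add_apply, h2, Pi.neg_apply, hV, h3, h6, Pi.smul_apply, smul_eq_mul, potentialMul, h5,
      hU, h4]
    push_cast
    ring

/-! ### Positivity of the quadratic form -/

/-- A function that dominates the derivative of a function vanishing at infinity has nonnegative
integral, whether or not that derivative is integrable. -/
theorem integral_nonneg_of_hasDerivAt_le {f f' φ : ℝ → ℝ} (hf : ∀ x, HasDerivAt f (f' x) x)
    (hφ : Integrable φ) (hle : ∀ x, f' x ≤ φ x) (hbot : Tendsto f atBot (𝓝 0))
    (htop : Tendsto f atTop (𝓝 0)) : 0 ≤ ∫ x, φ x := by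
  have h1 : Tendsto (fun r : ℝ => ∫ x in (-r)..r, φ x) atTop (𝓝 (∫ x, φ x)) :=
    intervalIntegral_tendsto_integral hφ tendsto_neg_atTop_atBot tendsto_id
  have h2 : Tendsto (fun r : ℝ => f r - f (-r)) atTop (𝓝 (0 - 0)) :=
    htop.sub (hbot.comp tendsto_neg_atTop_atBot)
  rw [sub_zero] at h2
  refine le_of_tendsto_of_tendsto h2 h1 ?_
  filter_upwards [eventually_ge_atTop 0] with r hr
  exact intervalIntegral.sub_le_integral_of_hasDeriv_right_of_le (by linarith)
    (fun x _ => (hf x).continuousAt.continuousWithinAt)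
    (fun x _ => (hf x).hasDerivWithinAt) hφ.integrableOn fun x _ => hle x

theorem integrable_mul_schwartz (φ : 𝓢(ℝ, ℂ)) {g : ℝ → ℂ} (hg : Continuous g) {B : ℝ}
    (hB : ∀ x, ‖g x‖ ≤ B) : Integrable fun x => φ x * g x :=
  φ.integrable.mul_bdd (c := B) hg.aestronglyMeasurable (Eventually.of_forall hB)

theorem exists_schwartz_bound (φ : 𝓢(ℝ, ℂ)) : ∃ B, ∀ x, ‖φ x‖ ≤ B :=
  ⟨_, fun x => SchwartzMap.norm_le_seminorm ℝ φ x⟩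

theorem integrable_conj_mul_schwartz (φ ψ : 𝓢(ℝ, ℂ)) {g : ℝ → ℝ} (hg : Continuous g) {B : ℝ}
    (hB : ∀ x, |g x| ≤ B) : Integrable fun x => (g x : ℂ) * (ψ x * conj (φ x)) := by
  obtain ⟨A, hA⟩ := exists_schwartz_bound φ
  have h := integrable_mul_schwartz ψ (g := fun x => (g x : ℂ) * conj (φ x))
    ((Complex.continuous_ofReal.comp hg).mul (Complex.continuous_conj.comp φ.continuous))
    (B := B * A) fun x => by
      rw [norm_mul, Complex.norm_real, RCLike.norm_conj]
      have := (norm_nonneg _).trans (hA x)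
      have := (abs_nonneg _).trans (hB x)
      gcongr
      · exact hB x
      · exact hA x
  refine h.congr (Eventually.of_forall fun x => ?_)
  ring

theorem mul_conj_eq_norm_sq (z : ℂ) : z * conj z = ((‖z‖ ^ 2 : ℝ) : ℂ) := by
  rw [Complex.mul_conj, Complex.normSq_eq_norm_sq]

theorem integrable_mul_norm_sq_schwartz (φ : 𝓢(ℝ, ℂ)) {g : ℝ → ℝ} (hg : Continuous g) {B : ℝ}
    (hB : ∀ x, |g x| ≤ B) : Integrable fun x => g x * ‖φ x‖ ^ 2 := by
  refine (integrable_conj_mul_schwartz φ φ hg hB).re.congr (Eventually.of_forall fun x => ?_)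
  simp only [mul_conj_eq_norm_sq]
  rw [← Complex.ofReal_mul]
  rfl

theorem integrable_energy (φ : 𝓢(ℝ, ℂ)) {W : ℝ → ℝ} (hW : Continuous W) (hW1 : ∀ x, |W x| ≤ 1) :
    Integrable fun x => ‖deriv φ x‖ ^ 2 + W x * ‖φ x‖ ^ 2 := by
  refine Integrable.add ?_ (integrable_mul_norm_sq_schwartz φ hW hW1)
  have := integrable_mul_norm_sq_schwartz (SchwartzMap.derivCLM ℝ ℂ φ) (g := fun _ => 1)
    continuous_const (B := 1) (by simp)
  simpa [coe_derivCLM] using this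

/-- The energy is nonnegative if `W ≥ q' + q²`: the integrand minus `(q |φ|²)'` is at least
`(|φ'| - |q| |φ|)²`. -/
theorem energy_nonneg (φ : 𝓢(ℝ, ℂ)) {W q q' : ℝ → ℝ} (hW : Continuous W) (hW1 : ∀ x, |W x| ≤ 1)
    (hq : ∀ x, HasDerivAt q (q' x) x) (hqb : ∃ B, ∀ x, |q x| ≤ B)
    (hqW : ∀ x, q' x + q x ^ 2 ≤ W x) : 0 ≤ ∫ x, ‖deriv φ x‖ ^ 2 + W x * ‖φ x‖ ^ 2 := by
  obtain ⟨B, hB⟩ := hqb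
  have hr : ∀ l : Filter ℝ, IsBoundedUnder (· ≤ ·) l (norm ∘ q) := fun l =>
    isBoundedUnder_of ⟨B, fun x => by simpa using hB x⟩
  have hz : ∀ l : Filter ℝ, Tendsto φ l (𝓝 0) → Tendsto (fun x => q x * ‖φ x‖ ^ 2) l (𝓝 0) :=
    fun l hl => by
      have h2 : Tendsto (fun x => ‖φ x‖ ^ 2) l (𝓝 0) := by
        simpa using (hl.norm.pow 2)
      exact isBoundedUnder_le_mul_tendsto_zero (hr l) h2
  refine integral_nonneg_of_hasDerivAt_le
    (fun x => (hq x).mul ((hasDerivAt_schwartz φ x).norm_sq)) (integrable_energy φ hW hW1)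
    (fun x => ?_) (hz _ (tendsto_schwartz φ).1) (hz _ (tendsto_schwartz φ).2)
  have h1 : |inner ℝ (φ x) (deriv φ x)| ≤ ‖φ x‖ * ‖deriv φ x‖ := abs_real_inner_le_norm _ _
  have h2 : q x * (2 * inner ℝ (φ x) (deriv φ x)) ≤ 2 * (|q x| * ‖φ x‖) * ‖deriv φ x‖ := by
    calc _ ≤ |q x * (2 * inner ℝ (φ x) (deriv φ x))| := le_abs_self _
      _ = 2 * |q x| * |inner ℝ (φ x) (deriv φ x)| := by
          rw [abs_mul, abs_mul, abs_two]
          ring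
      _ ≤ 2 * |q x| * (‖φ x‖ * ‖deriv φ x‖) := by gcongr
      _ = _ := by ring
  have h3 : (q' x + q x ^ 2) * ‖φ x‖ ^ 2 ≤ W x * ‖φ x‖ ^ 2 := by
    gcongr
    exact hqW x
  have h4 : (|q x| * ‖φ x‖) ^ 2 = q x ^ 2 * ‖φ x‖ ^ 2 := by
    rw [mul_pow, sq_abs]
  nlinarith [sq_nonneg (‖deriv φ x‖ - |q x| * ‖φ x‖)]

/-- Multiplication by a continuous function bounded by `1`. -/
noncomputable def potentialCLM {W : ℝ → ℝ} (hW : Continuous W) (hW1 : ∀ x, |W x| ≤ 1) :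
    L2 →L[ℂ] L2 :=
  mulCLM ((memLp_top_of_norm_le_one (g := fun x => (W x : ℂ)) (by fun_prop)
    fun x => by simpa using hW1 x).toLp _)

section Potential

variable {W : ℝ → ℝ} (hW : Continuous W) (hW1 : ∀ x, |W x| ≤ 1)

theorem norm_potentialCLM_le : ‖potentialCLM hW hW1‖ ≤ 1 :=
  (norm_mulCLM_le _).trans (norm_toLp_top_le_one (by fun_prop) fun x => by simpa using hW1 x)

theorem coeFn_potentialCLM (f : L2) :
    (potentialCLM hW hW1 f : ℝ → ℂ) =ᵐ[volume] fun x => (W x : ℂ) * f x := by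
  have hm := memLp_top_of_norm_le_one (g := fun x => (W x : ℂ)) (by fun_prop)
    fun x => by simpa using hW1 x
  filter_upwards [Lp.coeFn_lpSMul (r := 2) (hm.toLp _) f, hm.coeFn_toLp] with x h1 h2
  change (hm.toLp _ • f : L2) x = _
  rw [h1, Pi.smul_apply', h2, smul_eq_mul]

/-- The quadratic form of `-Δ + W` on Schwartz functions, after integration by parts. -/
theorem inner_schwartz (φ : 𝓢(ℝ, ℂ)) :
    inner ℂ (φ.toLp 2 : L2) (-((Δ φ).toLp 2 : L2) + potentialCLM hW hW1 (φ.toLp 2)) =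
      ((∫ x, ‖deriv φ x‖ ^ 2 + W x * ‖φ x‖ ^ 2 : ℝ) : ℂ) := by
  set ψ := SchwartzMap.derivCLM ℝ ℂ φ with hψ
  have hcoe : (ψ : ℝ → ℂ) = deriv φ := coe_derivCLM φ
  have hψ' : ∀ x, HasDerivAt ψ ((Δ φ) x) x := fun x => by
    rw [hcoe]
    exact hasDerivAt_deriv_schwartz φ x
  have hφ' : ∀ x, HasDerivAt φ (ψ x) x := fun x => by
    rw [hcoe]
    exact hasDerivAt_schwartz φ x
  have hder : ∀ x, HasDerivAt (fun x => ψ x * conj (φ x))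
      ((Δ φ) x * conj (φ x) + ψ x * conj (ψ x)) x := fun x =>
    (hψ' x).mul (Complex.conjCLE.toContinuousLinearMap.hasFDerivAt.comp_hasDerivAt x (hφ' x))
  have hint : ∀ χ η : 𝓢(ℝ, ℂ), Integrable fun x => χ x * conj (η x) := fun χ η => by
    simpa using integrable_conj_mul_schwartz η χ (g := fun _ => 1) continuous_const (B := 1)
      (by simp)
  have hbd : ∀ l : Filter ℝ, IsBoundedUnder (· ≤ ·) l (norm ∘ fun x => conj (φ x)) := fun l => by
    obtain ⟨B, hB⟩ := exists_schwartz_bound φ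
    exact isBoundedUnder_of ⟨B, fun x => by simpa using hB x⟩
  have hzero := integral_of_hasDerivAt_of_tendsto hder ((hint _ _).add (hint _ _))
    ((tendsto_schwartz ψ).1.zero_mul_isBoundedUnder_le (hbd _))
    ((tendsto_schwartz ψ).2.zero_mul_isBoundedUnder_le (hbd _))
  rw [sub_self] at hzero
  have hen : Integrable fun x => ((‖deriv φ x‖ ^ 2 + W x * ‖φ x‖ ^ 2 : ℝ) : ℂ) :=
    (integrable_energy φ hW hW1).ofReal
  rw [MeasureTheory.L2.inner_def, ← integral_complex_ofReal,
    ← sub_zero (∫ x, ((‖deriv φ x‖ ^ 2 + W x * ‖φ x‖ ^ 2 : ℝ) : ℂ)), ← hzero]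
  change _ = _ - ∫ x, ((fun x => (Δ φ) x * conj (φ x)) + fun x => ψ x * conj (ψ x)) x
  rw [← integral_sub hen ((hint (Δ φ) φ).add (hint ψ ψ))]
  refine integral_congr_ae ?_
  filter_upwards [Lp.coeFn_add (-((Δ φ).toLp 2 : L2)) (potentialCLM hW hW1 (φ.toLp 2)),
    Lp.coeFn_neg ((Δ φ).toLp 2 : L2), (Δ φ).coeFn_toLp 2, φ.coeFn_toLp 2,
    coeFn_potentialCLM hW hW1 (φ.toLp 2)] with x h1 h2 h3 h4 h5
  rw [h1, Pi.add_apply, h2, Pi.neg_apply, h3, h5, h4, RCLike.inner_apply, ← hcoe, Pi.add_apply]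
  push_cast
  have e1 := mul_conj_eq_norm_sq (ψ x)
  have e2 := mul_conj_eq_norm_sq (φ x)
  push_cast at e1 e2
  rw [← e1, ← e2]
  ring

end Potential

/-! ### The spectrum -/

open TemperedDistribution in
/-- The free resolvent maps Schwartz functions to Schwartz functions. -/
theorem exists_schwartz_freeResolvent (g : 𝓢(ℝ, ℂ)) :
    ∃ φ : 𝓢(ℝ, ℂ), freeResolvent (g.toLp 2) = (φ.toLp 2 : L2) ∧
      ((Δ φ).toLp 2 : L2) = (besselConst : ℂ) • ((φ.toLp 2 : L2) - (g.toLp 2 : L2)) := by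
  set φ := SchwartzMap.fourierMultiplierCLM ℂ
    (fun x : ℝ ↦ (((1 + ‖x‖ ^ 2) ^ ((-2 : ℝ) / 2) : ℝ) : ℂ)) g with hφ
  have h1 : freeResolvent (g.toLp 2) = (φ.toLp 2 : L2) := by
    apply toTempered_injective
    rw [freeResolvent_eq, besselPotential, Lp.toTemperedDistribution_toLp_eq,
      Lp.toTemperedDistribution_toLp_eq,
      fourierMultiplierCLM_toTemperedDistributionCLM_eq (by fun_prop)]
  refine ⟨φ, h1, ?_⟩
  apply toTempered_injective
  rw [← h1, ← laplacian_freeResolvent, h1, Lp.toTemperedDistribution_toLp_eq,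
    Lp.toTemperedDistribution_toLp_eq, laplacian_toTemperedDistributionCLM_eq]

section Abstract

variable {H : Type*} [NormedAddCommGroup H] [InnerProductSpace ℂ H] [CompleteSpace H]

open ComplexOrder in
/-- If `S` is a positive operator that inverts `T + μ` and satisfies `μ S² ≤ S`, then the spectrum
of `T` lies in `[0, ∞)`: for `z` outside, `(T - z)⁻¹ = S (1 - (z + μ) S)⁻¹`. -/
theorem spectrum_subset_of_inverse (T : H →ₗ.[ℂ] H) (S : H →L[ℂ] H) {μ : ℝ} (hμ : 0 < μ)
    (hreal : ∀ f, ((inner ℂ (S f) f).re : ℂ) = inner ℂ (S f) f)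
    (hS : ∀ f, μ * ‖S f‖ ^ 2 ≤ (inner ℂ (S f) f).re)
    (h1 : ∀ f, ∃ h : S f ∈ T.domain, T ⟨S f, h⟩ + (μ : ℂ) • S f = f)
    (h2 : ∀ u : T.domain, S (T u + (μ : ℂ) • (u : H)) = u) :
    spectrum T ⊆ (fun E : ℝ => (E : ℂ)) '' Ici 0 := by
  intro z hz
  by_contra hneg
  apply hz
  have hpos : S.IsPositive := by
    rw [ContinuousLinearMap.isPositive_iff_complex]
    exact fun f => ⟨hreal f, (by positivity : 0 ≤ μ * ‖S f‖ ^ 2).trans (hS f)⟩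
  have hnorm : ‖S‖ ≤ μ⁻¹ := by
    refine S.opNorm_le_bound (by positivity) fun f => ?_
    rw [inv_mul_eq_div, le_div_iff₀ hμ]
    by_cases h0 : ‖S f‖ = 0
    · rw [h0, zero_mul]
      exact norm_nonneg f
    · have hp : 0 < ‖S f‖ := lt_of_le_of_ne (norm_nonneg _) (Ne.symm h0)
      have h3 : μ * ‖S f‖ ^ 2 ≤ ‖S f‖ * ‖f‖ :=
        (hS f).trans ((Complex.re_le_norm _).trans (norm_inner_le_norm _ _))
      nlinarith
  have hunit : IsUnit (1 - (z + μ) • S) := by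
    by_cases hw : z + μ = 0
    · rw [hw, zero_smul, sub_zero]
      exact isUnit_one
    -- The spectrum of `S` lies in `[0, μ⁻¹]`; there `(z + μ)⁻¹ = r` would mean `z = r⁻¹ - μ ≥ 0`.
    · have hnot : (z + μ)⁻¹ ∉ _root_.spectrum ℂ S := by
        intro hmem
        have hn := (spectrum.norm_le_norm_mul_of_mem hmem).trans
          (mul_le_mul hnorm ContinuousLinearMap.norm_id_le (norm_nonneg _) (by positivity))
        have hre := (IsSelfAdjoint.mem_spectrum_eq_re hpos.isSelfAdjoint hmem)
        have hnn := spectrum_nonneg_of_nonneg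
          ((ContinuousLinearMap.nonneg_iff_isPositive S).mpr hpos) hmem
        set r := ((z + μ)⁻¹).re with hr
        rw [hre, Complex.norm_real, mul_one] at hn
        rw [hre] at hnn
        have hr0 : 0 ≤ r := by exact_mod_cast hnn
        have hrne : r ≠ 0 := by
          intro h
          rw [h, Complex.ofReal_zero, inv_eq_zero] at hre
          exact hw hre
        have hrpos : 0 < r := lt_of_le_of_ne hr0 hrne.symm
        rw [Real.norm_eq_abs, abs_of_nonneg hr0] at hn
        have hge : μ ≤ r⁻¹ := by
          rw [← inv_inv μ]
          exact inv_anti₀ hrpos hn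
        refine hneg ⟨r⁻¹ - μ, sub_nonneg.mpr hge, ?_⟩
        push_cast
        rw [← hre, inv_inv]
        ring
      rw [spectrum.notMem_iff] at hnot
      have hu : IsUnit ((z + μ) • (algebraMap ℂ (H →L[ℂ] H) (z + μ)⁻¹ - S)) :=
        hnot.smul (Units.mk0 _ hw)
      have e : (z + μ) • (algebraMap ℂ (H →L[ℂ] H) (z + μ)⁻¹ - S) = 1 - (z + μ) • S := by
        rw [smul_sub, Algebra.algebraMap_eq_smul_one, smul_smul, mul_inv_cancel₀ hw, one_smul]
      rwa [e] at hu
  obtain ⟨V, hV⟩ := hunit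
  set U : H →L[ℂ] H := ((V⁻¹ : (H →L[ℂ] H)ˣ) : H →L[ℂ] H) with hU
  have hVU : ∀ f, U f - (z + μ) • S (U f) = f := fun f => by
    have : (1 - (z + μ) • S) * U = 1 := by rw [← hV, hU, Units.mul_inv]
    exact congrArg (fun A : H →L[ℂ] H => A f) this
  have hUV : ∀ f, U (f - (z + μ) • S f) = f := fun f => by
    have : U * (1 - (z + μ) • S) = 1 := by rw [← hV, hU, Units.inv_mul]
    exact congrArg (fun A : H →L[ℂ] H => A f) this
  refine ⟨S * U, fun f => ?_, fun u => ?_⟩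
  · obtain ⟨hd, he⟩ := h1 (U f)
    refine ⟨hd, ?_⟩
    change T ⟨S (U f), hd⟩ - z • S (U f) = f
    have h3 := hVU f
    rw [add_smul, ← sub_sub] at h3
    rw [eq_sub_of_add_eq he, sub_right_comm, h3]
  · have h3 : U (T u - z • (u : H)) = T u + (μ : ℂ) • (u : H) := by
      rw [← hUV (T u + (μ : ℂ) • (u : H)), h2 u, add_smul]
      congr 1
      abel
    change S (U _) = _
    rw [h3, h2]

end Abstract

section Potential

variable {W : ℝ → ℝ}

theorem mem_schrodingerDomain (hW : Continuous W) (hW1 : ∀ x, |W x| ≤ 1)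
    {u : L2} (hu : TemperedDistribution.MemSobolev 2 2 (u : 𝓢'(ℝ, ℂ))) :
    u ∈ (schrodinger W).domain :=
  ⟨hu, (memLp_congr_ae (coeFn_potentialCLM hW hW1 u)).mp (Lp.memLp _)⟩

/-- On the range of the free resolvent `(1 - Δ / μ)⁻¹`, the operator `-Δ + W + μ` is bounded in
terms of the preimage. -/
theorem schrodinger_add_freeResolvent (hW : Continuous W) (hW1 : ∀ x, |W x| ≤ 1)
    (g : L2) (h : freeResolvent g ∈ (schrodinger W).domain) :
    schrodinger W ⟨freeResolvent g, h⟩ + (besselConst : ℂ) • freeResolvent g =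
      (besselConst : ℂ) • g + potentialCLM hW hW1 (freeResolvent g) := by
  have hsec : secondDeriv (⟨freeResolvent g, h⟩ : schrodingerDomain W) =
      (besselConst : ℂ) • (freeResolvent g - g) :=
    toTempered_injective (by rw [← secondDeriv_spec, ← laplacian_freeResolvent])
  have hpot : potentialMul (⟨freeResolvent g, h⟩ : schrodingerDomain W) =
      potentialCLM hW hW1 (freeResolvent g) := by
    apply Lp.ext
    have h5 := MemLp.coeFn_toLp (⟨freeResolvent g, h⟩ : schrodingerDomain W).2.2
    filter_upwards [h5, coeFn_potentialCLM hW hW1 (freeResolvent g)] with x h6 h7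
    rw [potentialMul, h6, h7]
  change -secondDeriv (⟨freeResolvent g, h⟩ : schrodingerDomain W) +
    potentialMul (⟨freeResolvent g, h⟩ : schrodingerDomain W) + _ = _
  rw [hsec, hpot, smul_sub]
  abel

/-- The energy inequality, transported by the free resolvent from Schwartz functions to `L²`. -/
theorem inner_freeResolvent (hW : Continuous W) (hW1 : ∀ x, |W x| ≤ 1)
    {q q' : ℝ → ℝ}
    (hq : ∀ x, HasDerivAt q (q' x) x) (hqb : ∃ B, ∀ x, |q x| ≤ B)
    (hqW : ∀ x, q' x + q x ^ 2 ≤ W x) (g : L2) :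
    (inner ℂ (freeResolvent g)
      ((besselConst : ℂ) • g + potentialCLM hW hW1 (freeResolvent g))).im = 0 ∧
    besselConst * ‖freeResolvent g‖ ^ 2 ≤ (inner ℂ (freeResolvent g)
      ((besselConst : ℂ) • g + potentialCLM hW hW1 (freeResolvent g))).re := by
  have hcl : IsClosed {g : L2 | (inner ℂ (freeResolvent g)
      ((besselConst : ℂ) • g + potentialCLM hW hW1 (freeResolvent g))).im = 0 ∧
    besselConst * ‖freeResolvent g‖ ^ 2 ≤ (inner ℂ (freeResolvent g)
      ((besselConst : ℂ) • g + potentialCLM hW hW1 (freeResolvent g))).re} := by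
    have hc : Continuous fun g : L2 => inner ℂ (freeResolvent g)
      ((besselConst : ℂ) • g + potentialCLM hW hW1 (freeResolvent g)) := by fun_prop
    exact (isClosed_eq (Complex.continuous_im.comp hc) continuous_const).inter
      (isClosed_le (by fun_prop) (Complex.continuous_re.comp hc))
  have hd : Dense (range (SchwartzMap.toLpCLM ℝ ℂ 2 (volume : Measure ℝ))) :=
    SchwartzMap.denseRange_toLpCLM ENNReal.ofNat_ne_top
  refine hcl.closure_subset_iff.mpr ?_ (hd g)
  rintro _ ⟨g, rfl⟩
  rw [SchwartzMap.toLpCLM_apply]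
  obtain ⟨φ, h1, h2⟩ := exists_schwartz_freeResolvent g
  have e : (besselConst : ℂ) • (g.toLp 2 : L2) + potentialCLM hW hW1 (φ.toLp 2) =
      (-((Δ φ).toLp 2 : L2) + potentialCLM hW hW1 (φ.toLp 2)) +
        (besselConst : ℂ) • (φ.toLp 2 : L2) := by
    rw [h2, smul_sub]
    abel
  rw [Set.mem_ofPred_eq, h1, e, inner_add_right, inner_schwartz, inner_smul_right,
    inner_self_eq_norm_sq_to_K]
  have hen := energy_nonneg φ hW hW1 hq hqb hqW
  constructor
  · simp [← Complex.ofReal_pow]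
  · simpa [← Complex.ofReal_pow] using hen

/-- If `W ≥ q' + q²` for a bounded function `q`, the spectrum of `-Δ + W` lies in `[0, ∞)`. -/
theorem spectrum_schrodinger_subset (hW : Continuous W) (hW1 : ∀ x, |W x| ≤ 1)
    {q q' : ℝ → ℝ}
    (hq : ∀ x, HasDerivAt q (q' x) x) (hqb : ∃ B, ∀ x, |q x| ≤ B)
    (hqW : ∀ x, q' x + q x ^ 2 ≤ W x) :
    spectrum (schrodinger W) ⊆ (fun E : ℝ => (E : ℂ)) '' Ici 0 := by
  have hμ := one_lt_besselConst
  have hμ0 : (besselConst : ℂ) ≠ 0 := by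
    have : besselConst ≠ 0 := by linarith
    exact_mod_cast this
  set M := potentialCLM hW hW1 with hM
  -- `A = μ + W (1 - Δ / μ)⁻¹` is invertible by a Neumann series.
  have hunit : IsUnit ((besselConst : ℂ) • (1 : L2 →L[ℂ] L2) + M * freeResolvent) := by
    have h1 : ‖-((besselConst : ℂ)⁻¹ • (M * freeResolvent))‖ < 1 := by
      rw [norm_neg, norm_smul, norm_inv, Complex.norm_real, Real.norm_eq_abs,
        abs_of_pos (by linarith)]
      have h2 : ‖M * freeResolvent‖ ≤ 1 * 1 := (norm_mul_le _ _).trans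
        (mul_le_mul (norm_potentialCLM_le hW hW1) norm_freeResolvent_le (norm_nonneg _) zero_le_one)
      calc besselConst⁻¹ * ‖M * freeResolvent‖ ≤ besselConst⁻¹ * (1 * 1) := by gcongr
        _ < 1 := by
          rw [mul_one, mul_one]
          exact inv_lt_one_of_one_lt₀ hμ
    have h3 : IsUnit ((besselConst : ℂ) • (1 - -((besselConst : ℂ)⁻¹ • (M * freeResolvent)))) :=
      (isUnit_one_sub_of_norm_lt_one h1).smul (Units.mk0 _ hμ0)
    have e : (besselConst : ℂ) • (1 - -((besselConst : ℂ)⁻¹ • (M * freeResolvent))) =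
        (besselConst : ℂ) • (1 : L2 →L[ℂ] L2) + M * freeResolvent := by
      rw [sub_neg_eq_add, smul_add, smul_smul, mul_inv_cancel₀ hμ0, one_smul]
    rwa [e] at h3
  obtain ⟨V, hV⟩ := hunit
  set U : L2 →L[ℂ] L2 := ((V⁻¹ : (L2 →L[ℂ] L2)ˣ) : L2 →L[ℂ] L2) with hU
  have hVU : ∀ f, (besselConst : ℂ) • U f + M (freeResolvent (U f)) = f := fun f => by
    have : ((besselConst : ℂ) • (1 : L2 →L[ℂ] L2) + M * freeResolvent) * U = 1 := by
      rw [← hV, hU, Units.mul_inv]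
    exact congrArg (fun A : L2 →L[ℂ] L2 => A f) this
  have hUV : ∀ f, U ((besselConst : ℂ) • f + M (freeResolvent f)) = f := fun f => by
    have : U * ((besselConst : ℂ) • (1 : L2 →L[ℂ] L2) + M * freeResolvent) = 1 := by
      rw [← hV, hU, Units.inv_mul]
    exact congrArg (fun A : L2 →L[ℂ] L2 => A f) this
  have hkey : ∀ f, (inner ℂ (freeResolvent (U f)) f).im = 0 ∧
      besselConst * ‖freeResolvent (U f)‖ ^ 2 ≤ (inner ℂ (freeResolvent (U f)) f).re := fun f => by
    have := inner_freeResolvent hW hW1 hq hqb hqW (U f)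
    rwa [hVU] at this
  refine spectrum_subset_of_inverse (schrodinger W) (freeResolvent * U)
    (μ := besselConst) (by linarith) (fun f => ?_) (fun f => (hkey f).2) (fun f => ?_) fun u => ?_
  · exact Complex.ext rfl (by simpa using (hkey f).1.symm)
  · refine ⟨mem_schrodingerDomain hW hW1 (memSobolev_freeResolvent _), ?_⟩
    exact (schrodinger_add_freeResolvent hW hW1 (U f) _).trans (hVU f)
  · obtain ⟨u, hu⟩ := u
    obtain ⟨g, rfl⟩ := exists_freeResolvent_of_memSobolev hu.1
    change freeResolvent (U (schrodinger W ⟨freeResolvent g, hu⟩ + _ • freeResolvent g)) =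
      freeResolvent g
    rw [schrodinger_add_freeResolvent hW hW1, hUV]

end Potential

/-! ### Density of the eigenvalues -/

theorem freq_half_sq (m : ℕ+ → ℕ+) (n : ℕ+) :
    (m n : ℝ) ^ 2 / (4 * (n : ℝ) ^ 2) = (freq m n / 2) ^ 2 := by
  rw [freq]
  ring

theorem Schedule.mem_pointSpectrum {m : ℕ+ → ℕ+} (S : Schedule m) (n : ℕ+) :
    (((m n : ℝ) ^ 2 / (4 * (n : ℝ) ^ 2) : ℝ) : ℂ) ∈ pointSpectrum (schrodinger S.potential) := by
  obtain ⟨u, v, hu, hv, hC, hv0⟩ := S.exists_decaying_solution n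
  rw [freq_half_sq]
  exact mem_pointSpectrum_of_solution S.contDiff_potential.continuous S.abs_potential_le hu hv hC hv0

/-- The squares of the halves of the positive rationals are dense in the half-line. -/
theorem image_Ici_subset_closure {m : ℕ+ → ℕ+}
    (hm : {q : ℚ | 0 < q} = range (fun n : ℕ+ => ((m n : ℕ) : ℚ) / ((n : ℕ) : ℚ))) {P : Set ℂ}
    (hP : ∀ n : ℕ+, (((m n : ℝ) ^ 2 / (4 * (n : ℝ) ^ 2) : ℝ) : ℂ) ∈ P) :
    (fun E : ℝ => (E : ℂ)) '' Ici 0 ⊆ closure P := by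
  rintro _ ⟨E, hE, rfl⟩
  have hE' : (2 * √E / 2) ^ 2 = E := by
    rw [mul_div_cancel_left₀ _ two_ne_zero, Real.sq_sqrt hE]
  have hc : Continuous fun t : ℝ => (((t / 2) ^ 2 : ℝ) : ℂ) := by fun_prop
  have hmem : 2 * √E ∈ closure {t : ℝ | (((t / 2) ^ 2 : ℝ) : ℂ) ∈ P} := by
    refine Metric.mem_closure_iff.mpr fun ε hε => ?_
    obtain ⟨q, hq1, hq2⟩ := exists_rat_btwn (show 2 * √E < 2 * √E + ε by linarith)
    have hq0 : 0 < q := by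
      have : (0 : ℝ) < q := (by positivity : 0 ≤ 2 * √E).trans_lt hq1
      exact_mod_cast this
    obtain ⟨n, hn⟩ : q ∈ range (fun n : ℕ+ => ((m n : ℕ) : ℚ) / ((n : ℕ) : ℚ)) := hm ▸ hq0
    have hfreq : freq m n = q := by
      rw [freq, ← hn]
      push_cast
      rfl
    refine ⟨q, ?_, ?_⟩
    · have := hP n
      rwa [freq_half_sq, hfreq] at this
    · rw [Real.dist_eq, abs_sub_lt_iff]
      constructor <;> linarith
  have h := image_closure_subset_closure_image hc ⟨_, hmem, rfl⟩
  simp only [hE'] at h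
  refine closure_mono ?_ h
  rintro _ ⟨t, ht, rfl⟩
  exact ht

end LimitPeriodic

theorem theoremB2 (m : ℕ+ → ℕ+) :
    ∃ W : ℝ → ℝ,
      ContDiff ℝ ∞ W ∧
      LimitPeriodic.LimitPeriodicHypotheses m 0 W ∧
      (∀ n : ℕ+, (((m n : ℝ) ^ 2 / (4 * (n : ℝ) ^ 2) : ℝ) : ℂ) ∈
        LimitPeriodic.pointSpectrum (LimitPeriodic.schrodinger W)) ∧
      ({q : ℚ | 0 < q} = Set.range (fun n : ℕ+ => ((m n : ℕ) : ℚ) / ((n : ℕ) : ℚ)) →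
        (fun E : ℝ => (E : ℂ)) '' Set.Ici 0 ⊆
          closure (LimitPeriodic.pointSpectrum (LimitPeriodic.schrodinger W)) ∧
        LimitPeriodic.spectrum (LimitPeriodic.schrodinger W) ⊆
          closure (LimitPeriodic.pointSpectrum (LimitPeriodic.schrodinger W))) := by
  obtain ⟨S⟩ := LimitPeriodic.nonempty_schedule m
  obtain ⟨q, q', hq, hqb, hqW⟩ := S.exists_riccati
  refine ⟨S.potential, S.contDiff_potential, ⟨LimitPeriodic.isLimitPeriodicCoefficient_zero m,
    S.isLimitPeriodicCoefficient_potential⟩, S.mem_pointSpectrum, fun hm => ?_⟩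
  have hdense := LimitPeriodic.image_Ici_subset_closure hm S.mem_pointSpectrum
  exact ⟨hdense, (LimitPeriodic.spectrum_schrodinger_subset S.contDiff_potential.continuous
    S.abs_potential_le hq hqb hqW).trans hdense⟩
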